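/- Let $S$ be a site. Let $A, B, P$ be complexes of abelian sheaves on $S$ concentrated in degrees $-2,-1,0$ (cohomological grading), and let $f\colon A\to P$ and $g\colon B\to P$ be morphisms of complexes. For a complex $K$ of abelian sheaves in degrees $-2,-1,0$, let $2st(K)$ be the Picard $2$-stack associated with $K$, i.e. the $2$-stack associated with the $2$-prestack whose objects over $U$ are the sections of $K^0(U)$, whose $1$-arrows $x\to y$ are the $m\in K^{-1}(U)$ with $dm=y-x$, and whose $2$-arrows $m\to m'$ are the $\theta\in K^{-2}(U)$ with $d\theta=m'-m$, the group-like structure being induced by addition. It can be computed by any injective resolution $K\to I$ with $I^i=0$ for $i<-2$: an object of $2st(K)$ over $U$ is an $x\in I^0(U)$ with $dx=0$, a $1$-arrow $x\to y$ is an $m\in I^{-1}(U)$ with $dm=y-x$, and a $2$-arrow $m\to m'$ is a $\theta\in I^{-2}(U)$ with $d\theta=m'-m$. Let $F\colon 2st(A)\to 2st(P)$ and $G\colon 2st(B)\to 2st(P)$ be the additive $2$-functors induced by $f$ and $g$, i.e. by morphisms between the injective resolutions that represent $f$ and $g$ up to homotopy. Let $2st(A)\times_{2st(P)}2st(B)$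 be the fibered product: its objects over $U$ are triples $(X,l,Y)$ with $X\in 2st(A)(U)$, $Y\in 2st(B)(U)$ and $l\colon F(X)\to G(Y)$ a $1$-arrow of $2st(P)(U)$; its $1$-arrows $(X_1,l_1,Y_1)\to(X_2,l_2,Y_2)$ are triples $(m,\alpha,n)$ with $m\colon X_1\to X_2$, $n\colon Y_1\to Y_2$ and a $2$-arrow $\alpha\colon l_2\circ F(m)\Rightarrow G(n)\circ l_1$; its $2$-arrows $(m,\alpha,n)\Rightarrow(m',\alpha',n')$ are pairs $(\theta\colon m\Rightarrow m',\ \phi\colon n\Rightarrow n')$ with $\alpha'\circ(l_2*F(\theta))=(G(\phi)*l_1)\circ\alpha$; its group-like structure is componentwise. Put $$A\times_P B:=\tau_{\le 0}\bigl(\mathrm{MC}(f-g)[-1]\bigr),$$ where $\mathrm{MC}(f-g)$ is the mapping cone of $f-g\colon A\oplus B\to P$. Then $2st(A)$, $2st(B)$, $2st(P)$, $2st(A\times_P B)$, computed by arbitrary such injective resolutions, are Picard $2$-stacks and are the $2$-stacks associated with the $2$-prestacks of $A$, $B$, $P$, $A\times_P B$; the fibered product $2st(A)\times_{2st(P)}2st(B)$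 is a Picard $2$-stack; and there is an additive $2$-functor $$2st(A\times_P B)\longrightarrow 2st(A)\times_{2st(P)}2st(B)$$ that is an equivalence of $2$-stacks. -/

import Mathlib

open CategoryTheory Category Limits Opposite Bicategory

universe v u w a b w' a' b' w'' a'' b''

/-- Objects of the total 2-category of a family of objects indexed by the objects of `C`. -/
structure Tot {C : Type u} (Obj : C → Type w) where
  base : C
  pt : Obj base

/-- A 2-category fibred over `C`, with weak composition (bicategories): a family `Obj U` of objects
over every `U : C`, a bicategory on the total collection of objects, and a strict projection of
1-arrows to `C` (2-arrows are vertical). The fibre over `U` consists of the 1-arrows that are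
projected to `𝟙 U`. Liftings along morphisms of `C` are required in `IsFibredInGroupoids`. -/
structure FibTwoCat (C : Type u) [Category.{v} C] where
  Obj : C → Type w
  bicat : Bicategory.{b, a} (Tot Obj)
  proj {X Y : Tot Obj} (f : X ⟶ Y) : X.base ⟶ Y.base
  proj_id (X : Tot Obj) : proj (𝟙 X) = 𝟙 X.base
  proj_comp {X Y Z : Tot Obj} (f : X ⟶ Y) (g : Y ⟶ Z) : proj (f ≫ g) = proj f ≫ proj g
  proj_eq {X Y : Tot Obj} {f g : X ⟶ Y} (η : f ⟶ g) : proj f = proj g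

attribute [instance] FibTwoCat.bicat
attribute [simp] FibTwoCat.proj_id FibTwoCat.proj_comp

section

variable {C : Type u} [Category.{v} C]

/-- A 2-functor (pseudofunctor) over `C`. -/
structure FibFunctor (P : FibTwoCat.{v, u, w, a, b} C) (Q : FibTwoCat.{v, u, w', a', b'} C) where
  obj {U : C} (x : P.Obj U) : Q.Obj U
  map {X Y : Tot P.Obj} (f : X ⟶ Y) :
    (Tot.mk X.base (obj X.pt) : Tot Q.Obj) ⟶ Tot.mk Y.base (obj Y.pt)
  proj_map {X Y : Tot P.Obj} (f : X ⟶ Y) : Q.proj (map f) = P.proj f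
  map₂ {X Y : Tot P.Obj} {f g : X ⟶ Y} (η : f ⟶ g) : map f ⟶ map g
  mapId (X : Tot P.Obj) : map (𝟙 X) ≅ 𝟙 (Tot.mk X.base (obj X.pt))
  mapComp {X Y Z : Tot P.Obj} (f : X ⟶ Y) (g : Y ⟶ Z) : map (f ≫ g) ≅ map f ≫ map g
  map₂_id {X Y : Tot P.Obj} (f : X ⟶ Y) : map₂ (𝟙 f) = 𝟙 (map f)
  map₂_comp {X Y : Tot P.Obj} {f g h : X ⟶ Y} (η : f ⟶ g) (θ : g ⟶ h) :
    map₂ (η ≫ θ) = map₂ η ≫ map₂ θ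
  map₂_whisker_left {X Y Z : Tot P.Obj} (f : X ⟶ Y) {g h : Y ⟶ Z} (η : g ⟶ h) :
    map₂ (f ◁ η) = (mapComp f g).hom ≫ map f ◁ map₂ η ≫ (mapComp f h).inv
  map₂_whisker_right {X Y Z : Tot P.Obj} {f g : X ⟶ Y} (η : f ⟶ g) (h : Y ⟶ Z) :
    map₂ (η ▷ h) = (mapComp f h).hom ≫ map₂ η ▷ map h ≫ (mapComp g h).inv
  map₂_associator {X Y Z W : Tot P.Obj} (f : X ⟶ Y) (g : Y ⟶ Z) (h : Z ⟶ W) :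
    map₂ (α_ f g h).hom = (mapComp (f ≫ g) h).hom ≫ (mapComp f g).hom ▷ map h ≫
      (α_ (map f) (map g) (map h)).hom ≫ map f ◁ (mapComp g h).inv ≫ (mapComp f (g ≫ h)).inv
  map₂_left_unitor {X Y : Tot P.Obj} (f : X ⟶ Y) :
    map₂ (λ_ f).hom = (mapComp (𝟙 X) f).hom ≫ (mapId X).hom ▷ map f ≫ (λ_ (map f)).hom
  map₂_right_unitor {X Y : Tot P.Obj} (f : X ⟶ Y) :
    map₂ (ρ_ f).hom = (mapComp f (𝟙 Y)).hom ≫ map f ◁ (mapId Y).hom ≫ (ρ_ (map f)).hom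

namespace FibFunctor

variable {P : FibTwoCat.{v, u, w, a, b} C} {Q : FibTwoCat.{v, u, w', a', b'} C}
  {R : FibTwoCat.{v, u, w'', a'', b''} C}

def toPseudofunctor (F : FibFunctor P Q) : Pseudofunctor (Tot P.Obj) (Tot Q.Obj) where
  obj X := Tot.mk X.base (F.obj X.pt)
  map := F.map
  map₂ := F.map₂
  map₂_id := F.map₂_id
  map₂_comp := F.map₂_comp
  mapId := F.mapId
  mapComp := F.mapComp
  map₂_whisker_left := F.map₂_whisker_left
  map₂_whisker_right := F.map₂_whisker_right
  map₂_associator := F.map₂_associator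
  map₂_left_unitor := F.map₂_left_unitor
  map₂_right_unitor := F.map₂_right_unitor

def comp (F : FibFunctor P Q) (G : FibFunctor Q R) : FibFunctor P R where
  obj x := G.obj (F.obj x)
  map f := G.map (F.map f)
  proj_map f := by rw [G.proj_map, F.proj_map]
  map₂ η := G.map₂ (F.map₂ η)
  mapId X := (F.toPseudofunctor.comp G.toPseudofunctor).mapId X
  mapComp f g := (F.toPseudofunctor.comp G.toPseudofunctor).mapComp f g
  map₂_id := (F.toPseudofunctor.comp G.toPseudofunctor).map₂_id
  map₂_comp := (F.toPseudofunctor.comp G.toPseudofunctor).map₂_comp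
  map₂_whisker_left := (F.toPseudofunctor.comp G.toPseudofunctor).map₂_whisker_left
  map₂_whisker_right := (F.toPseudofunctor.comp G.toPseudofunctor).map₂_whisker_right
  map₂_associator := (F.toPseudofunctor.comp G.toPseudofunctor).map₂_associator
  map₂_left_unitor := (F.toPseudofunctor.comp G.toPseudofunctor).map₂_left_unitor
  map₂_right_unitor := (F.toPseudofunctor.comp G.toPseudofunctor).map₂_right_unitor

def map₂Iso (F : FibFunctor P Q) {X Y : Tot P.Obj} {f g : X ⟶ Y} (η : f ≅ g) :
    F.map f ≅ F.map g where
  hom := F.map₂ η.hom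
  inv := F.map₂ η.inv
  hom_inv_id := by rw [← F.map₂_comp, η.hom_inv_id, F.map₂_id]
  inv_hom_id := by rw [← F.map₂_comp, η.inv_hom_id, F.map₂_id]

end FibFunctor

/-! ### Products -/

namespace FibTwoCat
variable (P : FibTwoCat.{v, u, w, a, b} C) (Q : FibTwoCat.{v, u, w', a', b'} C)

/-- 1-arrows of the product `P ×_C Q`. -/
structure ProdHom (X Y : Tot fun U => P.Obj U × Q.Obj U) where
  fst : Tot.mk X.base X.pt.1 ⟶ Tot.mk Y.base Y.pt.1
  snd : Tot.mk X.base X.pt.2 ⟶ Tot.mk Y.base Y.pt.2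
  eq : P.proj fst = Q.proj snd

@[ext]
structure ProdHom₂ {P : FibTwoCat.{v, u, w, a, b} C} {Q : FibTwoCat.{v, u, w', a', b'} C}
    {X Y : Tot fun U => P.Obj U × Q.Obj U} (f g : ProdHom P Q X Y) where
  fst : f.fst ⟶ g.fst
  snd : f.snd ⟶ g.snd

instance (X Y : Tot fun U => P.Obj U × Q.Obj U) : Category (ProdHom P Q X Y) where
  Hom := ProdHom₂
  id f := ⟨𝟙 _, 𝟙 _⟩
  comp η θ := ⟨η.fst ≫ θ.fst, η.snd ≫ θ.snd⟩
  id_comp _ := by ext <;> simp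
  comp_id _ := by ext <;> simp
  assoc _ _ _ := by ext <;> simp

variable {P Q} in
@[ext] lemma prodHom₂_ext {X Y : Tot fun U => P.Obj U × Q.Obj U} {f g : ProdHom P Q X Y}
    {η θ : f ⟶ g} (h : η.fst = θ.fst) (h' : η.snd = θ.snd) : η = θ := ProdHom₂.ext h h'

variable {P Q} in
@[simps] def prodIso {X Y : Tot fun U => P.Obj U × Q.Obj U} {f g : ProdHom P Q X Y}
    (η : f.fst ≅ g.fst) (θ : f.snd ≅ g.snd) : f ≅ g where
  hom := ⟨η.hom, θ.hom⟩
  inv := ⟨η.inv, θ.inv⟩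
  hom_inv_id := by apply ProdHom₂.ext; exacts [η.hom_inv_id, θ.hom_inv_id]
  inv_hom_id := by apply ProdHom₂.ext; exacts [η.inv_hom_id, θ.inv_hom_id]

section
variable {P Q} {X Y : Tot fun U => P.Obj U × Q.Obj U} {f g h : ProdHom P Q X Y}
@[simp] lemma prod_id_fst : ProdHom₂.fst (𝟙 f) = 𝟙 f.fst := rfl
@[simp] lemma prod_id_snd : ProdHom₂.snd (𝟙 f) = 𝟙 f.snd := rfl
@[simp] lemma prod_comp_fst (η : f ⟶ g) (θ : g ⟶ h) : (η ≫ θ).fst = η.fst ≫ θ.fst := rfl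
@[simp] lemma prod_comp_snd (η : f ⟶ g) (θ : g ⟶ h) : (η ≫ θ).snd = η.snd ≫ θ.snd := rfl
end

instance prodBicat : Bicategory (Tot fun U => P.Obj U × Q.Obj U) where
  Hom := ProdHom P Q
  id X := ⟨𝟙 _, 𝟙 _, by simp⟩
  comp f g := ⟨f.fst ≫ g.fst, f.snd ≫ g.snd, by simp [f.eq, g.eq]⟩
  homCategory X Y := inferInstance
  whiskerLeft f _ _ η := ⟨f.fst ◁ η.fst, f.snd ◁ η.snd⟩
  whiskerRight η h := ⟨η.fst ▷ h.fst, η.snd ▷ h.snd⟩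
  associator f g h := prodIso (α_ _ _ _) (α_ _ _ _)
  leftUnitor f := prodIso (λ_ _) (λ_ _)
  rightUnitor f := prodIso (ρ_ _) (ρ_ _)
  whiskerLeft_id _ _ := ProdHom₂.ext (whiskerLeft_id _ _) (whiskerLeft_id _ _)
  whiskerLeft_comp _ _ _ _ _ _ := ProdHom₂.ext (whiskerLeft_comp _ _ _) (whiskerLeft_comp _ _ _)
  id_whiskerLeft _ := ProdHom₂.ext (id_whiskerLeft _) (id_whiskerLeft _)
  comp_whiskerLeft _ _ _ _ _ := ProdHom₂.ext (comp_whiskerLeft _ _ _) (comp_whiskerLeft _ _ _)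
  id_whiskerRight _ _ := ProdHom₂.ext (id_whiskerRight _ _) (id_whiskerRight _ _)
  comp_whiskerRight _ _ _ := ProdHom₂.ext (comp_whiskerRight _ _ _) (comp_whiskerRight _ _ _)
  whiskerRight_id _ := ProdHom₂.ext (whiskerRight_id _) (whiskerRight_id _)
  whiskerRight_comp _ _ _ := ProdHom₂.ext (whiskerRight_comp _ _ _) (whiskerRight_comp _ _ _)
  whisker_assoc _ _ _ _ _ := ProdHom₂.ext (whisker_assoc _ _ _) (whisker_assoc _ _ _)
  whisker_exchange _ _ := ProdHom₂.ext (whisker_exchange _ _) (whisker_exchange _ _)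
  pentagon _ _ _ _ := ProdHom₂.ext (pentagon _ _ _ _) (pentagon _ _ _ _)
  triangle _ _ := ProdHom₂.ext (triangle _ _) (triangle _ _)

abbrev prod : FibTwoCat C where
  Obj U := P.Obj U × Q.Obj U
  bicat := prodBicat P Q
  proj f := P.proj f.fst
  proj_id X := P.proj_id _
  proj_comp f g := P.proj_comp _ _
  proj_eq η := P.proj_eq η.fst

end FibTwoCat

/-- The data of a transformation of 2-functors over `C` that is vertical: 1-arrows `F x ⟶ G x` in
the fibres with invertible naturality 2-arrows. -/
structure PreTrans {P : FibTwoCat.{v, u, w, a, b} C} {Q : FibTwoCat.{v, u, w', a', b'} C}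
    (F G : FibFunctor P Q) where
  app {U : C} (x : P.Obj U) : (Tot.mk U (F.obj x) : Tot Q.Obj) ⟶ Tot.mk U (G.obj x)
  proj_app {U : C} (x : P.Obj U) : Q.proj (app x) = 𝟙 U
  nat {X Y : Tot P.Obj} (f : X ⟶ Y) : F.map f ≫ app Y.pt ≅ app X.pt ≫ G.map f

/-- A vertical strong transformation of 2-functors over `C`. -/
structure FibTrans {P : FibTwoCat.{v, u, w, a, b} C} {Q : FibTwoCat.{v, u, w', a', b'} C}
    (F G : FibFunctor P Q) extends PreTrans F G where
  naturality {X Y : Tot P.Obj} {f g : X ⟶ Y} (η : f ⟶ g) :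
    F.map₂ η ▷ app Y.pt ≫ (nat g).hom = (nat f).hom ≫ app X.pt ◁ G.map₂ η
  nat_id (X : Tot P.Obj) : (nat (𝟙 X)).hom ≫ app X.pt ◁ (G.mapId X).hom =
    (F.mapId X).hom ▷ app X.pt ≫ (λ_ (app X.pt)).hom ≫ (ρ_ (app X.pt)).inv
  nat_comp {X Y Z : Tot P.Obj} (f : X ⟶ Y) (g : Y ⟶ Z) :
    (nat (f ≫ g)).hom ≫ app X.pt ◁ (G.mapComp f g).hom =
      (F.mapComp f g).hom ▷ app Z.pt ≫ (α_ _ _ _).hom ≫ F.map f ◁ (nat g).hom ≫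
        (α_ _ _ _).inv ≫ (nat f).hom ▷ G.map g ≫ (α_ _ _ _).hom

/-- Invertible modifications. -/
@[ext]
structure FibMod {P : FibTwoCat.{v, u, w, a, b} C} {Q : FibTwoCat.{v, u, w', a', b'} C}
    {F G : FibFunctor P Q} (s t : PreTrans F G) where
  app {U : C} (x : P.Obj U) : s.app x ≅ t.app x
  naturality {X Y : Tot P.Obj} (f : X ⟶ Y) :
    F.map f ◁ (app Y.pt).hom ≫ (t.nat f).hom = (s.nat f).hom ≫ (app X.pt).hom ▷ G.map f

namespace PreTrans
variable {P : FibTwoCat.{v, u, w, a, b} C} {Q : FibTwoCat.{v, u, w', a', b'} C}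
  {R : FibTwoCat.{v, u, w'', a'', b''} C}

def id (F : FibFunctor P Q) : PreTrans F F where
  app x := 𝟙 _
  proj_app x := Q.proj_id _
  nat f := ρ_ _ ≪≫ (λ_ _).symm

def vcomp {F G H : FibFunctor P Q} (s : PreTrans F G) (t : PreTrans G H) : PreTrans F H where
  app x := s.app x ≫ t.app x
  proj_app x := by rw [Q.proj_comp, s.proj_app, t.proj_app, Category.comp_id]
  nat f := (α_ _ _ _).symm ≪≫ whiskerRightIso (s.nat f) _ ≪≫ α_ _ _ _ ≪≫
    whiskerLeftIso _ (t.nat f) ≪≫ (α_ _ _ _).symm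

def precomp (K : FibFunctor P Q) {F G : FibFunctor Q R} (t : PreTrans F G) :
    PreTrans (K.comp F) (K.comp G) where
  app x := t.app (K.obj x)
  proj_app x := t.proj_app _
  nat f := t.nat (K.map f)

def postcomp {F G : FibFunctor P Q} (t : PreTrans F G) (K : FibFunctor Q R) :
    PreTrans (F.comp K) (G.comp K) where
  app x := K.map (t.app x)
  proj_app x := (K.proj_map _).trans (t.proj_app x)
  nat f := (K.mapComp _ _).symm ≪≫ K.map₂Iso (t.nat f) ≪≫ K.mapComp _ _

end PreTrans

namespace FibFunctor
variable {P : FibTwoCat.{v, u, w, a, b} C} {Q : FibTwoCat.{v, u, w', a', b'} C}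
  {R : FibTwoCat.{v, u, w'', a'', b''} C}

def fst (P : FibTwoCat.{v, u, w, a, b} C) (Q : FibTwoCat.{v, u, w', a', b'} C) :
    FibFunctor (P.prod Q) P where
  obj x := x.1
  map f := f.fst
  proj_map f := rfl
  map₂ η := η.fst
  mapId X := Iso.refl _
  mapComp f g := Iso.refl _
  map₂_id f := rfl
  map₂_comp η θ := rfl
  map₂_whisker_left _ _ _ _ := ((Category.id_comp _).trans (Category.comp_id _)).symm
  map₂_whisker_right _ _ := ((Category.id_comp _).trans (Category.comp_id _)).symm
  map₂_associator f g h := by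
    change (α_ f.fst g.fst h.fst).hom = 𝟙 _ ≫ 𝟙 _ ▷ _ ≫ (α_ _ _ _).hom ≫ _ ◁ 𝟙 _ ≫ 𝟙 _
    simp
  map₂_left_unitor f := by
    change (λ_ f.fst).hom = 𝟙 _ ≫ 𝟙 _ ▷ _ ≫ (λ_ _).hom
    simp
  map₂_right_unitor f := by
    change (ρ_ f.fst).hom = 𝟙 _ ≫ _ ◁ 𝟙 _ ≫ (ρ_ _).hom
    simp

def snd (P : FibTwoCat.{v, u, w, a, b} C) (Q : FibTwoCat.{v, u, w', a', b'} C) :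
    FibFunctor (P.prod Q) Q where
  obj x := x.2
  map f := f.snd
  proj_map f := f.eq.symm
  map₂ η := η.snd
  mapId X := Iso.refl _
  mapComp f g := Iso.refl _
  map₂_id f := rfl
  map₂_comp η θ := rfl
  map₂_whisker_left _ _ _ _ := ((Category.id_comp _).trans (Category.comp_id _)).symm
  map₂_whisker_right _ _ := ((Category.id_comp _).trans (Category.comp_id _)).symm
  map₂_associator f g h := by
    change (α_ f.snd g.snd h.snd).hom = 𝟙 _ ≫ 𝟙 _ ▷ _ ≫ (α_ _ _ _).hom ≫ _ ◁ 𝟙 _ ≫ 𝟙 _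
    simp
  map₂_left_unitor f := by
    change (λ_ f.snd).hom = 𝟙 _ ≫ 𝟙 _ ▷ _ ≫ (λ_ _).hom
    simp
  map₂_right_unitor f := by
    change (ρ_ f.snd).hom = 𝟙 _ ≫ _ ◁ 𝟙 _ ≫ (ρ_ _).hom
    simp

def pair (F : FibFunctor R P) (G : FibFunctor R Q) : FibFunctor R (P.prod Q) where
  obj x := (F.obj x, G.obj x)
  map f := ⟨F.map f, G.map f, by rw [F.proj_map, G.proj_map]⟩
  proj_map f := F.proj_map f
  map₂ η := ⟨F.map₂ η, G.map₂ η⟩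
  mapId X := FibTwoCat.prodIso (F.mapId X) (G.mapId X)
  mapComp f g := FibTwoCat.prodIso (F.mapComp f g) (G.mapComp f g)
  map₂_id f := FibTwoCat.ProdHom₂.ext (F.map₂_id f) (G.map₂_id f)
  map₂_comp η θ := FibTwoCat.ProdHom₂.ext (F.map₂_comp η θ) (G.map₂_comp η θ)
  map₂_whisker_left f _ _ η :=
    FibTwoCat.ProdHom₂.ext (F.map₂_whisker_left f η) (G.map₂_whisker_left f η)
  map₂_whisker_right η h :=
    FibTwoCat.ProdHom₂.ext (F.map₂_whisker_right η h) (G.map₂_whisker_right η h)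
  map₂_associator f g h :=
    FibTwoCat.ProdHom₂.ext (F.map₂_associator f g h) (G.map₂_associator f g h)
  map₂_left_unitor f :=
    FibTwoCat.ProdHom₂.ext (F.map₂_left_unitor f) (G.map₂_left_unitor f)
  map₂_right_unitor f :=
    FibTwoCat.ProdHom₂.ext (F.map₂_right_unitor f) (G.map₂_right_unitor f)

end FibFunctor

def PreTrans.pair {P : FibTwoCat.{v, u, w, a, b} C} {Q : FibTwoCat.{v, u, w', a', b'} C}
    {R : FibTwoCat.{v, u, w'', a'', b''} C} {F G : FibFunctor R P} {F' G' : FibFunctor R Q}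
    (s : PreTrans F G) (t : PreTrans F' G') : PreTrans (F.pair F') (G.pair G') where
  app x := ⟨s.app x, t.app x, (s.proj_app x).trans (t.proj_app x).symm⟩
  proj_app x := s.proj_app x
  nat f := FibTwoCat.prodIso (s.nat f) (t.nat f)

/-! ### Group-like structure -/

section Tensor

variable {P : FibTwoCat.{v, u, w, a, b} C} (T : FibFunctor (P.prod P) P)

/-- The tensor product, for `T`, of two 2-functors with values in `P`. -/
abbrev tens {D : FibTwoCat.{v, u, w', a', b'} C} (F G : FibFunctor D P) : FibFunctor D P :=
  (F.pair G).comp T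

abbrev tensT {D : FibTwoCat.{v, u, w', a', b'} C} {F G F' G' : FibFunctor D P}
    (s : PreTrans F G) (t : PreTrans F' G') : PreTrans (tens T F F') (tens T G G') :=
  (s.pair t).postcomp T

/-- `((X, Y), Z) ↦ (X ⊗ Y) ⊗ Z`. -/
abbrev assocSrc : FibFunctor ((P.prod P).prod P) P :=
  tens T (tens T ((FibFunctor.fst _ _).comp (FibFunctor.fst _ _))
    ((FibFunctor.fst _ _).comp (FibFunctor.snd _ _))) (FibFunctor.snd _ _)

/-- `((X, Y), Z) ↦ X ⊗ (Y ⊗ Z)`. -/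
abbrev assocTgt : FibFunctor ((P.prod P).prod P) P :=
  tens T ((FibFunctor.fst _ _).comp (FibFunctor.fst _ _))
    (tens T ((FibFunctor.fst _ _).comp (FibFunctor.snd _ _)) (FibFunctor.snd _ _))

/-- The instance `(F ⊗ G) ⊗ H ⟶ F ⊗ (G ⊗ H)` of an associator. -/
def tensAssoc (α : PreTrans (assocSrc T) (assocTgt T)) {D : FibTwoCat.{v, u, w', a', b'} C}
    (F G H : FibFunctor D P) : PreTrans (tens T (tens T F G) H) (tens T F (tens T G H)) where
  app x := α.app ((F.obj x, G.obj x), H.obj x)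
  proj_app x := α.proj_app _
  nat f := α.nat (((F.pair G).pair H).map f)

end Tensor

def FibFunctor.id (P : FibTwoCat.{v, u, w, a, b} C) : FibFunctor P P where
  obj x := x
  map f := f
  proj_map f := rfl
  map₂ η := η
  mapId X := Iso.refl _
  mapComp f g := Iso.refl _
  map₂_id f := rfl
  map₂_comp η θ := rfl
  map₂_whisker_left _ _ _ _ := by simp
  map₂_whisker_right _ _ := by simp
  map₂_associator f g h := by simp
  map₂_left_unitor f := by simp
  map₂_right_unitor f := by simp

section
variable {P : FibTwoCat.{v, u, w, a, b} C} (T : FibFunctor (P.prod P) P)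

def tensAssocInv (α : PreTrans (assocTgt T) (assocSrc T)) {D : FibTwoCat.{v, u, w', a', b'} C}
    (F G H : FibFunctor D P) : PreTrans (tens T F (tens T G H)) (tens T (tens T F G) H) where
  app x := α.app ((F.obj x, G.obj x), H.obj x)
  proj_app x := α.proj_app _
  nat f := α.nat (((F.pair G).pair H).map f)

/-- The instance `F ⊗ G ⟶ G ⊗ F` of a commutator. -/
def tensBraid (c : PreTrans (tens T (FibFunctor.snd P P) (FibFunctor.fst P P)) T)
    {D : FibTwoCat.{v, u, w', a', b'} C} (F G : FibFunctor D P) :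
    PreTrans (tens T F G) (tens T G F) where
  app x := c.app (G.obj x, F.obj x)
  proj_app x := c.proj_app _
  nat f := c.nat ((G.pair F).map f)

end

/-- The 2-functors and transformations of a Picard structure: the tensor product, the associator
`a` with a weak inverse, and the commutator `c : ⊗ ∘ s ⟶ ⊗`, where `s` exchanges the factors. -/
structure PicardData (P : FibTwoCat.{v, u, w, a, b} C) where
  tensor : FibFunctor (P.prod P) P
  assoc : FibTrans (assocSrc tensor) (assocTgt tensor)
  assocInv : FibTrans (assocTgt tensor) (assocSrc tensor)
  comm : FibTrans (tens tensor (FibFunctor.snd P P) (FibFunctor.fst P P)) tensor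

namespace PicardData
variable {P : FibTwoCat.{v, u, w, a, b} C} (M : PicardData P)
  {D : FibTwoCat.{v, u, w', a', b'} C}

abbrev ten (F G : FibFunctor D P) : FibFunctor D P := tens M.tensor F G
abbrev tenT {F G F' G' : FibFunctor D P} (s : PreTrans F G) (t : PreTrans F' G') :
    PreTrans (M.ten F F') (M.ten G G') := tensT M.tensor s t
abbrev asc (F G H : FibFunctor D P) : PreTrans (M.ten (M.ten F G) H) (M.ten F (M.ten G H)) :=
  tensAssoc M.tensor M.assoc.toPreTrans F G H
abbrev ascInv (F G H : FibFunctor D P) : PreTrans (M.ten F (M.ten G H)) (M.ten (M.ten F G) H) :=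
  tensAssocInv M.tensor M.assocInv.toPreTrans F G H
abbrev braid (F G : FibFunctor D P) : PreTrans (M.ten F G) (M.ten G F) :=
  tensBraid M.tensor M.comm.toPreTrans F G

abbrev X₂ (P : FibTwoCat.{v, u, w, a, b} C) : FibFunctor (P.prod P) P := FibFunctor.fst _ _
abbrev Y₂ (P : FibTwoCat.{v, u, w, a, b} C) : FibFunctor (P.prod P) P := FibFunctor.snd _ _
abbrev X₃ (P : FibTwoCat.{v, u, w, a, b} C) : FibFunctor ((P.prod P).prod P) P :=
  (FibFunctor.fst _ _).comp (X₂ P)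
abbrev Y₃ (P : FibTwoCat.{v, u, w, a, b} C) : FibFunctor ((P.prod P).prod P) P :=
  (FibFunctor.fst _ _).comp (Y₂ P)
abbrev Z₃ (P : FibTwoCat.{v, u, w, a, b} C) : FibFunctor ((P.prod P).prod P) P :=
  FibFunctor.snd _ _
abbrev X₄ (P : FibTwoCat.{v, u, w, a, b} C) : FibFunctor (((P.prod P).prod P).prod P) P :=
  (FibFunctor.fst _ _).comp (X₃ P)
abbrev Y₄ (P : FibTwoCat.{v, u, w, a, b} C) : FibFunctor (((P.prod P).prod P).prod P) P :=
  (FibFunctor.fst _ _).comp (Y₃ P)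
abbrev Z₄ (P : FibTwoCat.{v, u, w, a, b} C) : FibFunctor (((P.prod P).prod P).prod P) P :=
  (FibFunctor.fst _ _).comp (Z₃ P)
abbrev W₄ (P : FibTwoCat.{v, u, w, a, b} C) : FibFunctor (((P.prod P).prod P).prod P) P :=
  FibFunctor.snd _ _

end PicardData

open PicardData

/-- The invertible modifications of a Picard structure: unit and counit of the equivalence `a`, the
pentagonator, the two hexagonators, the symmetry `c ∘ c ⟶ 1`, and the strictness constraint
`c_{X, X} ⟶ 1`. -/
structure PicardConstraints {P : FibTwoCat.{v, u, w, a, b} C} (M : PicardData P) where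
  unit : FibMod ((M.asc (X₃ P) (Y₃ P) (Z₃ P)).vcomp (M.ascInv (X₃ P) (Y₃ P) (Z₃ P)))
    (PreTrans.id _)
  counit : FibMod ((M.ascInv (X₃ P) (Y₃ P) (Z₃ P)).vcomp (M.asc (X₃ P) (Y₃ P) (Z₃ P)))
    (PreTrans.id _)
  pentagonator : FibMod
    ((M.asc (M.ten (X₄ P) (Y₄ P)) (Z₄ P) (W₄ P)).vcomp
      (M.asc (X₄ P) (Y₄ P) (M.ten (Z₄ P) (W₄ P))))
    ((M.tenT (M.asc (X₄ P) (Y₄ P) (Z₄ P)) (PreTrans.id (W₄ P))).vcomp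
      ((M.asc (X₄ P) (M.ten (Y₄ P) (Z₄ P)) (W₄ P)).vcomp
        (M.tenT (PreTrans.id (X₄ P)) (M.asc (Y₄ P) (Z₄ P) (W₄ P)))))
  hexagonator₁ : FibMod
    ((M.asc (X₃ P) (Y₃ P) (Z₃ P)).vcomp
      ((M.braid (X₃ P) (M.ten (Y₃ P) (Z₃ P))).vcomp (M.asc (Y₃ P) (Z₃ P) (X₃ P))))
    ((M.tenT (M.braid (X₃ P) (Y₃ P)) (PreTrans.id (Z₃ P))).vcomp
      ((M.asc (Y₃ P) (X₃ P) (Z₃ P)).vcomp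
        (M.tenT (PreTrans.id (Y₃ P)) (M.braid (X₃ P) (Z₃ P)))))
  hexagonator₂ : FibMod
    ((M.ascInv (X₃ P) (Y₃ P) (Z₃ P)).vcomp
      ((M.braid (M.ten (X₃ P) (Y₃ P)) (Z₃ P)).vcomp (M.ascInv (Z₃ P) (X₃ P) (Y₃ P))))
    ((M.tenT (PreTrans.id (X₃ P)) (M.braid (Y₃ P) (Z₃ P))).vcomp
      ((M.ascInv (X₃ P) (Z₃ P) (Y₃ P)).vcomp
        (M.tenT (M.braid (X₃ P) (Z₃ P)) (PreTrans.id (Y₃ P)))))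
  syllepsis : FibMod ((M.braid (X₂ P) (Y₂ P)).vcomp (M.braid (Y₂ P) (X₂ P))) (PreTrans.id _)
  strictness : FibMod (M.braid (FibFunctor.id P) (FibFunctor.id P)) (PreTrans.id _)

/-- Bracketed words in letters from `ι`. -/
inductive Word (ι : Type) : Type
  | of (i : ι) : Word ι
  | mul (p q : Word ι) : Word ι

/-- Formal 1-arrows between words, made of associators and commutators. -/
inductive FormalArrow {ι : Type} : Word ι → Word ι → Type
  | one (p : Word ι) : FormalArrow p p
  | comp {p q r : Word ι} (f : FormalArrow p q) (g : FormalArrow q r) : FormalArrow p r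
  | tensor {p q p' q' : Word ι} (f : FormalArrow p q) (g : FormalArrow p' q') :
      FormalArrow (p.mul p') (q.mul q')
  | assoc (p q r : Word ι) : FormalArrow ((p.mul q).mul r) (p.mul (q.mul r))
  | assocInv (p q r : Word ι) : FormalArrow (p.mul (q.mul r)) ((p.mul q).mul r)
  | braid (p q : Word ι) : FormalArrow (p.mul q) (q.mul p)

open FormalArrow in
/-- Formal 2-arrows between formal 1-arrows: composites of the structural 2-arrows of a bicategory
with a tensor product, of the naturality 2-arrows of `a` and `c` and of the constraint
modifications. -/
inductive FormalCell {ι : Type} : {p q : Word ι} → FormalArrow p q → FormalArrow p q → Type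
  | refl {p q : Word ι} (f : FormalArrow p q) : FormalCell f f
  | symm {p q : Word ι} {f g : FormalArrow p q} (s : FormalCell f g) : FormalCell g f
  | trans {p q : Word ι} {f g h : FormalArrow p q} (s : FormalCell f g) (t : FormalCell g h) :
      FormalCell f h
  | hcomp {p q r : Word ι} {f f' : FormalArrow p q} {g g' : FormalArrow q r}
      (s : FormalCell f f') (t : FormalCell g g') : FormalCell (f.comp g) (f'.comp g')
  | tensor {p q p' q' : Word ι} {f f' : FormalArrow p q} {g g' : FormalArrow p' q'}
      (s : FormalCell f f') (t : FormalCell g g') : FormalCell (f.tensor g) (f'.tensor g')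
  | compAssoc {p q r s : Word ι} (f : FormalArrow p q) (g : FormalArrow q r)
      (h : FormalArrow r s) : FormalCell ((f.comp g).comp h) (f.comp (g.comp h))
  | idComp {p q : Word ι} (f : FormalArrow p q) : FormalCell ((one p).comp f) f
  | compId {p q : Word ι} (f : FormalArrow p q) : FormalCell (f.comp (one q)) f
  | tensorComp {p q r p' q' r' : Word ι} (f : FormalArrow p q) (g : FormalArrow q r)
      (f' : FormalArrow p' q') (g' : FormalArrow q' r') :
      FormalCell ((f.comp g).tensor (f'.comp g')) ((f.tensor f').comp (g.tensor g'))
  | tensorId (p q : Word ι) : FormalCell ((one p).tensor (one q)) (one (p.mul q))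
  | assocNat {p q r p' q' r' : Word ι} (f : FormalArrow p p') (g : FormalArrow q q')
      (h : FormalArrow r r') :
      FormalCell (((f.tensor g).tensor h).comp (assoc p' q' r'))
        ((assoc p q r).comp (f.tensor (g.tensor h)))
  | assocInvNat {p q r p' q' r' : Word ι} (f : FormalArrow p p') (g : FormalArrow q q')
      (h : FormalArrow r r') :
      FormalCell ((f.tensor (g.tensor h)).comp (assocInv p' q' r'))
        ((assocInv p q r).comp ((f.tensor g).tensor h))
  | braidNat {p q p' q' : Word ι} (f : FormalArrow p p') (g : FormalArrow q q') :
      FormalCell ((f.tensor g).comp (braid p' q')) ((braid p q).comp (g.tensor f))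
  | unit (p q r : Word ι) : FormalCell ((assoc p q r).comp (assocInv p q r)) (one _)
  | counit (p q r : Word ι) : FormalCell ((assocInv p q r).comp (assoc p q r)) (one _)
  | pentagonator (p q r s : Word ι) :
      FormalCell ((assoc (p.mul q) r s).comp (assoc p q (r.mul s)))
        (((assoc p q r).tensor (one s)).comp
          ((assoc p (q.mul r) s).comp ((one p).tensor (assoc q r s))))
  | hexagonator₁ (p q r : Word ι) :
      FormalCell ((assoc p q r).comp ((braid p (q.mul r)).comp (assoc q r p)))
        (((braid p q).tensor (one r)).comp ((assoc q p r).comp ((one q).tensor (braid p r))))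
  | hexagonator₂ (p q r : Word ι) :
      FormalCell ((assocInv p q r).comp ((braid (p.mul q) r).comp (assocInv r p q)))
        (((one p).tensor (braid q r)).comp ((assocInv p r q).comp ((braid p r).tensor (one q))))
  | syllepsis (p q : Word ι) : FormalCell ((braid p q).comp (braid q p)) (one _)
  | strictness (p : Word ι) : FormalCell (braid p p) (one _)

section Vertical
variable {P : FibTwoCat.{v, u, w, a, b} C} {Q : FibTwoCat.{v, u, w', a', b'} C} {U : C}

/-- 1-arrows of the fibre `P(U)`. -/
abbrev VHom (P : FibTwoCat.{v, u, w, a, b} C) {U : C} (x y : P.Obj U) :=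
  {f : (Tot.mk U x : Tot P.Obj) ⟶ Tot.mk U y // P.proj f = 𝟙 U}

def VHom.id (x : P.Obj U) : VHom P x x := ⟨𝟙 _, P.proj_id _⟩

def VHom.comp {x y z : P.Obj U} (f : VHom P x y) (g : VHom P y z) : VHom P x z :=
  ⟨f.1 ≫ g.1, by rw [P.proj_comp, f.2, g.2, Category.comp_id]⟩

def VHom.pair {x y : P.Obj U} {x' y' : Q.Obj U} (f : VHom P x y) (g : VHom Q x' y') :
    VHom (P.prod Q) (x, x') (y, y') := ⟨⟨f.1, g.1, f.2.trans g.2.symm⟩, f.2⟩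

def FibFunctor.vmap (F : FibFunctor P Q) {x y : P.Obj U} (f : VHom P x y) :
    VHom Q (F.obj x) (F.obj y) := ⟨F.map f.1, (F.proj_map f.1).trans f.2⟩

def PreTrans.vapp {F G : FibFunctor P Q} (t : PreTrans F G) (x : P.Obj U) :
    VHom Q (F.obj x) (G.obj x) := ⟨t.app x, t.proj_app x⟩

end Vertical

namespace PicardData
variable {P : FibTwoCat.{v, u, w, a, b} C} (M : PicardData P) {ι : Type} {U : C}
  (x : ι → P.Obj U)

/-- The value of a word on given objects of a fibre. -/
def evalWord : Word ι → P.Obj U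
  | .of i => x i
  | .mul p q => M.tensor.obj (evalWord p, evalWord q)

/-- The value of a formal 1-arrow. -/
def evalArrow : {p q : Word ι} → FormalArrow p q → VHom P (M.evalWord x p) (M.evalWord x q)
  | _, _, .one _ => VHom.id _
  | _, _, .comp f g => (evalArrow f).comp (evalArrow g)
  | _, _, .tensor f g => M.tensor.vmap ((evalArrow f).pair (evalArrow g))
  | _, _, .assoc p q r => M.assoc.vapp ((M.evalWord x p, M.evalWord x q), M.evalWord x r)
  | _, _, .assocInv p q r => M.assocInv.vapp ((M.evalWord x p, M.evalWord x q), M.evalWord x r)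
  | _, _, .braid p q => M.comm.vapp (M.evalWord x q, M.evalWord x p)

end PicardData

namespace PicardConstraints
variable {P : FibTwoCat.{v, u, w, a, b} C} {M : PicardData P} (K : PicardConstraints M)
  {ι : Type} {U : C} (x : ι → P.Obj U)

/-- The value of a formal 2-arrow. -/
def evalCell : {p q : Word ι} → {f g : FormalArrow p q} → FormalCell f g →
    ((M.evalArrow x f).1 ≅ (M.evalArrow x g).1)
  | _, _, _, _, .refl _ => Iso.refl _
  | _, _, _, _, .symm s => (evalCell s).symm
  | _, _, _, _, .trans s t => evalCell s ≪≫ evalCell t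
  | _, _, _, _, .hcomp (f' := f') (g := g) s t =>
      whiskerRightIso (evalCell s) (M.evalArrow x g).1 ≪≫
        whiskerLeftIso (M.evalArrow x f').1 (evalCell t)
  | _, _, _, _, .tensor s t => M.tensor.map₂Iso (FibTwoCat.prodIso (evalCell s) (evalCell t))
  | _, _, _, _, .compAssoc _ _ _ => α_ _ _ _
  | _, _, _, _, .idComp _ => λ_ _
  | _, _, _, _, .compId _ => ρ_ _
  | _, _, _, _, .tensorComp f g f' g' => M.tensor.mapComp
      ((M.evalArrow x f).pair (M.evalArrow x f')).1 ((M.evalArrow x g).pair (M.evalArrow x g')).1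
  | _, _, _, _, .tensorId p q => M.tensor.mapId (Tot.mk U (M.evalWord x p, M.evalWord x q))
  | _, _, _, _, .assocNat f g h =>
      M.assoc.nat (((M.evalArrow x f).pair (M.evalArrow x g)).pair (M.evalArrow x h)).1
  | _, _, _, _, .assocInvNat f g h =>
      M.assocInv.nat (((M.evalArrow x f).pair (M.evalArrow x g)).pair (M.evalArrow x h)).1
  | _, _, _, _, .braidNat f g => M.comm.nat ((M.evalArrow x g).pair (M.evalArrow x f)).1
  | _, _, _, _, .unit p q r => K.unit.app ((M.evalWord x p, M.evalWord x q), M.evalWord x r)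
  | _, _, _, _, .counit p q r => K.counit.app ((M.evalWord x p, M.evalWord x q), M.evalWord x r)
  | _, _, _, _, .pentagonator p q r s => K.pentagonator.app
      (((M.evalWord x p, M.evalWord x q), M.evalWord x r), M.evalWord x s)
  | _, _, _, _, .hexagonator₁ p q r =>
      K.hexagonator₁.app ((M.evalWord x p, M.evalWord x q), M.evalWord x r)
  | _, _, _, _, .hexagonator₂ p q r =>
      K.hexagonator₂.app ((M.evalWord x p, M.evalWord x q), M.evalWord x r)
  | _, _, _, _, .syllepsis p q => K.syllepsis.app (M.evalWord x p, M.evalWord x q)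
  | _, _, _, _, .strictness p => K.strictness.app (M.evalWord x p)

end PicardConstraints

/-- A fibred 2-category with a Picard structure. The law `coherence` comprises all coherence
conditions between the constraints: every diagram of 2-arrows which is built from the constraints
commutes. Invertibility of objects is part of `IsPicardTwoStack`. -/
structure PicardTwoCat (C : Type u) [Category.{v} C] where
  cat : FibTwoCat.{v, u, w, a, b} C
  data : PicardData cat
  con : PicardConstraints data
  coherence {n : ℕ} {U : C} (x : Fin n → cat.Obj U) {p q : Word (Fin n)} {f g : FormalArrow p q}
    (s t : FormalCell f g) : con.evalCell x s = con.evalCell x t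

section
variable {P : FibTwoCat.{v, u, w, a, b} C} {Q : FibTwoCat.{v, u, w', a', b'} C}
  (M : PicardData P) (N : PicardData Q)

/-- The transformation `λ_F : F X ⊗ F Y ⟶ F (X ⊗ Y)` of an additive 2-functor. -/
structure AdditiveData (F : FibFunctor P Q) where
  lam : FibTrans (N.ten ((FibFunctor.fst P P).comp F) ((FibFunctor.snd P P).comp F))
    (M.tensor.comp F)

variable {M N} {F : FibFunctor P Q}

def AdditiveData.lamT (L : AdditiveData M N F) {D : FibTwoCat.{v, u, w'', a'', b''} C}
    (G H : FibFunctor D P) : PreTrans (N.ten (G.comp F) (H.comp F)) ((M.ten G H).comp F) where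
  app x := L.lam.app (G.obj x, H.obj x)
  proj_app x := L.lam.proj_app _
  nat f := L.lam.nat ((G.pair H).map f)

/-- The modifications that compare `λ_F` with the associators and commutators. -/
structure AdditiveConstraints (L : AdditiveData M N F) where
  muAssoc : FibMod
    ((N.asc ((X₃ P).comp F) ((Y₃ P).comp F) ((Z₃ P).comp F)).vcomp
      ((N.tenT (PreTrans.id ((X₃ P).comp F)) (L.lamT (Y₃ P) (Z₃ P))).vcomp
        (L.lamT (X₃ P) (M.ten (Y₃ P) (Z₃ P)))))
    ((N.tenT (L.lamT (X₃ P) (Y₃ P)) (PreTrans.id ((Z₃ P).comp F))).vcomp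
      ((L.lamT (M.ten (X₃ P) (Y₃ P)) (Z₃ P)).vcomp
        ((M.asc (X₃ P) (Y₃ P) (Z₃ P)).postcomp F)))
  muAssocInv : FibMod
    ((N.ascInv ((X₃ P).comp F) ((Y₃ P).comp F) ((Z₃ P).comp F)).vcomp
      ((N.tenT (L.lamT (X₃ P) (Y₃ P)) (PreTrans.id ((Z₃ P).comp F))).vcomp
        (L.lamT (M.ten (X₃ P) (Y₃ P)) (Z₃ P))))
    ((N.tenT (PreTrans.id ((X₃ P).comp F)) (L.lamT (Y₃ P) (Z₃ P))).vcomp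
      ((L.lamT (X₃ P) (M.ten (Y₃ P) (Z₃ P))).vcomp
        ((M.ascInv (X₃ P) (Y₃ P) (Z₃ P)).postcomp F)))
  muBraid : FibMod
    ((N.braid ((X₂ P).comp F) ((Y₂ P).comp F)).vcomp (L.lamT (Y₂ P) (X₂ P)))
    ((L.lamT (X₂ P) (Y₂ P)).vcomp ((M.braid (X₂ P) (Y₂ P)).postcomp F))


namespace AdditiveConstraints
variable {L : AdditiveData M N F} (K : AdditiveConstraints L) {ι : Type} {U : C}
  (x : ι → P.Obj U)

variable (L) in
/-- The iterated `λ_F`, from the word in the objects `F x` to `F` of the word in the objects `x`. -/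
def lamWord : (p : Word ι) →
    VHom Q (N.evalWord (fun i => F.obj (x i)) p) (F.obj (M.evalWord x p))
  | .of i => VHom.id _
  | .mul p q => (N.tensor.vmap ((lamWord p).pair (lamWord q))).comp
      (L.lam.vapp (M.evalWord x p, M.evalWord x q))

variable (N) in
def tenComp {y z t y' z' t' : Q.Obj U} (f : VHom Q y z) (g : VHom Q z t) (f' : VHom Q y' z')
    (g' : VHom Q z' t') : (N.tensor.vmap ((f.comp g).pair (f'.comp g'))).1 ≅
      (N.tensor.vmap (f.pair f')).1 ≫ (N.tensor.vmap (g.pair g')).1 :=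
  N.tensor.mapComp (f.pair f').1 (g.pair g').1

variable (N) in
def tenCompLeft {y z t y' z' : Q.Obj U} (f : VHom Q y z) (g : VHom Q z t) (f' : VHom Q y' z') :
    (N.tensor.vmap ((f.comp g).pair f')).1 ≅
      (N.tensor.vmap (f.pair f')).1 ≫ (N.tensor.vmap (g.pair (VHom.id z'))).1 :=
  N.tensor.map₂Iso (FibTwoCat.prodIso (f := ((f.comp g).pair f').1)
    (g := ((f.comp g).pair (f'.comp (VHom.id z'))).1) (Iso.refl _) (ρ_ f'.1).symm) ≪≫
    tenComp N f g f' (VHom.id z')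

variable (N) in
def tenCompRight {y z y' z' t' : Q.Obj U} (f : VHom Q y z) (f' : VHom Q y' z')
    (g' : VHom Q z' t') : (N.tensor.vmap (f.pair (f'.comp g'))).1 ≅
      (N.tensor.vmap (f.pair f')).1 ≫ (N.tensor.vmap ((VHom.id z).pair g')).1 :=
  N.tensor.map₂Iso (FibTwoCat.prodIso (f := (f.pair (f'.comp g')).1)
    (g := ((f.comp (VHom.id z)).pair (f'.comp g')).1) (ρ_ f.1).symm (Iso.refl _)) ≪≫
    tenComp N f (VHom.id z) f' g'

/-- The comparison, through `λ_F`, of a formal 1-arrow with its image under `F`. -/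
def mu : {p q : Word ι} → (f : FormalArrow p q) →
    ((N.evalArrow (fun i => F.obj (x i)) f).1 ≫ (lamWord L x q).1 ≅
      (lamWord L x p).1 ≫ F.map (M.evalArrow x f).1)
  | _, _, .one p => λ_ _ ≪≫ (ρ_ _).symm ≪≫ whiskerLeftIso _ (F.mapId (Tot.mk U _)).symm
  | _, _, .comp f g => α_ _ _ _ ≪≫ whiskerLeftIso _ (mu g) ≪≫ (α_ _ _ _).symm ≪≫
      whiskerRightIso (mu f) _ ≪≫ α_ _ _ _ ≪≫
      whiskerLeftIso _ (F.mapComp (M.evalArrow x f).1 (M.evalArrow x g).1).symm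
  | _, _, .tensor (p := p) (q := q) (p' := p') (q' := q') f g =>
      (α_ _ _ _).symm ≪≫
      whiskerRightIso ((tenComp N _ (lamWord L x q) _ (lamWord L x q')).symm ≪≫
        N.tensor.map₂Iso (FibTwoCat.prodIso
          (f := (((N.evalArrow _ f).comp (lamWord L x q)).pair
            ((N.evalArrow _ g).comp (lamWord L x q'))).1)
          (g := (((lamWord L x p).comp (F.vmap (M.evalArrow x f))).pair
            ((lamWord L x p').comp (F.vmap (M.evalArrow x g)))).1) (mu f) (mu g)) ≪≫
        tenComp N (lamWord L x p) _ (lamWord L x p') _) _ ≪≫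
      α_ _ _ _ ≪≫
      whiskerLeftIso _ (L.lam.nat ((M.evalArrow x f).pair (M.evalArrow x g)).1) ≪≫
      (α_ _ _ _).symm
  | _, _, .assoc p q r =>
      whiskerLeftIso _ (whiskerRightIso (tenCompRight N (lamWord L x p)
        (N.tensor.vmap ((lamWord L x q).pair (lamWord L x r))) (L.lam.vapp (M.evalWord x q, M.evalWord x r))) _ ≪≫
        α_ _ _ _) ≪≫ (α_ _ _ _).symm ≪≫
      whiskerRightIso (N.assoc.nat
        (((lamWord L x p).pair (lamWord L x q)).pair (lamWord L x r)).1).symm _ ≪≫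
      α_ _ _ _ ≪≫
      whiskerLeftIso _ (K.muAssoc.app ((M.evalWord x p, M.evalWord x q), M.evalWord x r)) ≪≫
      (α_ _ _ _).symm ≪≫
      whiskerRightIso (tenCompLeft N (N.tensor.vmap ((lamWord L x p).pair (lamWord L x q)))
        (L.lam.vapp (M.evalWord x p, M.evalWord x q)) (lamWord L x r)).symm _ ≪≫ (α_ _ _ _).symm
  | _, _, .assocInv p q r =>
      whiskerLeftIso _ (whiskerRightIso (tenCompLeft N
        (N.tensor.vmap ((lamWord L x p).pair (lamWord L x q))) (L.lam.vapp (M.evalWord x p, M.evalWord x q))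
        (lamWord L x r)) _ ≪≫ α_ _ _ _) ≪≫ (α_ _ _ _).symm ≪≫
      whiskerRightIso (N.assocInv.nat
        (((lamWord L x p).pair (lamWord L x q)).pair (lamWord L x r)).1).symm _ ≪≫
      α_ _ _ _ ≪≫
      whiskerLeftIso _ (K.muAssocInv.app ((M.evalWord x p, M.evalWord x q), M.evalWord x r)) ≪≫
      (α_ _ _ _).symm ≪≫
      whiskerRightIso (tenCompRight N (lamWord L x p)
        (N.tensor.vmap ((lamWord L x q).pair (lamWord L x r))) (L.lam.vapp (M.evalWord x q, M.evalWord x r))).symm _ ≪≫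
      (α_ _ _ _).symm
  | _, _, .braid p q =>
      (α_ _ _ _).symm ≪≫
      whiskerRightIso (N.comm.nat ((lamWord L x q).pair (lamWord L x p)).1).symm _ ≪≫
      α_ _ _ _ ≪≫
      whiskerLeftIso _ (K.muBraid.app (M.evalWord x p, M.evalWord x q)) ≪≫ (α_ _ _ _).symm

end AdditiveConstraints
end

/-- An additive 2-functor between Picard 2-categories over `C`: a 2-functor with `λ_F` and its
compatibilities with associativity and commutativity. The law `coherence` says that every formal
2-arrow is carried to its image under the functor. -/
structure AdditiveFunctor (P : PicardTwoCat.{v, u, w, a, b} C)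
    (Q : PicardTwoCat.{v, u, w', a', b'} C) where
  functor : FibFunctor P.cat Q.cat
  data : AdditiveData P.data Q.data functor
  con : AdditiveConstraints data
  coherence {n : ℕ} {U : C} (x : Fin n → P.cat.Obj U) {p q : Word (Fin n)}
    {f g : FormalArrow p q} (s : FormalCell f g) :
    (Q.con.evalCell (fun i => functor.obj (x i)) s).hom ▷
        (AdditiveConstraints.lamWord data x q).1 ≫ (con.mu x g).hom =
      (con.mu x f).hom ≫
        (AdditiveConstraints.lamWord data x p).1 ◁ functor.map₂ (P.con.evalCell x s).hom

section Descent

/-- A sieve on `U`, as a category fibred in sets over `C`. -/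
def sieveCat {U : C} (R : Sieve U) : FibTwoCat.{v, u, v, v, v} C where
  Obj V := {f : V ⟶ U // R f}
  bicat :=
    { Hom X Y := Discrete {k : X.base ⟶ Y.base // k ≫ Y.pt.1 = X.pt.1}
      id X := ⟨𝟙 X.base, Category.id_comp _⟩
      comp f g := ⟨f.as.1 ≫ g.as.1, by rw [Category.assoc, g.as.2, f.as.2]⟩
      homCategory _ _ := inferInstance
      whiskerLeft f _ _ η := Discrete.eqToHom (by rw [Discrete.eq_of_hom η])
      whiskerRight η h := Discrete.eqToHom (by rw [Discrete.eq_of_hom η])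
      associator f g h := Discrete.eqToIso (Subtype.ext (Category.assoc _ _ _))
      leftUnitor f := Discrete.eqToIso (Subtype.ext (Category.id_comp _))
      rightUnitor f := Discrete.eqToIso (Subtype.ext (Category.comp_id _))
      whiskerLeft_id _ _ := Subsingleton.elim _ _
      whiskerLeft_comp _ _ _ _ _ _ := Subsingleton.elim _ _
      id_whiskerLeft _ := Subsingleton.elim _ _
      comp_whiskerLeft _ _ _ _ _ := Subsingleton.elim _ _
      id_whiskerRight _ _ := Subsingleton.elim _ _
      comp_whiskerRight _ _ _ := Subsingleton.elim _ _
      whiskerRight_id _ := Subsingleton.elim _ _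
      whiskerRight_comp _ _ _ := Subsingleton.elim _ _
      whisker_assoc _ _ _ _ _ := Subsingleton.elim _ _
      whisker_exchange _ _ := Subsingleton.elim _ _
      pentagon _ _ _ _ := Subsingleton.elim _ _
      triangle _ _ := Subsingleton.elim _ _ }
  proj f := f.as.1
  proj_id _ := rfl
  proj_comp _ _ := rfl
  proj_eq η := congrArg Subtype.val (Discrete.eq_of_hom η)

/-- The inclusion of a sieve in the maximal sieve. -/
def sieveIncl {U : C} (R : Sieve U) : FibFunctor (sieveCat R) (sieveCat (⊤ : Sieve U)) where
  obj f := ⟨f.1, trivial⟩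
  map f := ⟨f.as⟩
  proj_map _ := rfl
  map₂ η := Discrete.eqToHom (Discrete.eq_of_hom η)
  mapId _ := Discrete.eqToIso rfl
  mapComp _ _ := Discrete.eqToIso rfl
  map₂_id _ := ULift.ext _ _ (Subsingleton.elim _ _)
  map₂_comp _ _ := ULift.ext _ _ (Subsingleton.elim _ _)
  map₂_whisker_left _ _ _ _ := ULift.ext _ _ (Subsingleton.elim _ _)
  map₂_whisker_right _ _ := ULift.ext _ _ (Subsingleton.elim _ _)
  map₂_associator _ _ _ := ULift.ext _ _ (Subsingleton.elim _ _)
  map₂_left_unitor _ := ULift.ext _ _ (Subsingleton.elim _ _)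
  map₂_right_unitor _ := ULift.ext _ _ (Subsingleton.elim _ _)

variable {P : FibTwoCat.{v, u, w, a, b} C} {Q : FibTwoCat.{v, u, w', a', b'} C}
  {D : FibTwoCat.{v, u, w'', a'', b''} C}

def FibTrans.precomp (K : FibFunctor D P) {F G : FibFunctor P Q} (t : FibTrans F G) :
    FibTrans (K.comp F) (K.comp G) where
  toPreTrans := PreTrans.precomp K t.toPreTrans
  naturality η := t.naturality (K.map₂ η)
  nat_id X := by
    have h := t.naturality (K.mapId X).hom
    have h' := t.nat_id (Tot.mk X.base (K.obj X.pt))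
    have key : (t.nat (K.map (𝟙 X))).hom ≫ t.app (K.obj X.pt) ◁ (G.map₂ (K.mapId X).hom ≫
        (G.mapId (Tot.mk X.base (K.obj X.pt))).hom) =
      (F.map₂ (K.mapId X).hom ≫ (F.mapId (Tot.mk X.base (K.obj X.pt))).hom) ▷
        t.app (K.obj X.pt) ≫ (λ_ (t.app (K.obj X.pt))).hom ≫ (ρ_ (t.app (K.obj X.pt))).inv := by
      rw [Bicategory.whiskerLeft_comp, comp_whiskerRight, Category.assoc, ← h', ← reassoc_of% h]
    exact key
  nat_comp {X Y Z} f g := by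
    have h := t.naturality (K.mapComp f g).hom
    have h' := t.nat_comp (K.map f) (K.map g)
    have key : (t.nat (K.map (f ≫ g))).hom ≫ t.app (K.obj X.pt) ◁ (G.map₂ (K.mapComp f g).hom ≫
        (G.mapComp (K.map f) (K.map g)).hom) =
      (F.map₂ (K.mapComp f g).hom ≫ (F.mapComp (K.map f) (K.map g)).hom) ▷
        t.app (K.obj Z.pt) ≫ (α_ _ _ _).hom ≫ F.map (K.map f) ◁ (t.nat (K.map g)).hom ≫
        (α_ _ _ _).inv ≫ (t.nat (K.map f)).hom ▷ G.map (K.map g) ≫ (α_ _ _ _).hom := by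
      rw [Bicategory.whiskerLeft_comp, comp_whiskerRight, Category.assoc, ← h', ← reassoc_of% h]
    exact key

def FibMod.precomp (K : FibFunctor D P) {F G : FibFunctor P Q} {s t : PreTrans F G}
    (Γ : FibMod s t) : FibMod (s.precomp K) (t.precomp K) where
  app x := Γ.app (K.obj x)
  naturality f := Γ.naturality (K.map f)

/-- `P` is fibred in 2-groupoids: 2-arrows are invertible, every morphism of `C` can be lifted to a
1-arrow with given target, and every 1-arrow is 2-cartesian (so that the vertical 1-arrows are
equivalences). -/
structure FibTwoCat.IsFibredInGroupoids (P : FibTwoCat.{v, u, w, a, b} C) : Prop where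
  isIso {X Y : Tot P.Obj} {f g : X ⟶ Y} (η : f ⟶ g) : IsIso η
  lift {U V : C} (k : V ⟶ U) (y : P.Obj U) :
    ∃ (x : P.Obj V) (f : (Tot.mk V x : Tot P.Obj) ⟶ Tot.mk U y), P.proj f = k
  cartesian {X Y Z : Tot P.Obj} (f : Y ⟶ Z) (g : X ⟶ Z) (k : X.base ⟶ Y.base)
    (hk : k ≫ P.proj f = P.proj g) : ∃ h : X ⟶ Y, P.proj h = k ∧ Nonempty (h ≫ f ≅ g)
  cartesian₂ {X Y Z : Tot P.Obj} (f : Y ⟶ Z) (h h' : X ⟶ Y) (hh : P.proj h = P.proj h')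
    (β : h ≫ f ⟶ h' ≫ f) : ∃! γ : h ⟶ h', γ ▷ f = β

/-- `P` is a 2-stack in 2-groupoids: for every covering sieve `R` of `U` the restriction from
2-functors `C/U ⟶ P` to 2-functors `R ⟶ P` over `C`, that is, to 2-descent data, is an equivalence:
it is surjective up to equivalence on objects, surjective up to isomorphism on 1-arrows and
bijective on 2-arrows. -/
structure FibTwoCat.IsTwoStack (J : GrothendieckTopology C) (P : FibTwoCat.{v, u, w, a, b} C) :
    Prop extends P.IsFibredInGroupoids where
  descent_obj {U : C} {R : Sieve U} (hR : R ∈ J U) (s : FibFunctor (sieveCat R) P) :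
    ∃ t : FibFunctor (sieveCat (⊤ : Sieve U)) P, Nonempty (FibTrans ((sieveIncl R).comp t) s)
  descent_hom {U : C} {R : Sieve U} (hR : R ∈ J U) (s t : FibFunctor (sieveCat (⊤ : Sieve U)) P)
    (φ : FibTrans ((sieveIncl R).comp s) ((sieveIncl R).comp t)) :
    ∃ ψ : FibTrans s t, Nonempty (FibMod (ψ.precomp (sieveIncl R)).toPreTrans φ.toPreTrans)
  descent_hom₂ {U : C} {R : Sieve U} (hR : R ∈ J U)
    (s t : FibFunctor (sieveCat (⊤ : Sieve U)) P) (φ ψ : FibTrans s t)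
    (Γ : FibMod (φ.precomp (sieveIncl R)).toPreTrans (ψ.precomp (sieveIncl R)).toPreTrans) :
    ∃! Ω : FibMod φ.toPreTrans ψ.toPreTrans, FibMod.precomp (sieveIncl R) Ω = Γ

/-- `F` is an equivalence of fibred 2-categories: a biequivalence on every fibre. -/
structure FibFunctor.IsEquivalence (F : FibFunctor P Q) : Prop where
  essSurj {U : C} (y : Q.Obj U) : ∃ x : P.Obj U, Nonempty (VHom Q (F.obj x) y)
  full {U : C} {x x' : P.Obj U} (g : VHom Q (F.obj x) (F.obj x')) :
    ∃ f : VHom P x x', Nonempty ((F.vmap f).1 ≅ g.1)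
  bijective {U : C} {x x' : P.Obj U} (f f' : VHom P x x') :
    Function.Bijective (fun η : f.1 ⟶ f'.1 => F.map₂ η)

/-- `F` is locally an equivalence: locally surjective on objects and on 1-arrows, up to equivalence
and isomorphism, and bijective on 2-arrows. If moreover the target is a 2-stack, it is the 2-stack
associated with the source. -/
structure FibFunctor.IsLocalEquivalence (J : GrothendieckTopology C) (F : FibFunctor P Q) :
    Prop where
  locally_essSurj {U : C} (y : Q.Obj U) : ∃ R ∈ J U, ∀ {V : C} (k : V ⟶ U), R k →
    ∃ (x : P.Obj V) (q : (Tot.mk V (F.obj x) : Tot Q.Obj) ⟶ Tot.mk U y), Q.proj q = k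
  locally_full {U : C} {x x' : P.Obj U} (g : VHom Q (F.obj x) (F.obj x')) :
    ∃ R ∈ J U, ∀ {V : C} (k : V ⟶ U), R k → ∃ (z z' : P.Obj V)
      (p : (Tot.mk V z : Tot P.Obj) ⟶ Tot.mk U x) (p' : (Tot.mk V z' : Tot P.Obj) ⟶ Tot.mk U x')
      (f : VHom P z z'), P.proj p = k ∧ P.proj p' = k ∧
        Nonempty (F.map f.1 ≫ F.map p' ≅ F.map p ≫ g.1)
  bijective {U : C} {x x' : P.Obj U} (f f' : VHom P x x') :
    Function.Bijective (fun η : f.1 ⟶ f'.1 => F.map₂ η)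

end Descent

/-- A Picard 2-stack: a Picard 2-category over `C` that is a 2-stack, with non-empty fibres on which
`X ⊗ -` is an equivalence for every object `X`. -/
structure PicardTwoCat.IsPicardTwoStack (J : GrothendieckTopology C)
    (P : PicardTwoCat.{v, u, w, a, b} C) : Prop where
  isTwoStack : P.cat.IsTwoStack J
  nonempty (U : C) : Nonempty (P.cat.Obj U)
  essSurj {U : C} (x z : P.cat.Obj U) :
    ∃ y : P.cat.Obj U, Nonempty (VHom P.cat (P.data.tensor.obj (x, y)) z)
  full {U : C} (x : P.cat.Obj U) {y y' : P.cat.Obj U}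
    (g : VHom P.cat (P.data.tensor.obj (x, y)) (P.data.tensor.obj (x, y'))) :
    ∃ f : VHom P.cat y y', Nonempty ((P.data.tensor.vmap ((VHom.id x).pair f)).1 ≅ g.1)
  bijective {U : C} (x : P.cat.Obj U) {y y' : P.cat.Obj U} (f f' : VHom P.cat y y') :
    Function.Bijective (fun η : f.1 ⟶ f'.1 => P.data.tensor.map₂
      (show ((VHom.id x).pair f).1 ⟶ ((VHom.id x).pair f').1 from ⟨𝟙 _, η⟩))
section FibredProduct

universe w₁ a₁ b₁ w₂ a₂ b₂ w₃ a₃ b₃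

variable {A : FibTwoCat.{v, u, w₁, a₁, b₁} C} {B : FibTwoCat.{v, u, w₂, a₂, b₂} C}
  {P : FibTwoCat.{v, u, w₃, a₃, b₃} C} (F : FibFunctor A P) (G : FibFunctor B P)

/-- Objects of the fibered product: triples `(X, l, Y)` with `l : F X ⟶ G Y` in the fibre. -/
structure FibProdObj (U : C) where
  fst : A.Obj U
  snd : B.Obj U
  link : VHom P (F.obj fst) (G.obj snd)

variable {F G}

/-- 1-arrows `(m, α, n)` with `α : l₂ ∘ F m ⟶ G n ∘ l₁`. -/
structure FibProdHom (X Y : Tot (FibProdObj F G)) where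
  fst : Tot.mk X.base X.pt.fst ⟶ Tot.mk Y.base Y.pt.fst
  snd : Tot.mk X.base X.pt.snd ⟶ Tot.mk Y.base Y.pt.snd
  cell : F.map fst ≫ Y.pt.link.1 ⟶ X.pt.link.1 ≫ G.map snd

/-- 2-arrows `(θ, φ) : (m, α, n) ⟶ (m', α', n')`, compatible with `α` and `α'`. -/
@[ext]
structure FibProdHom₂ {X Y : Tot (FibProdObj F G)} (f g : FibProdHom X Y) where
  fst : f.fst ⟶ g.fst
  snd : f.snd ⟶ g.snd
  comm : F.map₂ fst ▷ Y.pt.link.1 ≫ g.cell = f.cell ≫ X.pt.link.1 ◁ G.map₂ snd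

@[simps]
instance (X Y : Tot (FibProdObj F G)) : Category (FibProdHom X Y) where
  Hom := FibProdHom₂
  id f := ⟨𝟙 _, 𝟙 _, by simp [F.map₂_id, G.map₂_id]⟩
  comp η θ := ⟨η.fst ≫ θ.fst, η.snd ≫ θ.snd, by
    rw [F.map₂_comp, G.map₂_comp, comp_whiskerRight, Category.assoc, θ.comm,
      Bicategory.whiskerLeft_comp, ← Category.assoc, η.comm, Category.assoc]⟩
  id_comp _ := FibProdHom₂.ext (Category.id_comp _) (Category.id_comp _)
  comp_id _ := FibProdHom₂.ext (Category.comp_id _) (Category.comp_id _)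
  assoc _ _ _ := FibProdHom₂.ext (Category.assoc _ _ _) (Category.assoc _ _ _)

def fibProdIso {X Y : Tot (FibProdObj F G)} {f g : FibProdHom X Y} (η : f.fst ≅ g.fst)
    (θ : f.snd ≅ g.snd) (h : F.map₂ η.hom ▷ Y.pt.link.1 ≫ g.cell =
      f.cell ≫ X.pt.link.1 ◁ G.map₂ θ.hom) : f ≅ g where
  hom := ⟨η.hom, θ.hom, h⟩
  inv := ⟨η.inv, θ.inv, by
    have hF : F.map₂ η.inv ▷ Y.pt.link.1 ≫ F.map₂ η.hom ▷ Y.pt.link.1 = 𝟙 _ := by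
      rw [← comp_whiskerRight, ← F.map₂_comp, η.inv_hom_id, F.map₂_id, id_whiskerRight]
    have hG : X.pt.link.1 ◁ G.map₂ θ.hom ≫ X.pt.link.1 ◁ G.map₂ θ.inv = 𝟙 _ := by
      rw [← Bicategory.whiskerLeft_comp, ← G.map₂_comp, θ.hom_inv_id, G.map₂_id,
        Bicategory.whiskerLeft_id]
    calc _ = F.map₂ η.inv ▷ Y.pt.link.1 ≫ (f.cell ≫ X.pt.link.1 ◁ G.map₂ θ.hom) ≫
          X.pt.link.1 ◁ G.map₂ θ.inv := by rw [Category.assoc, hG, Category.comp_id]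
      _ = _ := by rw [← h, Category.assoc, reassoc_of% hF]⟩
  hom_inv_id := FibProdHom₂.ext η.hom_inv_id θ.hom_inv_id
  inv_hom_id := FibProdHom₂.ext η.inv_hom_id θ.inv_hom_id

def fibProdId (X : Tot (FibProdObj F G)) : FibProdHom X X where
  fst := 𝟙 _
  snd := 𝟙 _
  cell := (F.mapId (Tot.mk X.base X.pt.fst)).hom ▷ _ ≫ (λ_ _).hom ≫ (ρ_ _).inv ≫
    _ ◁ (G.mapId (Tot.mk X.base X.pt.snd)).inv

def fibProdComp {X Y Z : Tot (FibProdObj F G)} (f : FibProdHom X Y) (g : FibProdHom Y Z) :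
    FibProdHom X Z where
  fst := f.fst ≫ g.fst
  snd := f.snd ≫ g.snd
  cell := (F.mapComp _ _).hom ▷ _ ≫ (α_ _ _ _).hom ≫ F.map f.fst ◁ g.cell ≫ (α_ _ _ _).inv ≫
    f.cell ▷ G.map g.snd ≫ (α_ _ _ _).hom ≫ _ ◁ (G.mapComp _ _).inv

instance fibProdBicat : Bicategory (Tot (FibProdObj F G)) where
  Hom := FibProdHom
  id := fibProdId
  comp := fibProdComp
  homCategory _ _ := inferInstance
  whiskerLeft {X Y Z} f g h η := ⟨f.fst ◁ η.fst, f.snd ◁ η.snd, by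
    have h1 := η.comm
    simp only [fibProdComp, F.map₂_whisker_left, G.map₂_whisker_left]
    simp
    rw [← Bicategory.whiskerLeft_comp_assoc, h1]
    simp only [Bicategory.whiskerLeft_comp, Category.assoc]
    rw [associator_inv_naturality_right_assoc, whisker_exchange_assoc]
    simp⟩
  whiskerRight {X Y Z f g} η h := ⟨η.fst ▷ h.fst, η.snd ▷ h.snd, by
    have h1 := η.comm
    simp only [fibProdComp, F.map₂_whisker_right, G.map₂_whisker_right]
    simp
    rw [associator_naturality_left_assoc, ← whisker_exchange_assoc, whiskerRight_comp]
    simp only [Category.assoc, Iso.hom_inv_id_assoc]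
    rw [← comp_whiskerRight_assoc, h1]
    simp⟩
  associator f g h := fibProdIso (α_ _ _ _) (α_ _ _ _) (by
    simp only [fibProdComp, F.map₂_associator, G.map₂_associator]
    simp
    rw [associator_inv_naturality_right_assoc, whisker_exchange_assoc,
      ← associator_inv_naturality_left_assoc, whisker_exchange_assoc]
    simp)
  leftUnitor f := fibProdIso (λ_ _) (λ_ _) (by
    simp only [fibProdComp, fibProdId, F.map₂_left_unitor, G.map₂_left_unitor]
    simp
    rw [associator_naturality_left_assoc, associator_naturality_left_assoc, Iso.inv_hom_id_assoc,
      whisker_exchange_assoc]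
    simp)
  rightUnitor f := fibProdIso (ρ_ _) (ρ_ _) (by
    simp only [fibProdComp, fibProdId, F.map₂_right_unitor, G.map₂_right_unitor]
    simp
    rw [associator_inv_naturality_right_assoc, Iso.hom_inv_id_assoc, whisker_exchange_assoc]
    simp)
  whiskerLeft_id _ _ := FibProdHom₂.ext (whiskerLeft_id _ _) (whiskerLeft_id _ _)
  whiskerLeft_comp _ _ _ _ _ _ := FibProdHom₂.ext (whiskerLeft_comp _ _ _) (whiskerLeft_comp _ _ _)
  id_whiskerLeft _ := FibProdHom₂.ext (id_whiskerLeft _) (id_whiskerLeft _)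
  comp_whiskerLeft _ _ _ _ _ := FibProdHom₂.ext (comp_whiskerLeft _ _ _) (comp_whiskerLeft _ _ _)
  id_whiskerRight _ _ := FibProdHom₂.ext (id_whiskerRight _ _) (id_whiskerRight _ _)
  comp_whiskerRight _ _ _ := FibProdHom₂.ext (comp_whiskerRight _ _ _) (comp_whiskerRight _ _ _)
  whiskerRight_id _ := FibProdHom₂.ext (whiskerRight_id _) (whiskerRight_id _)
  whiskerRight_comp _ _ _ := FibProdHom₂.ext (whiskerRight_comp _ _ _) (whiskerRight_comp _ _ _)
  whisker_assoc _ _ _ _ _ := FibProdHom₂.ext (whisker_assoc _ _ _) (whisker_assoc _ _ _)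
  whisker_exchange _ _ := FibProdHom₂.ext (whisker_exchange _ _) (whisker_exchange _ _)
  pentagon _ _ _ _ := FibProdHom₂.ext (pentagon _ _ _ _) (pentagon _ _ _ _)
  triangle _ _ := FibProdHom₂.ext (triangle _ _) (triangle _ _)

variable (F G) in
/-- The fibered product of `F` and `G`. -/
def fibProd : FibTwoCat C where
  Obj := FibProdObj F G
  bicat := fibProdBicat
  proj f := A.proj (FibProdHom.fst f)
  proj_id _ := A.proj_id _
  proj_comp _ _ := A.proj_comp _ _
  proj_eq η := A.proj_eq (FibProdHom₂.fst η)

end FibredProduct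
noncomputable section Integral

variable {J : GrothendieckTopology C}

/-- Sections over `U` of the sheaf in degree `i` of a complex of abelian sheaves. -/
abbrev sec (K : CochainComplex (Sheaf J AddCommGrpCat.{max u v}) ℤ) (i : ℤ) (U : C) :
    Type (max u v) := (K.X i).obj.obj (op U)

section Sections
variable (K : CochainComplex (Sheaf J AddCommGrpCat.{max u v}) ℤ)
  {L : CochainComplex (Sheaf J AddCommGrpCat.{max u v}) ℤ}

/-- Restriction of sections. -/
def res {i : ℤ} {U V : C} (k : V ⟶ U) : sec K i U →+ sec K i V :=
  ((K.X i).obj.map k.op).hom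

/-- The differential on sections. -/
def dif (i j : ℤ) {U : C} : sec K i U →+ sec K j U := ((K.d i j).hom.app (op U)).hom

variable {K} in
/-- A morphism of complexes on sections. -/
def mor (φ : K ⟶ L) {i : ℤ} {U : C} : sec K i U →+ sec L i U :=
  ((φ.f i).hom.app (op U)).hom

@[simp] lemma res_id {i : ℤ} {U : C} (x : sec K i U) : res K (𝟙 U) x = x := by
  simp [res]

@[simp] lemma res_comp {i : ℤ} {U V W : C} (k : V ⟶ U) (l : W ⟶ V) (x : sec K i U) :
    res K (l ≫ k) x = res K l (res K k x) := by
  simp [res]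

lemma dif_res {i j : ℤ} {U V : C} (k : V ⟶ U) (x : sec K i U) :
    dif K i j (res K k x) = res K k (dif K i j x) :=
  ConcreteCategory.congr_hom ((K.d i j).hom.naturality k.op) x

variable {K} in
lemma mor_res (φ : K ⟶ L) {i : ℤ} {U V : C} (k : V ⟶ U) (x : sec K i U) :
    mor φ (res K k x) = res L k (mor φ x) :=
  ConcreteCategory.congr_hom ((φ.f i).hom.naturality k.op) x

variable {K} in
lemma mor_dif (φ : K ⟶ L) {i j : ℤ} {U : C} (x : sec K i U) :
    mor φ (dif K i j x) = dif L i j (mor φ x) :=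
  (ConcreteCategory.congr_hom (congrArg (fun t => t.hom.app (op U)) (φ.comm i j)) x).symm

end Sections

variable (K : CochainComplex (Sheaf J AddCommGrpCat.{max u v}) ℤ)
  {L : CochainComplex (Sheaf J AddCommGrpCat.{max u v}) ℤ}

/-- Objects over `U`: cocycles of degree `0`. -/
abbrev IntObj (U : C) := {x : sec K 0 U // dif K 0 1 x = 0}

variable {K} in
/-- 1-arrows over `k`: an `m` in degree `-1` with `d m = k^* y - x`. -/
structure IntHom (X Y : Tot (IntObj K)) where
  base : X.base ⟶ Y.base
  val : sec K (-1) X.base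
  dif_val : dif K (-1) 0 val = res K base Y.pt.1 - X.pt.1

variable {K} in
/-- 2-arrows `f ⟶ g`: a `θ` in degree `-2` with `d θ = g - f`. -/
@[ext]
structure IntHom₂ {X Y : Tot (IntObj K)} (f g : IntHom X Y) where
  val : sec K (-2) X.base
  base_eq : f.base = g.base
  dif_val : dif K (-2) (-1) val = g.val - f.val

instance (X Y : Tot (IntObj K)) : Category (IntHom X Y) where
  Hom := IntHom₂
  id f := ⟨0, rfl, by simp⟩
  comp η θ := ⟨η.val + θ.val, η.base_eq.trans θ.base_eq, by
    rw [map_add, η.dif_val, θ.dif_val]; abel⟩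
  id_comp _ := IntHom₂.ext (zero_add _)
  comp_id _ := IntHom₂.ext (add_zero _)
  assoc _ _ _ := IntHom₂.ext (add_assoc _ _ _)

variable {K} in
def zeroIso {X Y : Tot (IntObj K)} {f g : IntHom X Y} (h : f.base = g.base)
    (h' : f.val = g.val) : f ≅ g where
  hom := ⟨0, h, by simp [h']⟩
  inv := ⟨0, h.symm, by simp [h']⟩
  hom_inv_id := IntHom₂.ext (add_zero _)
  inv_hom_id := IntHom₂.ext (add_zero _)

instance secBicat : Bicategory (Tot (IntObj K)) where
  Hom := IntHom
  id X := ⟨𝟙 _, 0, by simp⟩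
  comp {X Y Z} f g := ⟨f.base ≫ g.base, f.val + res K f.base g.val, by
    rw [map_add, dif_res, f.dif_val, g.dif_val, map_sub, res_comp]; abel⟩
  homCategory _ _ := inferInstance
  whiskerLeft f g h η := ⟨res K f.base η.val, by simp [η.base_eq], by
    rw [dif_res, η.dif_val, map_sub]; exact (add_sub_add_left_eq_sub _ _ _).symm⟩
  whiskerRight {X Y Z f g} η h := ⟨η.val, by simp [η.base_eq], by
    rw [η.dif_val]; simp [η.base_eq]⟩
  associator f g h := zeroIso (by simp) (by simp [add_assoc])
  leftUnitor f := zeroIso (by simp) (by simp)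
  rightUnitor f := zeroIso (by simp) (by simp)
  whiskerLeft_id f _ := IntHom₂.ext (map_zero (res K f.base))
  whiskerLeft_comp f _ _ _ _ _ := IntHom₂.ext (map_add (res K f.base) _ _)
  id_whiskerLeft η := IntHom₂.ext (by
    change res K (𝟙 _) η.val = 0 + (η.val + 0); simp)
  comp_whiskerLeft f g h h' η := IntHom₂.ext (by
    change res K (f.base ≫ g.base) η.val = 0 + (res K f.base (res K g.base η.val) + 0); simp)
  id_whiskerRight _ _ := rfl
  comp_whiskerRight _ _ _ := rfl
  whiskerRight_id η := IntHom₂.ext (by change η.val = 0 + (η.val + 0); simp)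
  whiskerRight_comp η _ _ := IntHom₂.ext (by change η.val = 0 + (η.val + 0); simp)
  whisker_assoc f _ _ η _ := IntHom₂.ext (by
    change res K f.base η.val = 0 + (res K f.base η.val + 0); simp)
  whisker_exchange {X Y Z f g h i} η θ := IntHom₂.ext (by
    change res K f.base θ.val + η.val = η.val + res K g.base θ.val
    rw [η.base_eq, add_comm])
  pentagon f _ _ _ := IntHom₂.ext (by
    change 0 + (0 + res K f.base 0) = (0 : sec K (-2) _) + 0; simp)
  triangle f _ := IntHom₂.ext (by
    change 0 + res K f.base 0 = (0 : sec K (-2) _); simp)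

/-- The fibred 2-category of sections of a complex `K` of abelian sheaves with `K^i = 0` for
`i < -2`. Objects over `U` are the sections `x` of `K^0` with `d x = 0`, 1-arrows `x ⟶ y` the
sections `m` of `K^{-1}` with `d m = y - x`, 2-arrows `m ⟶ m'` the sections `θ` of `K^{-2}` with
`d θ = m' - m`. For a complex in degrees `-2, -1, 0` this is the associated 2-prestack. -/
def secCat : FibTwoCat C where
  Obj := IntObj K
  bicat := secBicat K
  proj f := IntHom.base f
  proj_id _ := rfl
  proj_comp _ _ := rfl
  proj_eq η := IntHom₂.base_eq η

section Val
variable {K} {X Y Z W : Tot (secCat K).Obj}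

def av (f : X ⟶ Y) : sec K (-1) X.base := IntHom.val f
def cv {f g : X ⟶ Y} (η : f ⟶ g) : sec K (-2) X.base := IntHom₂.val η

lemma av_ext {f g : X ⟶ Y} (h : (secCat K).proj f = (secCat K).proj g) (h' : av f = av g) : f = g := by
  obtain ⟨_, _, _⟩ := f
  obtain ⟨_, _, _⟩ := g
  cases h; cases h'; rfl

lemma cv_ext {f g : X ⟶ Y} {η θ : f ⟶ g} (h : cv η = cv θ) : η = θ := IntHom₂.ext h

lemma dif_av (f : X ⟶ Y) : dif K (-1) 0 (av f) = res K ((secCat K).proj f) Y.pt.1 - X.pt.1 :=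
  IntHom.dif_val f
lemma dif_cv {f g : X ⟶ Y} (η : f ⟶ g) : dif K (-2) (-1) (cv η) = av g - av f :=
  IntHom₂.dif_val η
@[simp] lemma av_id : av (𝟙 X) = 0 := rfl
@[simp] lemma av_comp (f : X ⟶ Y) (g : Y ⟶ Z) :
    av (f ≫ g) = av f + res K ((secCat K).proj f) (av g) := rfl
@[simp] lemma cv_id (f : X ⟶ Y) : cv (𝟙 f) = 0 := rfl
@[simp] lemma cv_comp {f g h : X ⟶ Y} (η : f ⟶ g) (θ : g ⟶ h) : cv (η ≫ θ) = cv η + cv θ := rfl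
@[simp] lemma cv_whiskerLeft (f : X ⟶ Y) {g h : Y ⟶ Z} (η : g ⟶ h) :
    cv (f ◁ η) = res K ((secCat K).proj f) (cv η) := rfl
@[simp] lemma cv_whiskerRight {f g : X ⟶ Y} (η : f ⟶ g) (h : Y ⟶ Z) : cv (η ▷ h) = cv η := rfl
@[simp] lemma cv_assoc_hom (f : X ⟶ Y) (g : Y ⟶ Z) (h : Z ⟶ W) : cv (α_ f g h).hom = 0 := rfl
@[simp] lemma cv_assoc_inv (f : X ⟶ Y) (g : Y ⟶ Z) (h : Z ⟶ W) : cv (α_ f g h).inv = 0 := rfl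
@[simp] lemma cv_left_hom (f : X ⟶ Y) : cv (λ_ f).hom = 0 := rfl
@[simp] lemma cv_left_inv (f : X ⟶ Y) : cv (λ_ f).inv = 0 := rfl
@[simp] lemma cv_right_hom (f : X ⟶ Y) : cv (ρ_ f).hom = 0 := rfl
@[simp] lemma cv_right_inv (f : X ⟶ Y) : cv (ρ_ f).inv = 0 := rfl
@[simp] lemma cv_inv {f g : X ⟶ Y} (η : f ≅ g) : cv η.inv = - cv η.hom :=
  eq_neg_of_add_eq_zero_right ((cv_comp _ _).symm.trans
    (by rw [η.hom_inv_id]; rfl))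

def mkCell {f g : X ⟶ Y} (θ : sec K (-2) X.base) (h : (secCat K).proj f = (secCat K).proj g)
    (h' : dif K (-2) (-1) θ = av g - av f) : f ⟶ g := (⟨θ, h, h'⟩ : IntHom₂ f g)
def mkArrow (k : X.base ⟶ Y.base) (m : sec K (-1) X.base)
    (h : dif K (-1) 0 m = res K k Y.pt.1 - X.pt.1) : X ⟶ Y := (⟨k, m, h⟩ : IntHom X Y)
def mkIso {f g : X ⟶ Y} (h : (secCat K).proj f = (secCat K).proj g) (h' : av f = av g) : f ≅ g :=
  zeroIso (f := f) (g := g) h h'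
@[simp] lemma cv_mkCell {f g : X ⟶ Y} (θ : sec K (-2) X.base)
    (h : (secCat K).proj f = (secCat K).proj g) (h' : dif K (-2) (-1) θ = av g - av f) :
    cv (mkCell θ h h') = θ := rfl
@[simp] lemma av_mkArrow (k : X.base ⟶ Y.base) (m : sec K (-1) X.base)
    (h : dif K (-1) 0 m = res K k Y.pt.1 - X.pt.1) : av (mkArrow k m h : X ⟶ Y) = m := rfl
@[simp] lemma proj_mkArrow (k : X.base ⟶ Y.base) (m : sec K (-1) X.base)
    (h : dif K (-1) 0 m = res K k Y.pt.1 - X.pt.1) :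
    (secCat K).proj (mkArrow k m h : X ⟶ Y) = k := rfl
@[simp] lemma cv_mkIso_hom {f g : X ⟶ Y} (h : (secCat K).proj f = (secCat K).proj g)
    (h' : av f = av g) : cv (mkIso h h').hom = 0 := rfl

end Val

variable {P : FibTwoCat.{v, u, w, a, b} C}

section
variable {K} {F G : FibFunctor P (secCat K)}

def zeroTrans (h₀ : ∀ {U : C} (x : P.Obj U), (F.obj x).1 = (G.obj x).1)
    (h₁ : ∀ {X Y : Tot P.Obj} (f : X ⟶ Y), av (F.map f) = av (G.map f))
    (h₂ : ∀ {X Y : Tot P.Obj} {f g : X ⟶ Y} (η : f ⟶ g), cv (F.map₂ η) = cv (G.map₂ η))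
    (hi : ∀ X : Tot P.Obj, cv (F.mapId X).hom = cv (G.mapId X).hom)
    (hc : ∀ {X Y Z : Tot P.Obj} (f : X ⟶ Y) (g : Y ⟶ Z),
      cv (F.mapComp f g).hom = cv (G.mapComp f g).hom) : FibTrans F G where
  app x := mkArrow (𝟙 _) 0 (by simp [h₀])
  proj_app x := rfl
  nat f := mkIso (by simp [F.proj_map, G.proj_map]) (by simp [h₁])
  naturality η := cv_ext (by simp [h₂])
  nat_id X := cv_ext (by simp [hi])
  nat_comp f g := cv_ext (by simp [hc])

def zeroMod {s t : PreTrans F G} (h : ∀ {U : C} (x : P.Obj U), av (s.app x) = av (t.app x))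
    (hn : ∀ {X Y : Tot P.Obj} (f : X ⟶ Y), cv (s.nat f).hom = cv (t.nat f).hom) :
    FibMod s t where
  app x := mkIso (by rw [s.proj_app, t.proj_app]) (h x)
  naturality f := cv_ext (by simp [hn])

end

variable {K} in
lemma dif_add_arrow {U V : C} {k k' : U ⟶ V} (hk : k = k') {m m' : sec K (-1) U}
    {x x' : sec K 0 U} {y y' : sec K 0 V} (h : dif K (-1) 0 m = res K k y - x)
    (h' : dif K (-1) 0 m' = res K k' y' - x') :
    dif K (-1) 0 (m + m') = res K k (y + y') - (x + x') := by
  subst hk; rw [map_add, map_add, h, h']; abel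

variable {K} in
lemma dif_add_cell {U : C} {t t' : sec K (-2) U} {m m' n n' : sec K (-1) U}
    (h : dif K (-2) (-1) t = n - m) (h' : dif K (-2) (-1) t' = n' - m') :
    dif K (-2) (-1) (t + t') = (n + n') - (m + m') := by
  rw [map_add, h, h']; abel

variable {K} in
lemma add_res {i : ℤ} {U V : C} {k k' : U ⟶ V} (hk : k = k') (m m' : sec K i U)
    (n n' : sec K i V) :
    (m + res K k n) + (m' + res K k' n') = (m + m') + res K k (n + n') := by
  subst hk; rw [map_add]; abel

section Zero
variable {K} {X Y Z : Tot (secCat K).Obj}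
lemma cz_comp {f g h : X ⟶ Y} {η : f ⟶ g} {θ : g ⟶ h} (h₁ : cv η = 0) (h₂ : cv θ = 0) :
    cv (η ≫ θ) = 0 := by rw [cv_comp, h₁, h₂, add_zero]
lemma cz_left (f : X ⟶ Y) {g h : Y ⟶ Z} {η : g ⟶ h} (h₁ : cv η = 0) : cv (f ◁ η) = 0 := by
  rw [cv_whiskerLeft, h₁, map_zero]
lemma cz_right {f g : X ⟶ Y} {η : f ⟶ g} (h : Y ⟶ Z) (h₁ : cv η = 0) : cv (η ▷ h) = 0 := h₁
lemma cz_inv {f g : X ⟶ Y} {η : f ≅ g} (h₁ : cv η.hom = 0) : cv η.inv = 0 := by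
  rw [cv_inv, h₁, neg_zero]
end Zero

section
variable {K} {X Y Z : Tot ((secCat K).prod (secCat K)).Obj}

def addObj {U : C} (x : IntObj K U × IntObj K U) : IntObj K U :=
  ⟨x.1.1 + x.2.1, by rw [map_add, x.1.2, x.2.2, add_zero]⟩

def addArrow (f : X ⟶ Y) :
    (Tot.mk X.base (addObj X.pt) : Tot (secCat K).Obj) ⟶ Tot.mk Y.base (addObj Y.pt) :=
  mkArrow (((secCat K).prod (secCat K)).proj f) (av f.fst + av f.snd)
    (dif_add_arrow f.eq (dif_av f.fst) (dif_av f.snd))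

lemma av_addArrow (f : X ⟶ Y) : av (addArrow f) = av f.fst + av f.snd := rfl

lemma av_addArrow_comp (f : X ⟶ Y) (g : Y ⟶ Z) :
    av (addArrow (f ≫ g)) = av (addArrow f ≫ addArrow g) := by
  let m := av f.snd
  let n := av g.snd
  exact add_res f.eq (av f.fst) m (av g.fst) n

def addCell {f g : X ⟶ Y} (η : f ⟶ g) : addArrow f ⟶ addArrow g :=
  mkCell (cv η.fst + cv η.snd) (((secCat K).prod (secCat K)).proj_eq η)
    (dif_add_cell (dif_cv η.fst) (dif_cv η.snd))

lemma cv_addCell {f g : X ⟶ Y} (η : f ⟶ g) : cv (addCell η) = cv η.fst + cv η.snd := rfl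

def addComp (f : X ⟶ Y) (g : Y ⟶ Z) : addArrow (f ≫ g) ≅ addArrow f ≫ addArrow g :=
  mkIso rfl (av_addArrow_comp f g)

lemma cv_addComp (f : X ⟶ Y) (g : Y ⟶ Z) : cv (addComp f g).hom = 0 := rfl

def addId (X : Tot ((secCat K).prod (secCat K)).Obj) :
    addArrow (𝟙 X) ≅ 𝟙 (Tot.mk X.base (addObj X.pt) : Tot (secCat K).Obj) :=
  mkIso rfl (add_zero _)

end

/-- The tensor product of `secCat K` is the addition. -/
def secTensor : FibFunctor ((secCat K).prod (secCat K)) (secCat K) where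
  obj := addObj
  map := addArrow
  proj_map f := rfl
  map₂ := addCell
  mapId := addId
  mapComp := addComp
  map₂_id f := cv_ext (add_zero _)
  map₂_comp η θ := cv_ext (add_add_add_comm _ _ _ _)
  map₂_whisker_left {X Y Z} f _ _ η := cv_ext (by
    rw [cv_comp, cv_comp, cv_inv, cv_addComp, cv_addComp, neg_zero, add_zero, zero_add]
    refine Eq.trans ?_ (map_add _ _ _).symm
    exact congrArg (fun k => _ + res K k (cv η.snd)) f.eq.symm)
  map₂_whisker_right η h := cv_ext (by
    rw [cv_comp, cv_comp, cv_inv, cv_addComp, cv_addComp, neg_zero, add_zero, zero_add]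
    rfl)
  map₂_associator f g h := cv_ext ((add_zero (0 : sec K (-2) _)).trans
    (cz_comp (cv_addComp _ _) (cz_comp (cz_right _ (cv_addComp _ _)) (cz_comp (cv_assoc_hom _ _ _)
      (cz_comp (cz_left _ (cz_inv (cv_addComp _ _))) (cz_inv (cv_addComp _ _)))))).symm)
  map₂_left_unitor f := cv_ext ((add_zero (0 : sec K (-2) _)).trans
    (cz_comp (cv_addComp _ _) (cz_comp (cz_right _ rfl) (cv_left_hom _))).symm)
  map₂_right_unitor f := cv_ext ((add_zero (0 : sec K (-2) _)).trans
    (cz_comp (cv_addComp _ _) (cz_comp (cz_left _ rfl) (cv_right_hom _))).symm)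

section Tens
variable {K} (F G : FibFunctor P (secCat K))
@[simp] lemma tens_obj {U : C} (x : P.Obj U) :
    ((tens (secTensor K) F G).obj x).1 = (F.obj x).1 + (G.obj x).1 := rfl
@[simp] lemma av_tens {X Y : Tot P.Obj} (f : X ⟶ Y) :
    av ((tens (secTensor K) F G).map f) = av (F.map f) + av (G.map f) := rfl
@[simp] lemma cv_tens {X Y : Tot P.Obj} {f g : X ⟶ Y} (η : f ⟶ g) :
    cv ((tens (secTensor K) F G).map₂ η) = cv (F.map₂ η) + cv (G.map₂ η) := rfl
@[simp] lemma cv_tens_mapId (X : Tot P.Obj) : cv ((tens (secTensor K) F G).mapId X).hom =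
    cv (F.mapId X).hom + cv (G.mapId X).hom := add_zero _
@[simp] lemma cv_tens_mapComp {X Y Z : Tot P.Obj} (f : X ⟶ Y) (g : Y ⟶ Z) :
    cv ((tens (secTensor K) F G).mapComp f g).hom =
    cv (F.mapComp f g).hom + cv (G.mapComp f g).hom := add_zero _
end Tens

/-- Associator and commutator are given by `0`. -/
def secData : PicardData (secCat K) where
  tensor := secTensor K
  assoc := zeroTrans (fun _ => by simp [add_assoc]) (fun _ => by simp [add_assoc])
    (fun _ => by simp [add_assoc]) (fun _ => by simp [add_assoc])
    (fun _ _ => by simp [add_assoc])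
  assocInv := zeroTrans (fun _ => by simp [add_assoc]) (fun _ => by simp [add_assoc])
    (fun _ => by simp [add_assoc]) (fun _ => by simp [add_assoc])
    (fun _ _ => by simp [add_assoc])
  comm := zeroTrans (fun _ => add_comm _ _) (fun _ => add_comm _ _) (fun _ => add_comm _ _)
    (fun _ => (cv_tens_mapId _ _ _).trans (add_zero _))
    (fun _ _ => (cv_tens_mapComp _ _ _ _).trans (add_zero _))

@[simp] lemma secData_tensor : (secData K).tensor = secTensor K := rfl

section Eval
variable {K} {P : FibTwoCat.{v, u, w, a, b} C} {F G H : FibFunctor P (secCat K)}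
@[simp] lemma av_pid {U : C} (x : P.Obj U) : av ((PreTrans.id F).app x) = 0 := rfl
@[simp] lemma cv_pid {X Y : Tot P.Obj} (f : X ⟶ Y) :
    cv ((PreTrans.id F).nat f).hom = 0 := add_zero _
lemma az_vcomp {s : PreTrans F G} {t : PreTrans G H} {U : C} (x : P.Obj U)
    (h : av (s.app x) = 0) (h' : av (t.app x) = 0) : av ((s.vcomp t).app x) = 0 :=
  (av_comp _ _).trans (by rw [h, h', map_zero, add_zero])
lemma cz_vcomp {s : PreTrans F G} {t : PreTrans G H} {X Y : Tot P.Obj} (f : X ⟶ Y)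
    (h : cv (s.nat f).hom = 0) (h' : cv (t.nat f).hom = 0) :
    cv ((s.vcomp t).nat f).hom = 0 :=
  cz_comp rfl (cz_comp (cz_right _ h) (cz_comp rfl (cz_comp (cz_left _ h') rfl)))
lemma az_ten {F' G' : FibFunctor P (secCat K)} {s : PreTrans F G} {t : PreTrans F' G'} {U : C}
    (x : P.Obj U) (h : av (s.app x) = 0) (h' : av (t.app x) = 0) :
    av (((secData K).tenT s t).app x) = 0 :=
  (congrArg₂ (· + ·) h h').trans (add_zero _)
lemma cz_ten {F' G' : FibFunctor P (secCat K)} {s : PreTrans F G} {t : PreTrans F' G'}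
    {X Y : Tot P.Obj} (f : X ⟶ Y) (h : cv (s.nat f).hom = 0) (h' : cv (t.nat f).hom = 0) :
    cv (((secData K).tenT s t).nat f).hom = 0 :=
  cz_comp (cz_inv (cv_addComp _ _)) (cz_comp
    ((congrArg₂ (· + ·) h h').trans (add_zero _)) (cv_addComp _ _))
lemma zeroMod' {s t : PreTrans F G} (h : ∀ {U : C} (x : P.Obj U), av (s.app x) = 0)
    (h' : ∀ {U : C} (x : P.Obj U), av (t.app x) = 0) {U : C} (x : P.Obj U) :
    av (s.app x) = av (t.app x) := (h x).trans (h' x).symm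
end Eval

def secCon : PicardConstraints (secData K) where
  unit := zeroMod (fun x => az_vcomp x rfl rfl)
    (fun f => (cz_vcomp f rfl rfl).trans (cv_pid f).symm)
  counit := zeroMod (fun x => az_vcomp x rfl rfl)
    (fun f => (cz_vcomp f rfl rfl).trans (cv_pid f).symm)
  pentagonator := zeroMod
    (fun x => (az_vcomp x rfl rfl).trans
      (az_vcomp x (az_ten x rfl rfl) (az_vcomp x rfl (az_ten x rfl rfl))).symm)
    (fun f => (cz_vcomp f rfl rfl).trans
      (cz_vcomp f (cz_ten f rfl (cv_pid f)) (cz_vcomp f rfl (cz_ten f (cv_pid f) rfl))).symm)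
  hexagonator₁ := zeroMod
    (fun x => (az_vcomp x rfl (az_vcomp x rfl rfl)).trans
      (az_vcomp x (az_ten x rfl rfl) (az_vcomp x rfl (az_ten x rfl rfl))).symm)
    (fun f => (cz_vcomp f rfl (cz_vcomp f rfl rfl)).trans
      (cz_vcomp f (cz_ten f rfl (cv_pid f)) (cz_vcomp f rfl (cz_ten f (cv_pid f) rfl))).symm)
  hexagonator₂ := zeroMod
    (fun x => (az_vcomp x rfl (az_vcomp x rfl rfl)).trans
      (az_vcomp x (az_ten x rfl rfl) (az_vcomp x rfl (az_ten x rfl rfl))).symm)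
    (fun f => (cz_vcomp f rfl (cz_vcomp f rfl rfl)).trans
      (cz_vcomp f (cz_ten f (cv_pid f) rfl) (cz_vcomp f rfl (cz_ten f rfl (cv_pid f)))).symm)
  syllepsis := zeroMod (fun x => az_vcomp x rfl rfl)
    (fun f => (cz_vcomp f rfl rfl).trans (cv_pid f).symm)
  strictness := zeroMod (fun _ => rfl) (fun f => (cv_pid f).symm)

lemma secCon_eval {ι : Type} {U : C} (x : ι → (secCat K).Obj U) {p q : Word ι}
    {f g : FormalArrow p q} (s : FormalCell f g) : cv ((secCon K).evalCell x s).hom = 0 := by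
  induction s with
  | refl => rfl
  | symm s ih => exact cz_inv ih
  | trans s t ih ih' => exact cz_comp ih ih'
  | hcomp s t ih ih' => exact cz_comp (cz_right _ ih) (cz_left _ ih')
  | tensor s t ih ih' => exact (congrArg₂ (· + ·) ih ih').trans (add_zero _)
  | _ => rfl

/-- The fibred 2-category of sections with the Picard structure given by addition. -/
def secPicard : PicardTwoCat C where
  cat := secCat K
  data := secData K
  con := secCon K
  coherence x _ _ _ _ s t := Iso.ext (cv_ext
    ((secCon_eval K x s).trans (secCon_eval K x t).symm))

section Map
variable {K} (φ : K ⟶ L) {X Y Z : Tot (secCat K).Obj}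

def morObj {U : C} (x : IntObj K U) : IntObj L U :=
  ⟨mor φ x.1, by rw [← mor_dif, x.2, map_zero]⟩

def morArrow (f : X ⟶ Y) :
    (Tot.mk X.base (morObj φ X.pt) : Tot (secCat L).Obj) ⟶ Tot.mk Y.base (morObj φ Y.pt) :=
  mkArrow ((secCat K).proj f) (mor φ (av f))
    ((mor_dif φ _).symm.trans ((congrArg (mor φ) (dif_av f)).trans
      ((map_sub _ _ _).trans (congrArg (· - _) (mor_res φ _ _)))))

lemma av_morArrow (f : X ⟶ Y) : av (morArrow φ f) = mor φ (av f) := rfl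

def morCell {f g : X ⟶ Y} (η : f ⟶ g) : morArrow φ f ⟶ morArrow φ g :=
  mkCell (mor φ (cv η)) ((secCat K).proj_eq η)
    ((mor_dif φ _).symm.trans ((congrArg (mor φ) (dif_cv η)).trans (map_sub _ _ _)))

def morComp (f : X ⟶ Y) (g : Y ⟶ Z) : morArrow φ (f ≫ g) ≅ morArrow φ f ≫ morArrow φ g :=
  mkIso rfl ((map_add _ _ _).trans (congrArg (_ + ·) (mor_res _ _ _)))

lemma cv_morComp (f : X ⟶ Y) (g : Y ⟶ Z) : cv (morComp φ f g).hom = 0 := rfl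

def morId (X : Tot (secCat K).Obj) :
    morArrow φ (𝟙 X) ≅ 𝟙 (Tot.mk X.base (morObj φ X.pt) : Tot (secCat L).Obj) :=
  mkIso rfl (map_zero _)

/-- The 2-functor on sections that is induced by a morphism of complexes. -/
def secMap : FibFunctor (secCat K) (secCat L) where
  obj := morObj φ
  map := morArrow φ
  proj_map f := rfl
  map₂ := morCell φ
  mapId := morId φ
  mapComp := morComp φ
  map₂_id f := cv_ext (map_zero _)
  map₂_comp η θ := cv_ext (map_add _ _ _)
  map₂_whisker_left f _ _ η := cv_ext (by
    rw [cv_comp, cv_comp, cv_inv, cv_morComp, cv_morComp, neg_zero, add_zero, zero_add]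
    exact mor_res _ _ _)
  map₂_whisker_right η h := cv_ext (by
    rw [cv_comp, cv_comp, cv_inv, cv_morComp, cv_morComp, neg_zero, add_zero, zero_add]
    rfl)
  map₂_associator f g h := cv_ext ((map_zero (mor φ (i := -2))).trans
    (cz_comp (cv_morComp φ _ _) (cz_comp (cz_right _ (cv_morComp φ _ _))
      (cz_comp (cv_assoc_hom _ _ _) (cz_comp (cz_left _ (cz_inv (cv_morComp φ _ _)))
        (cz_inv (cv_morComp φ _ _)))))).symm)
  map₂_left_unitor f := cv_ext ((map_zero (mor φ (i := -2))).trans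
    (cz_comp (cv_morComp φ _ _) (cz_comp (cz_right _ rfl) (cv_left_hom _))).symm)
  map₂_right_unitor f := cv_ext ((map_zero (mor φ (i := -2))).trans
    (cz_comp (cv_morComp φ _ _) (cz_comp (cz_left _ rfl) (cv_right_hom _))).symm)

lemma cz_map {f g : X ⟶ Y} {η : f ⟶ g} (h : cv η = 0) : cv ((secMap φ).map₂ η) = 0 :=
  (congrArg (mor φ) h).trans (map_zero _)

lemma az_map {f : X ⟶ Y} (h : av f = 0) : av ((secMap φ).map f) = 0 :=
  (congrArg (mor φ) h).trans (map_zero _)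

lemma add_z {i : ℤ} {U : C} {s t : sec L i U} (h : s = 0) (h' : t = 0) : s + t = 0 := by
  rw [h, h', add_zero]

lemma cz_compMap_id {F : FibFunctor P (secCat K)} {X : Tot P.Obj} (h : cv (F.mapId X).hom = 0) :
    cv ((F.comp (secMap φ)).mapId X).hom = 0 :=
  cz_comp (cz_map φ h) rfl

lemma cz_compMap (F : FibFunctor P (secCat K)) {X Y Z : Tot P.Obj} (f : X ⟶ Y) (g : Y ⟶ Z)
    (h : cv (F.mapComp f g).hom = 0) : cv ((F.comp (secMap φ)).mapComp f g).hom = 0 :=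
  cz_comp (cz_map φ h) (cv_morComp φ _ _)

def secMapData : AdditiveData (secData K) (secData L) (secMap φ) where
  lam := zeroTrans (fun _ => (map_add _ _ _).symm) (fun _ => (map_add _ _ _).symm)
    (fun _ => (map_add _ _ _).symm)
    (fun _ => (cv_tens_mapId _ _ _).trans ((add_z (cz_compMap_id φ rfl)
      (cz_compMap_id φ rfl)).trans (cz_compMap_id φ (F := secTensor K) rfl).symm))
    (fun f g => (cv_tens_mapComp _ _ f g).trans ((add_z (cz_compMap φ _ f g rfl)
      (cz_compMap φ _ f g rfl)).trans (cz_compMap φ (secTensor K) f g (cv_addComp f g)).symm))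

lemma az_postcomp {F G : FibFunctor P (secCat K)} {s : PreTrans F G} {U : C} (x : P.Obj U)
    (h : av (s.app x) = 0) : av ((s.postcomp (secMap φ)).app x) = 0 := az_map φ h

lemma cz_postcomp {F G : FibFunctor P (secCat K)} {s : PreTrans F G} {X Y : Tot P.Obj} (f : X ⟶ Y)
    (h : cv (s.nat f).hom = 0) : cv ((s.postcomp (secMap φ)).nat f).hom = 0 :=
  cz_comp (cz_inv (cv_morComp φ _ _)) (cz_comp (cz_map φ h) (cv_morComp φ _ _))

def secMapCon : AdditiveConstraints (secMapData φ) where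
  muAssoc := zeroMod
    (fun x => (az_vcomp x rfl (az_vcomp x (az_ten x rfl rfl) rfl)).trans
      (az_vcomp x (az_ten x rfl rfl) (az_vcomp x rfl (az_postcomp φ x rfl))).symm)
    (fun f => (cz_vcomp f rfl (cz_vcomp f (cz_ten f (cv_pid f) rfl) rfl)).trans
      (cz_vcomp f (cz_ten f rfl (cv_pid f)) (cz_vcomp f rfl (cz_postcomp φ f rfl))).symm)
  muAssocInv := zeroMod
    (fun x => (az_vcomp x rfl (az_vcomp x (az_ten x rfl rfl) rfl)).trans
      (az_vcomp x (az_ten x rfl rfl) (az_vcomp x rfl (az_postcomp φ x rfl))).symm)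
    (fun f => (cz_vcomp f rfl (cz_vcomp f (cz_ten f rfl (cv_pid f)) rfl)).trans
      (cz_vcomp f (cz_ten f (cv_pid f) rfl) (cz_vcomp f rfl (cz_postcomp φ f rfl))).symm)
  muBraid := zeroMod
    (fun x => (az_vcomp x rfl rfl).trans (az_vcomp x rfl (az_postcomp φ x rfl)).symm)
    (fun f => (cz_vcomp f rfl rfl).trans (cz_vcomp f rfl (cz_postcomp φ f rfl)).symm)

lemma av_lamWord {ι : Type} {U : C} (x : ι → (secCat K).Obj U) (p : Word ι) :
    av (AdditiveConstraints.lamWord (secMapData φ) x p).1 = 0 := by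
  induction p with
  | of i => rfl
  | mul p q ih ih' =>
    exact (av_comp _ _).trans (add_z (add_z ih ih') (map_zero _))

lemma cz_map₂ {X Y : Tot ((secCat K).prod (secCat K)).Obj} {f g : X ⟶ Y} {η : f ⟶ g}
    (h : cv η.fst = 0) (h' : cv η.snd = 0) : cv ((secTensor K).map₂ η) = 0 := add_z h h'

lemma cv_mu {ι : Type} {U : C} (x : ι → (secCat K).Obj U) {p q : Word ι} (f : FormalArrow p q) :
    cv ((secMapCon φ).mu x f).hom = 0 := by
  induction f with
  | one p => exact cz_comp rfl (cz_comp rfl (cz_left _ (cz_inv rfl)))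
  | comp f g ih ih' =>
    exact cz_comp rfl (cz_comp (cz_left _ ih') (cz_comp rfl (cz_comp (cz_right _ ih)
      (cz_comp rfl (cz_left _ (cz_inv (cv_morComp φ _ _)))))))
  | tensor f g ih ih' =>
    exact cz_comp rfl (cz_comp (cz_right _ (cz_comp (cz_inv (cv_addComp _ _))
      (cz_comp (cz_map₂ ih ih') (cv_addComp _ _)))) (cz_comp rfl (cz_comp (cz_left _ rfl) rfl)))
  | assoc p q r =>
    exact cz_comp (cz_left _ (cz_comp (cz_right _ (cz_comp (cz_map₂ (cz_inv rfl) rfl)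
      (cv_addComp _ _))) rfl)) (cz_comp rfl (cz_comp (cz_right _ (cz_inv rfl)) (cz_comp rfl
      (cz_comp (cz_left _ rfl) (cz_comp rfl (cz_comp (cz_right _ (cz_inv
        (cz_comp (cz_map₂ rfl (cz_inv rfl)) (cv_addComp _ _)))) rfl))))))
  | assocInv p q r =>
    exact cz_comp (cz_left _ (cz_comp (cz_right _ (cz_comp (cz_map₂ rfl (cz_inv rfl))
      (cv_addComp _ _))) rfl)) (cz_comp rfl (cz_comp (cz_right _ (cz_inv rfl)) (cz_comp rfl
      (cz_comp (cz_left _ rfl) (cz_comp rfl (cz_comp (cz_right _ (cz_inv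
        (cz_comp (cz_map₂ (cz_inv rfl) rfl) (cv_addComp _ _)))) rfl))))))
  | braid p q =>
    exact cz_comp rfl (cz_comp (cz_right _ (cz_inv rfl)) (cz_comp rfl
      (cz_comp (cz_left _ rfl) rfl)))

/-- The additive 2-functor that is induced by a morphism of complexes. -/
def secAdditive : AdditiveFunctor (secPicard K) (secPicard L) where
  functor := secMap φ
  data := secMapData φ
  con := secMapCon φ
  coherence x _ _ f g s := cv_ext
    ((cz_comp (cz_right _ (secCon_eval L _ s)) (cv_mu φ x g)).trans
      (cz_comp (cv_mu φ x f) (cz_left _ (cz_map φ (secCon_eval K x s)))).symm)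

end Map

end Integral

section FibredProductPicard

lemma cv_chain {J : GrothendieckTopology C}
    {M : CochainComplex (Sheaf J AddCommGrpCat.{max u v}) ℤ} {X Y Z X' Y' Z' : Tot (secCat M).Obj}
    {k : X ⟶ Z} {f : X ⟶ Y} {g : Y ⟶ Z} {x : X ⟶ X'} {y : Y ⟶ Y'} {z : Z ⟶ Z'} {f' : X' ⟶ Y'}
    {g' : Y' ⟶ Z'} {l : X' ⟶ Z'} (a : k ⟶ f ≫ g) (b : g ≫ z ⟶ y ≫ g') (c : f ≫ y ⟶ x ≫ f')
    (e : f' ≫ g' ⟶ l) :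
    cv (a ▷ z ≫ (α_ _ _ _).hom ≫ f ◁ b ≫ (α_ _ _ _).inv ≫ c ▷ g' ≫ (α_ _ _ _).hom ≫ x ◁ e) =
      cv a + (res M ((secCat M).proj f) (cv b) + (cv c + res M ((secCat M).proj x) (cv e))) := by
  simp

variable {J : GrothendieckTopology C}
  {K L M : CochainComplex (Sheaf J AddCommGrpCat.{max u v}) ℤ} {φ : K ⟶ M} {γ : L ⟶ M}

variable (φ γ) in
/-- The fibered product of the 2-functors on sections induced by `φ` and `γ`. -/
abbrev secProd : FibTwoCat C := fibProd (secMap φ) (secMap γ)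

section
variable {X Y Z W : Tot (secProd φ γ).Obj}

def p₁ (f : X ⟶ Y) : (Tot.mk X.base X.pt.fst : Tot (secCat K).Obj) ⟶ Tot.mk Y.base Y.pt.fst :=
  FibProdHom.fst f
def p₂ (f : X ⟶ Y) : (Tot.mk X.base X.pt.snd : Tot (secCat L).Obj) ⟶ Tot.mk Y.base Y.pt.snd :=
  FibProdHom.snd f
def lv (f : X ⟶ Y) : sec M (-2) X.base := cv (FibProdHom.cell f)
def q₁ {f g : X ⟶ Y} (η : f ⟶ g) : p₁ f ⟶ p₁ g := FibProdHom₂.fst η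
def q₂ {f g : X ⟶ Y} (η : f ⟶ g) : p₂ f ⟶ p₂ g := FibProdHom₂.snd η

lemma proj_p₂ (f : X ⟶ Y) : (secCat L).proj (p₂ f) = (secCat K).proj (p₁ f) := by
  have h : (secCat K).proj (p₁ f) ≫ (secCat M).proj Y.pt.link.1 =
      (secCat M).proj X.pt.link.1 ≫ (secCat L).proj (p₂ f) := (secCat M).proj_eq (FibProdHom.cell f)
  rw [X.pt.link.2, Y.pt.link.2, Category.id_comp] at h
  exact h.symm.trans (Category.comp_id _)

lemma dif_lv (f : X ⟶ Y) : dif M (-2) (-1) (lv f) =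
    (av X.pt.link.1 + mor γ (av (p₂ f))) -
      (mor φ (av (p₁ f)) + res M ((secCat K).proj (p₁ f)) (av Y.pt.link.1)) := by
  have h := dif_cv (FibProdHom.cell f)
  rw [av_comp, av_comp, X.pt.link.2, res_id] at h
  exact h

lemma lv_eq {f g : X ⟶ Y} (η : f ⟶ g) :
    mor φ (cv (q₁ η)) + lv g = lv f + mor γ (cv (q₂ η)) := by
  have h := congrArg cv (FibProdHom₂.comm η)
  rw [cv_comp, cv_comp, cv_whiskerRight, cv_whiskerLeft, X.pt.link.2, res_id] at h
  exact h

lemma q_ext {f g : X ⟶ Y} {η θ : f ⟶ g} (h : cv (q₁ η) = cv (q₁ θ))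
    (h' : cv (q₂ η) = cv (q₂ θ)) : η = θ := FibProdHom₂.ext (cv_ext h) (cv_ext h')

lemma lv_id : lv (𝟙 X) = 0 :=
  cz_comp (cz_right _ rfl) (cz_comp rfl (cz_comp rfl (cz_left _ (cz_inv rfl))))

lemma lv_comp (f : X ⟶ Y) (g : Y ⟶ Z) :
    lv (f ≫ g) = res M ((secCat K).proj (p₁ f)) (lv g) + lv f := by
  refine (cv_chain _ _ _ _).trans ?_
  change 0 + (res M ((secCat K).proj (p₁ f)) (lv g) + (lv f + 
    res M _ (cv ((secMap γ).mapComp (p₂ f) (p₂ g)).inv))) = _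
  have e : cv ((secMap γ).mapComp (p₂ f) (p₂ g)).inv = 0 := cz_inv (cv_morComp γ (p₂ f) (p₂ g))
  rw [e, map_zero, add_zero, zero_add]

def mkProdArrow (k : X.base ⟶ Y.base) (m : sec K (-1) X.base) (n : sec L (-1) X.base)
    (t : sec M (-2) X.base) (hm : dif K (-1) 0 m = res K k Y.pt.fst.1 - X.pt.fst.1)
    (hn : dif L (-1) 0 n = res L k Y.pt.snd.1 - X.pt.snd.1)
    (ht : dif M (-2) (-1) t = (av X.pt.link.1 + mor γ n) -
      (mor φ m + res M k (av Y.pt.link.1))) : X ⟶ Y :=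
  (⟨mkArrow k m hm, mkArrow k n hn, mkCell t
    ((congrArg (k ≫ ·) Y.pt.link.2).trans ((Category.comp_id _).trans
      ((Category.id_comp _).symm.trans (congrArg (· ≫ k) X.pt.link.2.symm))))
    (by
      rw [av_comp, av_comp, X.pt.link.2, res_id]
      exact ht)⟩ : FibProdHom X Y)

def mkProdIso {f g : X ⟶ Y} (h : (secCat K).proj (p₁ f) = (secCat K).proj (p₁ g))
    (h₁ : av (p₁ f) = av (p₁ g)) (h₂ : av (p₂ f) = av (p₂ g)) (h₃ : lv f = lv g) : f ≅ g :=
  fibProdIso (f := f) (g := g) (mkIso h h₁)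
    (mkIso ((proj_p₂ f).trans (h.trans (proj_p₂ g).symm)) h₂)
    (cv_ext (by
      rw [cv_comp, cv_comp, cv_whiskerRight, cv_whiskerLeft]
      change mor φ 0 + lv g = lv f + res M _ (mor γ 0)
      simp [h₃]))

/-- A 2-arrow with zero components. -/
def Cz {f g : X ⟶ Y} (η : f ⟶ g) : Prop := cv (q₁ η) = 0 ∧ cv (q₂ η) = 0

lemma Cz.ext {f g : X ⟶ Y} {η θ : f ⟶ g} (h : Cz η) (h' : Cz θ) : η = θ :=
  q_ext (h.1.trans h'.1.symm) (h.2.trans h'.2.symm)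
lemma Cz.comp {f g h : X ⟶ Y} {η : f ⟶ g} {θ : g ⟶ h} (h₁ : Cz η) (h₂ : Cz θ) : Cz (η ≫ θ) :=
  ⟨cz_comp h₁.1 h₂.1, cz_comp h₁.2 h₂.2⟩
lemma Cz.left (f : X ⟶ Y) {g h : Y ⟶ Z} {η : g ⟶ h} (h₁ : Cz η) : Cz (f ◁ η) :=
  ⟨cz_left (p₁ f) h₁.1, cz_left (p₂ f) h₁.2⟩
lemma Cz.right {f g : X ⟶ Y} {η : f ⟶ g} (h : Y ⟶ Z) (h₁ : Cz η) : Cz (η ▷ h) := h₁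
lemma Cz.inv {f g : X ⟶ Y} {η : f ≅ g} (h₁ : Cz η.hom) : Cz η.inv := by
  have h := congrArg q₁ η.hom_inv_id
  have h' := congrArg q₂ η.hom_inv_id
  have e : cv (q₁ η.hom) + cv (q₁ η.inv) = 0 := congrArg cv h
  have e' : cv (q₂ η.hom) + cv (q₂ η.inv) = 0 := congrArg cv h'
  rw [h₁.1, zero_add] at e
  rw [h₁.2, zero_add] at e'
  exact ⟨e, e'⟩
lemma Cz.id {f : X ⟶ Y} : Cz (𝟙 f) := ⟨rfl, rfl⟩
lemma Cz.mk {f g : X ⟶ Y} (h : (secCat K).proj (p₁ f) = (secCat K).proj (p₁ g))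
    (h₁ : av (p₁ f) = av (p₁ g)) (h₂ : av (p₂ f) = av (p₂ g)) (h₃ : lv f = lv g) :
    Cz (mkProdIso h h₁ h₂ h₃).hom := ⟨rfl, rfl⟩
lemma Cz.ahom (f : X ⟶ Y) (g : Y ⟶ Z) (h : Z ⟶ W) : Cz (α_ f g h).hom := ⟨rfl, rfl⟩
lemma Cz.ainv (f : X ⟶ Y) (g : Y ⟶ Z) (h : Z ⟶ W) : Cz (α_ f g h).inv := ⟨rfl, rfl⟩
lemma Cz.lhom (f : X ⟶ Y) : Cz (λ_ f).hom := ⟨rfl, rfl⟩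
lemma Cz.linv (f : X ⟶ Y) : Cz (λ_ f).inv := ⟨rfl, rfl⟩
lemma Cz.rhom (f : X ⟶ Y) : Cz (ρ_ f).hom := ⟨rfl, rfl⟩
lemma Cz.rinv (f : X ⟶ Y) : Cz (ρ_ f).inv := ⟨rfl, rfl⟩
end

section
variable {X Y Z : Tot (secProd φ γ).Obj}

def mkProdCell {f g : X ⟶ Y} (s : sec K (-2) X.base) (t : sec L (-2) X.base)
    (h : (secCat K).proj (p₁ f) = (secCat K).proj (p₁ g))
    (hs : dif K (-2) (-1) s = av (p₁ g) - av (p₁ f))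
    (ht : dif L (-2) (-1) t = av (p₂ g) - av (p₂ f))
    (hc : mor φ s + lv g = lv f + mor γ t) : f ⟶ g :=
  (⟨mkCell s h hs, mkCell t ((proj_p₂ f).trans (h.trans (proj_p₂ g).symm)) ht, cv_ext (by
    rw [cv_comp, cv_comp, cv_whiskerRight, cv_whiskerLeft, X.pt.link.2, res_id]
    exact hc)⟩ : FibProdHom₂ f g)

lemma av_p₁_comp (f : X ⟶ Y) (g : Y ⟶ Z) :
    av (p₁ (f ≫ g)) = av (p₁ f) + res K ((secCat K).proj (p₁ f)) (av (p₁ g)) := rfl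
lemma av_p₂_comp (f : X ⟶ Y) (g : Y ⟶ Z) :
    av (p₂ (f ≫ g)) = av (p₂ f) + res L ((secCat K).proj (p₁ f)) (av (p₂ g)) := by
  rw [← proj_p₂]; rfl
lemma cv_q₁_comp {f g h : X ⟶ Y} (η : f ⟶ g) (θ : g ⟶ h) :
    cv (q₁ (η ≫ θ)) = cv (q₁ η) + cv (q₁ θ) := rfl
lemma cv_q₂_comp {f g h : X ⟶ Y} (η : f ⟶ g) (θ : g ⟶ h) :
    cv (q₂ (η ≫ θ)) = cv (q₂ η) + cv (q₂ θ) := rfl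
lemma cv_q₁_left (f : X ⟶ Y) {g h : Y ⟶ Z} (η : g ⟶ h) :
    cv (q₁ (f ◁ η)) = res K ((secCat K).proj (p₁ f)) (cv (q₁ η)) := rfl
lemma cv_q₂_left (f : X ⟶ Y) {g h : Y ⟶ Z} (η : g ⟶ h) :
    cv (q₂ (f ◁ η)) = res L ((secCat K).proj (p₁ f)) (cv (q₂ η)) := by
  rw [← proj_p₂]; rfl
lemma cv_q₁_right {f g : X ⟶ Y} (η : f ⟶ g) (h : Y ⟶ Z) : cv (q₁ (η ▷ h)) = cv (q₁ η) := rfl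
lemma cv_q₂_right {f g : X ⟶ Y} (η : f ⟶ g) (h : Y ⟶ Z) : cv (q₂ (η ▷ h)) = cv (q₂ η) := rfl

lemma dif_link {U : C} (x : (secProd φ γ).Obj U) :
    dif M (-1) 0 (av x.link.1) = mor γ x.snd.1 - mor φ x.fst.1 := by
  have h := dif_av x.link.1
  rw [x.link.2, res_id] at h
  exact h

lemma dif_add_lv {U V : C} {k k' : U ⟶ V} (hk : k = k') {t t' : sec M (-2) U}
    {n n' : sec L (-1) U} {m m' : sec K (-1) U} {a a' : sec M (-1) U} {b b' : sec M (-1) V}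
    (h : dif M (-2) (-1) t = (a + mor γ n) - (mor φ m + res M k b))
    (h' : dif M (-2) (-1) t' = (a' + mor γ n') - (mor φ m' + res M k' b')) :
    dif M (-2) (-1) (t + t') =
      ((a + a') + mor γ (n + n')) - (mor φ (m + m') + res M k (b + b')) := by
  subst hk; simp only [map_add, h, h']; abel

end

section
variable {X Y Z : Tot ((secProd φ γ).prod (secProd φ γ)).Obj}

def prodAddObj {U : C} (x : (secProd φ γ).Obj U × (secProd φ γ).Obj U) :
    (secProd φ γ).Obj U where
  fst := addObj (x.1.fst, x.2.fst)
  snd := addObj (x.1.snd, x.2.snd)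
  link := ⟨mkArrow (𝟙 U) (av x.1.link.1 + av x.2.link.1) (by
    rw [map_add, dif_link, dif_link, res_id]
    change _ = mor γ (x.1.snd.1 + x.2.snd.1) - mor φ (x.1.fst.1 + x.2.fst.1)
    rw [map_add, map_add]; abel), rfl⟩

def prodAddArrow (f : X ⟶ Y) : (Tot.mk X.base (prodAddObj X.pt) : Tot (secProd φ γ).Obj) ⟶
    Tot.mk Y.base (prodAddObj Y.pt) :=
  mkProdArrow ((secCat K).proj (p₁ f.fst)) (av (p₁ f.fst) + av (p₁ f.snd))
    (av (p₂ f.fst) + av (p₂ f.snd)) (lv f.fst + lv f.snd)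
    (dif_add_arrow f.eq (dif_av (p₁ f.fst)) (dif_av (p₁ f.snd)))
    ((dif_add_arrow (k := (secCat L).proj (p₂ f.fst))
      ((proj_p₂ f.fst).trans (f.eq.trans (proj_p₂ f.snd).symm)) (dif_av (p₂ f.fst))
      (dif_av (p₂ f.snd))).trans (by rw [proj_p₂]; rfl))
    (dif_add_lv f.eq (dif_lv f.fst) (dif_lv f.snd))

def prodAddCell {f g : X ⟶ Y} (η : f ⟶ g) : prodAddArrow f ⟶ prodAddArrow g :=
  mkProdCell (cv (q₁ η.fst) + cv (q₁ η.snd)) (cv (q₂ η.fst) + cv (q₂ η.snd))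
    (show (secCat K).proj (p₁ f.fst) = (secCat K).proj (p₁ g.fst) from (secCat K).proj_eq (q₁ η.fst))
    (dif_add_cell (dif_cv (q₁ η.fst)) (dif_cv (q₁ η.snd)))
    (dif_add_cell (dif_cv (q₂ η.fst)) (dif_cv (q₂ η.snd))) (by
      change mor φ (cv (q₁ η.fst) + cv (q₁ η.snd)) + (lv g.fst + lv g.snd) =
        (lv f.fst + lv f.snd) + mor γ (cv (q₂ η.fst) + cv (q₂ η.snd))
      rw [map_add, map_add, add_add_add_comm, lv_eq η.fst, lv_eq η.snd, add_add_add_comm])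

lemma p₁_prodAddArrow_comp (f : X ⟶ Y) (g : Y ⟶ Z) :
    av (p₁ (prodAddArrow (f ≫ g))) = av (p₁ (prodAddArrow f ≫ prodAddArrow g)) := by
  let m := av (p₁ f.snd)
  let n := av (p₁ g.snd)
  exact add_res f.eq (av (p₁ f.fst)) m (av (p₁ g.fst)) n

lemma p₂_prodAddArrow_comp (f : X ⟶ Y) (g : Y ⟶ Z) :
    av (p₂ (prodAddArrow (f ≫ g))) = av (p₂ (prodAddArrow f ≫ prodAddArrow g)) := by
  let m := av (p₂ f.snd)
  let n := av (p₂ g.snd)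
  have e := add_res (k := (secCat L).proj (p₂ f.fst))
    ((proj_p₂ f.fst).trans (f.eq.trans (proj_p₂ f.snd).symm)) (av (p₂ f.fst)) m
    (av (p₂ g.fst)) n
  refine e.trans ?_
  rw [proj_p₂]; rfl

lemma lv_prodAddArrow_comp (f : X ⟶ Y) (g : Y ⟶ Z) :
    lv (prodAddArrow (f ≫ g)) = lv (prodAddArrow f ≫ prodAddArrow g) := by
  let m := lv f.snd
  let n := lv g.snd
  refine Eq.trans ?_ (lv_comp (prodAddArrow f) (prodAddArrow g)).symm
  refine (congrArg₂ (· + ·) (lv_comp f.fst g.fst) (lv_comp f.snd g.snd)).trans ?_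
  have h : (secCat K).proj (p₁ f.snd) = (secCat K).proj (p₁ f.fst) := f.eq.symm
  change (_ + _) + (res M _ n + m) = res M _ (lv g.fst + n) + (lv f.fst + m)
  rw [h, map_add, add_add_add_comm]; rfl

def prodAddComp (f : X ⟶ Y) (g : Y ⟶ Z) :
    prodAddArrow (f ≫ g) ≅ prodAddArrow f ≫ prodAddArrow g :=
  mkProdIso rfl (p₁_prodAddArrow_comp f g) (p₂_prodAddArrow_comp f g) (lv_prodAddArrow_comp f g)

lemma Cz.add (f : X ⟶ Y) (g : Y ⟶ Z) : Cz (prodAddComp f g).hom := ⟨rfl, rfl⟩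

def prodAddId (X : Tot ((secProd φ γ).prod (secProd φ γ)).Obj) :
    prodAddArrow (𝟙 X) ≅ 𝟙 (Tot.mk X.base (prodAddObj X.pt) : Tot (secProd φ γ).Obj) :=
  mkProdIso rfl (add_zero _) (add_zero _) 
    ((add_z (lv_id (X := Tot.mk X.base X.pt.1)) (lv_id (X := Tot.mk X.base X.pt.2))).trans
      (lv_id (X := Tot.mk X.base (prodAddObj X.pt))).symm)

lemma Cz.addCell {f g : X ⟶ Y} {η : f ⟶ g} (h : Cz η.fst) (h' : Cz η.snd) :
    Cz (prodAddCell η) := ⟨add_z h.1 h'.1, add_z h.2 h'.2⟩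

end

variable (φ γ) in
/-- The tensor product of the fibered product is componentwise:
`(X, l, Y) ⊗ (X', l', Y') = (X ⊗ X', l ⊗ l', Y ⊗ Y')`. -/
def prodTensor : FibFunctor ((secProd φ γ).prod (secProd φ γ)) (secProd φ γ) where
  obj := prodAddObj
  map := prodAddArrow
  proj_map f := rfl
  map₂ := prodAddCell
  mapId := prodAddId
  mapComp := prodAddComp
  map₂_id f := q_ext (add_zero _) (add_zero _)
  map₂_comp η θ := q_ext (add_add_add_comm _ _ _ _) (add_add_add_comm _ _ _ _)
  map₂_whisker_left f _ _ η := q_ext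
    (by
      rw [cv_q₁_comp, cv_q₁_comp, (Cz.add _ _).1, (Cz.inv (Cz.add _ _)).1, add_zero, zero_add]
      refine Eq.trans ?_ (map_add _ _ _).symm
      exact congrArg (fun k => _ + res K k (cv (q₁ η.snd))) f.eq.symm)
    (by
      rw [cv_q₂_comp, cv_q₂_comp, (Cz.add _ _).2, (Cz.inv (Cz.add _ _)).2, add_zero, zero_add,
        cv_q₂_left]
      refine Eq.trans ?_ (map_add _ _ _).symm
      refine (congrArg₂ (· + ·) (cv_q₂_left f.fst η.fst) (cv_q₂_left f.snd η.snd)).trans ?_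
      exact congrArg (fun k => _ + res L k (cv (q₂ η.snd))) f.eq.symm)
  map₂_whisker_right η h := q_ext
    (by
      rw [cv_q₁_comp, cv_q₁_comp, (Cz.add _ _).1, (Cz.inv (Cz.add _ _)).1, add_zero, zero_add]
      rfl)
    (by
      rw [cv_q₂_comp, cv_q₂_comp, (Cz.add _ _).2, (Cz.inv (Cz.add _ _)).2, add_zero, zero_add]
      rfl)
  map₂_associator f g h := Cz.ext (Cz.addCell (Cz.ahom _ _ _) (Cz.ahom _ _ _))
    (Cz.comp (Cz.add _ _) (Cz.comp (Cz.right _ (Cz.add _ _)) (Cz.comp (Cz.ahom _ _ _)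
      (Cz.comp (Cz.left _ (Cz.inv (Cz.add _ _))) (Cz.inv (Cz.add _ _))))))
  map₂_left_unitor f := Cz.ext (Cz.addCell (Cz.lhom _) (Cz.lhom _))
    (Cz.comp (Cz.add _ _) (Cz.comp (Cz.right _ ⟨rfl, rfl⟩) (Cz.lhom _)))
  map₂_right_unitor f := Cz.ext (Cz.addCell (Cz.rhom _) (Cz.rhom _))
    (Cz.comp (Cz.add _ _) (Cz.comp (Cz.left _ ⟨rfl, rfl⟩) (Cz.rhom _)))

section
variable {D : FibTwoCat.{v, u, w, a, b} C} {F G H : FibFunctor D (secProd φ γ)}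

/-- A 1-arrow with zero components. -/
structure Az {X Y : Tot (secProd φ γ).Obj} (f : X ⟶ Y) : Prop where
  fst : av (p₁ f) = 0
  snd : av (p₂ f) = 0
  link : lv f = 0

lemma Az.comp {X Y Z : Tot (secProd φ γ).Obj} {f : X ⟶ Y} {g : Y ⟶ Z} (h : Az f) (h' : Az g) :
    Az (f ≫ g) where
  fst := by rw [av_p₁_comp, h.fst, h'.fst, map_zero, add_zero]
  snd := by rw [av_p₂_comp, h.snd, h'.snd, map_zero, add_zero]
  link := by rw [lv_comp, h.link, h'.link, map_zero, add_zero]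

lemma Az.id (X : Tot (secProd φ γ).Obj) : Az (𝟙 X) := ⟨rfl, rfl, lv_id⟩

section
variable {X Y Z : Tot (secProd φ γ).Obj}
lemma Az.right₁ (f : X ⟶ Y) {g : Y ⟶ Z} (h : Az g) : av (p₁ (f ≫ g)) = av (p₁ f) := by
  rw [av_p₁_comp, h.fst, map_zero, add_zero]
lemma Az.right₂ (f : X ⟶ Y) {g : Y ⟶ Z} (h : Az g) : av (p₂ (f ≫ g)) = av (p₂ f) := by
  rw [av_p₂_comp, h.snd, map_zero, add_zero]
lemma Az.right₃ (f : X ⟶ Y) {g : Y ⟶ Z} (h : Az g) : lv (f ≫ g) = lv f := by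
  rw [lv_comp, h.link, map_zero, zero_add]

variable {U : C} {x y : (secProd φ γ).Obj U} {f : (Tot.mk U x : Tot (secProd φ γ).Obj) ⟶ Tot.mk U y}

lemma Az.left₁ (h : Az f) (hf : (secCat K).proj (p₁ f) = 𝟙 U) (g : Tot.mk U y ⟶ Z) :
    av (p₁ (f ≫ g)) = av (p₁ g) := by
  rw [av_p₁_comp, h.fst, hf, res_id, zero_add]
lemma Az.left₂ (h : Az f) (hf : (secCat K).proj (p₁ f) = 𝟙 U) (g : Tot.mk U y ⟶ Z) :
    av (p₂ (f ≫ g)) = av (p₂ g) := by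
  rw [av_p₂_comp, h.snd, hf, res_id, zero_add]
lemma Az.left₃ (h : Az f) (hf : (secCat K).proj (p₁ f) = 𝟙 U) (g : Tot.mk U y ⟶ Z) :
    lv (f ≫ g) = lv g := by
  rw [lv_comp, h.link, hf, res_id, add_zero]

variable (x y) in
def zeroArrow (h₁ : x.fst.1 = y.fst.1) (h₂ : x.snd.1 = y.snd.1)
    (h₃ : av x.link.1 = av y.link.1) : (Tot.mk U x : Tot (secProd φ γ).Obj) ⟶ Tot.mk U y :=
  mkProdArrow (𝟙 U) 0 0 0 (by simp [h₁]) (by simp [h₂]) (by simp [h₃])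

lemma Az.zero (h₁ : x.fst.1 = y.fst.1) (h₂ : x.snd.1 = y.snd.1)
    (h₃ : av x.link.1 = av y.link.1) : Az (zeroArrow x y h₁ h₂ h₃) := ⟨rfl, rfl, rfl⟩

end

def prodZeroTrans
    (h₁ : ∀ {U : C} (x : D.Obj U), (F.obj x).fst.1 = (G.obj x).fst.1)
    (h₂ : ∀ {U : C} (x : D.Obj U), (F.obj x).snd.1 = (G.obj x).snd.1)
    (h₃ : ∀ {U : C} (x : D.Obj U), av (F.obj x).link.1 = av (G.obj x).link.1)
    (k₁ : ∀ {X Y : Tot D.Obj} (f : X ⟶ Y), av (p₁ (F.map f)) = av (p₁ (G.map f)))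
    (k₂ : ∀ {X Y : Tot D.Obj} (f : X ⟶ Y), av (p₂ (F.map f)) = av (p₂ (G.map f)))
    (k₃ : ∀ {X Y : Tot D.Obj} (f : X ⟶ Y), lv (F.map f) = lv (G.map f))
    (l₁ : ∀ {X Y : Tot D.Obj} {f g : X ⟶ Y} (η : f ⟶ g),
      cv (q₁ (F.map₂ η)) = cv (q₁ (G.map₂ η)))
    (l₂ : ∀ {X Y : Tot D.Obj} {f g : X ⟶ Y} (η : f ⟶ g),
      cv (q₂ (F.map₂ η)) = cv (q₂ (G.map₂ η)))
    (iF : ∀ X : Tot D.Obj, Cz (F.mapId X).hom) (iG : ∀ X : Tot D.Obj, Cz (G.mapId X).hom)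
    (cF : ∀ {X Y Z : Tot D.Obj} (f : X ⟶ Y) (g : Y ⟶ Z), Cz (F.mapComp f g).hom)
    (cG : ∀ {X Y Z : Tot D.Obj} (f : X ⟶ Y) (g : Y ⟶ Z), Cz (G.mapComp f g).hom) :
    FibTrans F G where
  app x := zeroArrow (F.obj x) (G.obj x) (h₁ x) (h₂ x) (h₃ x)
  proj_app x := rfl
  nat {X Y} f := mkProdIso
    (((congrArg (· ≫ 𝟙 Y.base) (F.proj_map f)).trans (Category.comp_id _)).trans
      ((congrArg (𝟙 X.base ≫ ·) (G.proj_map f)).trans (Category.id_comp _)).symm)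
    (by rw [Az.right₁ _ (Az.zero (h₁ Y.pt) (h₂ Y.pt) (h₃ Y.pt)),
      Az.left₁ (Az.zero (h₁ X.pt) (h₂ X.pt) (h₃ X.pt)) rfl, k₁])
    (by rw [Az.right₂ _ (Az.zero (h₁ Y.pt) (h₂ Y.pt) (h₃ Y.pt)),
      Az.left₂ (Az.zero (h₁ X.pt) (h₂ X.pt) (h₃ X.pt)) rfl, k₂])
    (by rw [Az.right₃ _ (Az.zero (h₁ Y.pt) (h₂ Y.pt) (h₃ Y.pt)),
      Az.left₃ (Az.zero (h₁ X.pt) (h₂ X.pt) (h₃ X.pt)) rfl, k₃])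
  naturality η := q_ext
    ((add_zero _).trans ((l₁ η).trans ((zero_add _).trans (res_id K _)).symm))
    (by
      rw [cv_q₂_comp, cv_q₂_comp, cv_q₂_right, cv_q₂_left]
      exact (add_zero _).trans ((l₂ η).trans ((zero_add _).trans (res_id L _)).symm))
  nat_id X := Cz.ext (Cz.comp (Cz.mk _ _ _ _) (Cz.left _ (iG X)))
    (Cz.comp (Cz.right _ (iF X)) (Cz.comp (Cz.lhom _) (Cz.rinv _)))
  nat_comp f g := Cz.ext (Cz.comp (Cz.mk _ _ _ _) (Cz.left _ (cG f g)))
    (Cz.comp (Cz.right _ (cF f g)) (Cz.comp (Cz.ahom _ _ _) (Cz.comp (Cz.left _ (Cz.mk _ _ _ _))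
      (Cz.comp (Cz.ainv _ _ _) (Cz.comp (Cz.right _ (Cz.mk _ _ _ _)) (Cz.ahom _ _ _))))))

def prodZeroMod {s t : PreTrans F G} (h : ∀ {U : C} (x : D.Obj U), Az (s.app x))
    (h' : ∀ {U : C} (x : D.Obj U), Az (t.app x))
    (hn : ∀ {X Y : Tot D.Obj} (f : X ⟶ Y), Cz (s.nat f).hom)
    (hn' : ∀ {X Y : Tot D.Obj} (f : X ⟶ Y), Cz (t.nat f).hom) : FibMod s t where
  app x := mkProdIso ((s.proj_app x).trans (t.proj_app x).symm)
    ((h x).fst.trans (h' x).fst.symm) ((h x).snd.trans (h' x).snd.symm)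
    ((h x).link.trans (h' x).link.symm)
  naturality f := Cz.ext (Cz.comp (Cz.left _ ⟨rfl, rfl⟩) (hn' f))
    (Cz.comp (hn f) (Cz.right _ ⟨rfl, rfl⟩))

lemma Cz.tens_id {X : Tot D.Obj} (h : Cz (F.mapId X).hom) (h' : Cz (G.mapId X).hom) :
    Cz ((tens (prodTensor φ γ) F G).mapId X).hom :=
  Cz.comp (Cz.addCell h h') ⟨rfl, rfl⟩

lemma Cz.tens_comp {X Y Z : Tot D.Obj} (f : X ⟶ Y) (g : Y ⟶ Z) (h : Cz (F.mapComp f g).hom)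
    (h' : Cz (G.mapComp f g).hom) : Cz ((tens (prodTensor φ γ) F G).mapComp f g).hom :=
  Cz.comp (Cz.addCell h h') (Cz.add _ _)

end

variable (φ γ) in
def prodData : PicardData (secProd φ γ) where
  tensor := prodTensor φ γ
  assoc := prodZeroTrans (fun _ => add_assoc _ _ _) (fun _ => add_assoc _ _ _)
    (fun _ => add_assoc _ _ _) (fun _ => add_assoc _ _ _) (fun _ => add_assoc _ _ _)
    (fun _ => add_assoc _ _ _) (fun _ => add_assoc _ _ _) (fun _ => add_assoc _ _ _)
    (fun _ => Cz.tens_id (Cz.tens_id (Cz.comp Cz.id Cz.id) (Cz.comp Cz.id Cz.id)) Cz.id)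
    (fun _ => Cz.tens_id (Cz.comp Cz.id Cz.id) (Cz.tens_id (Cz.comp Cz.id Cz.id) Cz.id))
    (fun f g => Cz.tens_comp f g (Cz.tens_comp f g (Cz.comp Cz.id Cz.id)
      (Cz.comp Cz.id Cz.id)) Cz.id)
    (fun f g => Cz.tens_comp f g (Cz.comp Cz.id Cz.id)
      (Cz.tens_comp f g (Cz.comp Cz.id Cz.id) Cz.id))
  assocInv := prodZeroTrans (fun _ => (add_assoc _ _ _).symm) (fun _ => (add_assoc _ _ _).symm)
    (fun _ => (add_assoc _ _ _).symm) (fun _ => (add_assoc _ _ _).symm)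
    (fun _ => (add_assoc _ _ _).symm) (fun _ => (add_assoc _ _ _).symm)
    (fun _ => (add_assoc _ _ _).symm) (fun _ => (add_assoc _ _ _).symm)
    (fun _ => Cz.tens_id (Cz.comp Cz.id Cz.id) (Cz.tens_id (Cz.comp Cz.id Cz.id) Cz.id))
    (fun _ => Cz.tens_id (Cz.tens_id (Cz.comp Cz.id Cz.id) (Cz.comp Cz.id Cz.id)) Cz.id)
    (fun f g => Cz.tens_comp f g (Cz.comp Cz.id Cz.id)
      (Cz.tens_comp f g (Cz.comp Cz.id Cz.id) Cz.id))
    (fun f g => Cz.tens_comp f g (Cz.tens_comp f g (Cz.comp Cz.id Cz.id)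
      (Cz.comp Cz.id Cz.id)) Cz.id)
  comm := prodZeroTrans (fun _ => add_comm _ _) (fun _ => add_comm _ _)
    (fun _ => add_comm _ _) (fun _ => add_comm _ _) (fun _ => add_comm _ _)
    (fun _ => add_comm _ _) (fun _ => add_comm _ _) (fun _ => add_comm _ _)
    (fun _ => Cz.tens_id Cz.id Cz.id) (fun _ => ⟨rfl, rfl⟩)
    (fun f g => Cz.tens_comp f g Cz.id Cz.id) (fun _ _ => ⟨rfl, rfl⟩)

section
variable {D : FibTwoCat.{v, u, w, a, b} C} {F G H F' G' : FibFunctor D (secProd φ γ)}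

lemma Az.vcomp {s : PreTrans F G} {t : PreTrans G H} {U : C} (x : D.Obj U) (h : Az (s.app x))
    (h' : Az (t.app x)) : Az ((s.vcomp t).app x) := Az.comp h h'
lemma Az.ten {s : PreTrans F G} {t : PreTrans F' G'} {U : C} (x : D.Obj U) (h : Az (s.app x))
    (h' : Az (t.app x)) : Az (((prodData φ γ).tenT s t).app x) :=
  ⟨add_z h.fst h'.fst, add_z h.snd h'.snd, add_z h.link h'.link⟩
lemma Az.pid {U : C} (x : D.Obj U) : Az ((PreTrans.id F).app x) := Az.id _
lemma Cz.pid {X Y : Tot D.Obj} (f : X ⟶ Y) : Cz ((PreTrans.id F).nat f).hom :=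
  Cz.comp (Cz.rhom _) (Cz.linv _)
lemma Cz.vcomp {s : PreTrans F G} {t : PreTrans G H} {X Y : Tot D.Obj} (f : X ⟶ Y)
    (h : Cz (s.nat f).hom) (h' : Cz (t.nat f).hom) : Cz ((s.vcomp t).nat f).hom :=
  Cz.comp (Cz.ainv _ _ _) (Cz.comp (Cz.right _ h) (Cz.comp (Cz.ahom _ _ _)
    (Cz.comp (Cz.left _ h') (Cz.ainv _ _ _))))
lemma Cz.ten {s : PreTrans F G} {t : PreTrans F' G'} {X Y : Tot D.Obj} (f : X ⟶ Y)
    (h : Cz (s.nat f).hom) (h' : Cz (t.nat f).hom) :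
    Cz (((prodData φ γ).tenT s t).nat f).hom :=
  Cz.comp (Cz.inv (Cz.add _ _)) (Cz.comp (Cz.addCell h h') (Cz.add _ _))
lemma az_asc {U : C} (x : D.Obj U) : Az (((prodData φ γ).asc F G H).app x) := ⟨rfl, rfl, rfl⟩
lemma az_ascInv {U : C} (x : D.Obj U) : Az (((prodData φ γ).ascInv F G H).app x) :=
  ⟨rfl, rfl, rfl⟩
lemma az_braid {U : C} (x : D.Obj U) : Az (((prodData φ γ).braid F G).app x) := ⟨rfl, rfl, rfl⟩
lemma zz_asc {X Y : Tot D.Obj} (f : X ⟶ Y) : Cz (((prodData φ γ).asc F G H).nat f).hom :=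
  ⟨rfl, rfl⟩
lemma zz_ascInv {X Y : Tot D.Obj} (f : X ⟶ Y) : Cz (((prodData φ γ).ascInv F G H).nat f).hom :=
  ⟨rfl, rfl⟩
lemma zz_braid {X Y : Tot D.Obj} (f : X ⟶ Y) : Cz (((prodData φ γ).braid F G).nat f).hom :=
  ⟨rfl, rfl⟩
end

variable (φ γ) in
def prodCon : PicardConstraints (prodData φ γ) where
  unit := prodZeroMod (fun x => Az.vcomp x (az_asc x) (az_ascInv x)) (fun x => Az.pid x)
    (fun f => Cz.vcomp f (zz_asc f) (zz_ascInv f)) (fun f => Cz.pid f)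
  counit := prodZeroMod (fun x => Az.vcomp x (az_ascInv x) (az_asc x)) (fun x => Az.pid x)
    (fun f => Cz.vcomp f (zz_ascInv f) (zz_asc f)) (fun f => Cz.pid f)
  pentagonator := prodZeroMod
    (fun x => Az.vcomp x (az_asc x) (az_asc x))
    (fun x => Az.vcomp x (Az.ten x (az_asc x) (Az.pid x))
      (Az.vcomp x (az_asc x) (Az.ten x (Az.pid x) (az_asc x))))
    (fun f => Cz.vcomp f (zz_asc f) (zz_asc f))
    (fun f => Cz.vcomp f (Cz.ten f (zz_asc f) (Cz.pid f))
      (Cz.vcomp f (zz_asc f) (Cz.ten f (Cz.pid f) (zz_asc f))))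
  hexagonator₁ := prodZeroMod
    (fun x => Az.vcomp x (az_asc x) (Az.vcomp x (az_braid x) (az_asc x)))
    (fun x => Az.vcomp x (Az.ten x (az_braid x) (Az.pid x))
      (Az.vcomp x (az_asc x) (Az.ten x (Az.pid x) (az_braid x))))
    (fun f => Cz.vcomp f (zz_asc f) (Cz.vcomp f (zz_braid f) (zz_asc f)))
    (fun f => Cz.vcomp f (Cz.ten f (zz_braid f) (Cz.pid f))
      (Cz.vcomp f (zz_asc f) (Cz.ten f (Cz.pid f) (zz_braid f))))
  hexagonator₂ := prodZeroMod
    (fun x => Az.vcomp x (az_ascInv x) (Az.vcomp x (az_braid x) (az_ascInv x)))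
    (fun x => Az.vcomp x (Az.ten x (Az.pid x) (az_braid x))
      (Az.vcomp x (az_ascInv x) (Az.ten x (az_braid x) (Az.pid x))))
    (fun f => Cz.vcomp f (zz_ascInv f) (Cz.vcomp f (zz_braid f) (zz_ascInv f)))
    (fun f => Cz.vcomp f (Cz.ten f (Cz.pid f) (zz_braid f))
      (Cz.vcomp f (zz_ascInv f) (Cz.ten f (zz_braid f) (Cz.pid f))))
  syllepsis := prodZeroMod (fun x => Az.vcomp x (az_braid x) (az_braid x)) (fun x => Az.pid x)
    (fun f => Cz.vcomp f (zz_braid f) (zz_braid f)) (fun f => Cz.pid f)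
  strictness := prodZeroMod (fun x => az_braid x) (fun x => Az.pid x) (fun f => zz_braid f)
    (fun f => Cz.pid f)

lemma prodCon_eval {ι : Type} {U : C} (x : ι → (secProd φ γ).Obj U) {p q : Word ι}
    {f g : FormalArrow p q} (s : FormalCell f g) : Cz ((prodCon φ γ).evalCell x s).hom := by
  induction s with
  | symm s ih => exact Cz.inv ih
  | trans s t ih ih' => exact Cz.comp ih ih'
  | hcomp s t ih ih' => exact Cz.comp (Cz.right _ ih) (Cz.left _ ih')
  | tensor s t ih ih' => exact Cz.addCell ih ih'
  | tensorComp f g f' g' => exact Cz.add _ _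
  | _ => exact ⟨rfl, rfl⟩

variable (φ γ) in
/-- The fibered product of the Picard 2-categories of sections of `K` and `L` over that of `M`,
along the additive 2-functors induced by `φ` and `γ`. -/
def prodPicard : PicardTwoCat C where
  cat := secProd φ γ
  data := prodData φ γ
  con := prodCon φ γ
  coherence x _ _ _ _ s t := Iso.ext (Cz.ext (prodCon_eval x s) (prodCon_eval x t))

end FibredProductPicard

section MainObjects

variable {J : GrothendieckTopology C}

/-- An injective resolution, in degrees `≥ -2`, of a complex `K` of abelian sheaves.  The
2-category of sections `secCat cx` is then the 2-stack `2st(K)` associated with `K`: the functor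
`secMap ι : secCat K → secCat cx` from the 2-prestack defined by `K` is the 2-stackification
map. -/
structure InjRes (K : CochainComplex (Sheaf J AddCommGrpCat.{max u v}) ℤ) where
  cx : CochainComplex (Sheaf J AddCommGrpCat.{max u v}) ℤ
  ι : K ⟶ cx
  injective (i : ℤ) : Injective (cx.X i)
  strictlyGE : cx.IsStrictlyGE (-2)
  quasiIso : QuasiIso ι

/-- The Picard 2-stack `2st(K)` of a complex, computed by an injective resolution. -/
noncomputable abbrev InjRes.twoStack {K : CochainComplex (Sheaf J AddCommGrpCat.{max u v}) ℤ}
    (R : InjRes K) : PicardTwoCat.{v, u, max u v, max u v, max u v} C := secPicard R.cx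

/-- `2st(K)` is a Picard 2-stack, and it is the 2-stack associated with the 2-prestack `secCat K`
of sections of `K`, through the additive functor `secCat K → 2st(K)`. -/
structure InjRes.IsAssociated {K : CochainComplex (Sheaf J AddCommGrpCat.{max u v}) ℤ}
    (R : InjRes K) : Prop where
  isPicardTwoStack : R.twoStack.IsPicardTwoStack J
  isLocalEquivalence : (secAdditive R.ι).functor.IsLocalEquivalence J

/-- The fibered product `A ×_P B = τ_{≤ 0} (MC(f - g)[-1])` of complexes of abelian sheaves, where
`MC` is the mapping cone and `f - g : A ⊞ B ⟶ P`. -/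
noncomputable def fiberedProduct
    {A B P : CochainComplex (Sheaf J AddCommGrpCat.{max u v}) ℤ} (f : A ⟶ P) (g : B ⟶ P) :
    CochainComplex (Sheaf J AddCommGrpCat.{max u v}) ℤ :=
  ((CochainComplex.mappingCone (biprod.desc f (-g)))⟦(-1 : ℤ)⟧).truncLE 0

end MainObjects

end

/-! Everything rests on two consequences of injectivity: descent data split, and exactness of
complexes survives on sections.

An injective sheaf `F` is also injective as a presheaf, so its embedding in the presheaf of families
of sections indexed by the arrows into `U` has a natural retraction, an averaging operator
(`avgSheaf`). Averaging a cocycle over its first arrow shows that 1-cocycles and 2-cocycles on any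
sieve are coboundaries (`sieve_cocycle`, `sieve_cocycle₂`). In a descent datum for objects the
composition constraints form a 2-cocycle in degree -2; once it is split, the corrected 1-arrows form
a 1-cocycle in degree -1; once that is split, the corrected objects agree on restriction and glue.
Descent for 1-arrows needs one splitting, for 2-arrows only the sheaf condition. The argument uses
no more than a description of objects, 1-arrows and 2-arrows by sections of three sheaves with
averaging operators (`FibTwoCat.Coord`). Such coordinates exist for the sections of a complex of
injectives, and equally for the fibered product of `K` and `L` over `M`, where the sheaves are `K⁰ ⊕
L⁰ ⊕ M⁻¹`, `K⁻¹ ⊕ L⁻¹ ⊕ M⁻²` and `K⁻² ⊕ L⁻²`; so both are 2-stacks (`isTwoStack`). They are Picard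
because tensoring with an object is a translation.

That `2st(K)` is associated with `K` follows from the acyclicity of the cone of the resolution: an
exact sequence of sheaves can be solved locally on sections, and globally in the lowest degrees,
where left exactness of sections is enough (`isLocalEquivalence_secMap`).

For the equivalence, let `H` be the shifted cone of `f' - g'` between the resolutions. A section of
`H` in degree `j` is a triple `(x, y, t)` in degrees `j`, `j`, `j - 1`, so the fibered product is
the 2-category of sections of `H` in other words. Since `H` is a bounded below complex of injectives
it is K-injective, and it is quasi-isomorphic to `MC(f - g)[-1]`; hence the inclusion of the
truncation extends up to homotopy to `ψ : E ⟶ H`, where `E` resolves `A ×_P B`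
(`exists_hom_exactAt_mappingCone`). The map `ψ` is an isomorphism in cohomology in degrees `≤ 0` and
`E` has no cohomology in degree 1, so the cone of `ψ` is exact in degrees `≤ 0`. Its terms are
injective and it is bounded below, hence it is contractible in these degrees and stays exact on
sections over every `U` (`exists_of_dif_eq_mor`). Exactness in degree 0 is essential surjectivity,
in degree -1 fullness, in degrees -2 and -3 bijectivity on 2-arrows (`isEquivalence_prodMap`).
Additivity costs nothing: the 2-functor is given by group homomorphisms and all its constraints have
zero coordinates. -/

/-- A sheaf of abelian groups with a natural averaging operator: every family of sections indexed by
the arrows with target `U` has an average over `U`. This is an additive natural retraction of the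
embedding in the product of all sections over objects over `U`. -/
structure AvgSheaf {C : Type u} [Category.{v} C] (J : GrothendieckTopology C) where
  sec : C → Type w
  [grp : ∀ U, AddCommGroup (sec U)]
  res {U V : C} (k : V ⟶ U) : sec U →+ sec V
  res_id {U : C} (x : sec U) : res (𝟙 U) x = x
  res_comp {U V W : C} (k : V ⟶ U) (l : W ⟶ V) (x : sec U) : res (l ≫ k) x = res l (res k x)
  sep {U : C} {R : Sieve U} (hR : R ∈ J U) {x y : sec U}
    (h : ∀ {V : C} (k : V ⟶ U), R k → res k x = res k y) : x = y
  glue {U : C} {R : Sieve U} (hR : R ∈ J U) (x : ∀ {V : C} (k : V ⟶ U), R k → sec V)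
    (h : ∀ {V W : C} (k : V ⟶ U) (hk : R k) (l : W ⟶ V) (hl : R (l ≫ k)),
      res l (x k hk) = x (l ≫ k) hl) :
    ∃ y : sec U, ∀ {V : C} (k : V ⟶ U) (hk : R k), res k y = x k hk
  avg {U : C} : (∀ V : C, (V ⟶ U) → sec V) →+ sec U
  avg_res {U : C} (x : sec U) : avg (fun _ k => res k x) = x
  res_avg {U V : C} (k : V ⟶ U) (s : ∀ W : C, (W ⟶ U) → sec W) :
    res k (avg s) = avg (fun W l => s W (l ≫ k))

attribute [instance] AvgSheaf.grp

namespace AvgSheaf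

variable {C : Type u} [Category.{v} C] {J : GrothendieckTopology C}

/-- The product of two sheaves with averaging operators. -/
def prod (E : AvgSheaf.{v, u, w} J) (F : AvgSheaf.{v, u, w'} J) : AvgSheaf J where
  sec U := E.sec U × F.sec U
  res k := (E.res k).prodMap (F.res k)
  res_id x := Prod.ext (E.res_id _) (F.res_id _)
  res_comp k l x := Prod.ext (E.res_comp _ _ _) (F.res_comp _ _ _)
  sep hR _ _ h := Prod.ext (E.sep hR fun k hk => congrArg Prod.fst (h k hk))
    (F.sep hR fun k hk => congrArg Prod.snd (h k hk))
  glue hR x h := by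
    obtain ⟨y, hy⟩ := E.glue hR (fun k hk => (x k hk).1)
      (fun k hk l hl => congrArg Prod.fst (h k hk l hl))
    obtain ⟨z, hz⟩ := F.glue hR (fun k hk => (x k hk).2)
      (fun k hk l hl => congrArg Prod.snd (h k hk l hl))
    exact ⟨(y, z), fun k hk => Prod.ext (hy k hk) (hz k hk)⟩
  avg := AddMonoidHom.mk' (fun s => (E.avg fun V k => (s V k).1, F.avg fun V k => (s V k).2))
    (fun s t => Prod.ext (map_add E.avg (fun V k => (s V k).1) fun V k => (t V k).1)
      (map_add F.avg (fun V k => (s V k).2) fun V k => (t V k).2))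
  avg_res x := Prod.ext (E.avg_res x.1) (F.avg_res x.2)
  res_avg k s := Prod.ext (E.res_avg k _) (F.res_avg k _)

end AvgSheaf

/-! ### Averaging operators on injective sheaves. -/

section InjectiveSheaf

variable {C : Type u} [Category.{v} C]

/-- The presheaf of families of sections of `F` indexed by the arrows with given target. -/
def coindPresheaf (F : Cᵒᵖ ⥤ AddCommGrpCat.{max u v}) : Cᵒᵖ ⥤ AddCommGrpCat.{max u v} where
  obj U := AddCommGrpCat.of (∀ V : C, (V ⟶ U.unop) → F.obj (op V))
  map {U U'} k := AddCommGrpCat.ofHom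
    (AddMonoidHom.mk' (fun s V l => s V (l ≫ k.unop)) (fun _ _ => rfl))
  map_id U := by
    ext s V l; exact congrArg (s V) (Category.comp_id l)
  map_comp k k' := by
    ext s V l; exact congrArg (s V) (Category.assoc l k'.unop k.unop).symm

def coindUnit (F : Cᵒᵖ ⥤ AddCommGrpCat.{max u v}) : F ⟶ coindPresheaf F where
  app U := AddCommGrpCat.ofHom
    (AddMonoidHom.mk' (fun x V l => (F.map l.op).hom x) (fun x y => by
      funext V l; exact map_add _ _ _))
  naturality U U' k := by
    ext x; funext V l
    exact (ConcreteCategory.congr_hom (F.map_comp k l.op) x).symm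

instance (F : Cᵒᵖ ⥤ AddCommGrpCat.{max u v}) : Mono (coindUnit F) := by
  have (U : Cᵒᵖ) : Mono ((coindUnit F).app U) := by
    refine ConcreteCategory.mono_of_injective _ fun x y h => ?_
    -- A section is recovered from its family as the value at the identity arrow.
    have h' := congrFun (congrFun h U.unop) (𝟙 _)
    change (F.map (𝟙 U)).hom x = (F.map (𝟙 U)).hom y at h'
    simpa using h'
  exact NatTrans.mono_of_mono_app _

variable {J : GrothendieckTopology C}

/-- Sheafification preserves monomorphisms, so its right adjoint, the inclusion in presheaves,
preserves injectives. The retraction can therefore be sought among presheaves, and `coindPresheaf`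
needs no sheaf condition. -/
lemma injective_obj_of_injective (F : Sheaf J AddCommGrpCat.{max u v}) [Injective F] :
    Injective F.obj :=
  Injective.injective_of_adjoint (sheafificationAdjunction J AddCommGrpCat.{max u v}) F

lemma isSheaf_forget (F : Sheaf J AddCommGrpCat.{max u v}) :
    Presieve.IsSheaf J (F.obj ⋙ forget AddCommGrpCat.{max u v}) :=
  (isSheaf_iff_isSheaf_of_type _ _).1
    ((Presheaf.isSheaf_iff_isSheaf_forget J F.obj (forget AddCommGrpCat.{max u v})).1 F.property)

lemma sheaf_sep (F : Sheaf J AddCommGrpCat.{max u v}) {U : C} {R : Sieve U} (hR : R ∈ J U)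
    {x y : F.obj.obj (op U)}
    (h : ∀ {V : C} (k : V ⟶ U), R k → (F.obj.map k.op).hom x = (F.obj.map k.op).hom y) : x = y :=
  (isSheaf_forget F R hR).isSeparatedFor.ext fun _ k hk => h k hk

lemma sheaf_glue (F : Sheaf J AddCommGrpCat.{max u v}) {U : C} {R : Sieve U} (hR : R ∈ J U)
    (x : ∀ {V : C} (k : V ⟶ U), R k → F.obj.obj (op V))
    (h : ∀ {V W : C} (k : V ⟶ U) (hk : R k) (l : W ⟶ V) (hl : R (l ≫ k)),
      (F.obj.map l.op).hom (x k hk) = x (l ≫ k) hl) :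
    ∃ y : F.obj.obj (op U), ∀ {V : C} (k : V ⟶ U) (hk : R k), (F.obj.map k.op).hom y = x k hk := by
  let s : Presieve.FamilyOfElements (F.obj ⋙ forget AddCommGrpCat.{max u v}) R.arrows :=
    fun V k hk => x k hk
  have hs : s.Compatible := (Presieve.compatible_iff_sieveCompatible s).2
    fun V W k l hk => (h k hk l (R.downward_closed hk l)).symm
  exact ⟨(isSheaf_forget F R hR).amalgamate s hs,
    fun k hk => (isSheaf_forget F R hR).valid_glue hs k hk⟩

/-- An injective abelian sheaf has an averaging operator. -/
noncomputable def avgSheaf (F : Sheaf J AddCommGrpCat.{max u v}) [Injective F] :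
    AvgSheaf.{v, u, max u v} J :=
  have := injective_obj_of_injective F
  -- The identity extends along the monomorphism `coindUnit`. That `r` is a retraction is `avg_res`,
  -- that it is natural is `res_avg`.
  let r : coindPresheaf F.obj ⟶ F.obj := Injective.factorThru (𝟙 F.obj) (coindUnit F.obj)
  { sec := fun U => F.obj.obj (op U)
    res := fun k => (F.obj.map k.op).hom
    res_id := fun x => by simp
    res_comp := fun k l x => by simp
    sep := sheaf_sep F
    glue := sheaf_glue F
    avg := fun {U} => (r.app (op U)).hom
    avg_res := fun {U} x => ConcreteCategory.congr_hom (congrArg (fun t => t.app (op U))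
      (Injective.comp_factorThru (𝟙 F.obj) (coindUnit F.obj))) x
    res_avg := fun k s => (ConcreteCategory.congr_hom (r.naturality k.op) s).symm }

end InjectiveSheaf

/-! ### Fibred 2-categories in additive coordinates. -/

/-- Coordinates on a fibred 2-category: objects, 1-arrows and 2-arrows are described, as in
`secCat`, by sections of sheaves with averaging operators. -/
structure FibTwoCat.Coord {C : Type u} [Category.{v} C] (J : GrothendieckTopology C)
    (P : FibTwoCat.{v, u, w, a, b} C) where
  E₀ : AvgSheaf.{v, u, w'} J
  E₁ : AvgSheaf.{v, u, w'} J
  E₂ : AvgSheaf.{v, u, w'} J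
  d₁ {U : C} : E₁.sec U →+ E₀.sec U
  d₂ {U : C} : E₂.sec U →+ E₁.sec U
  d₁_res {U V : C} (k : V ⟶ U) (x : E₁.sec U) : d₁ (E₁.res k x) = E₀.res k (d₁ x)
  d₂_res {U V : C} (k : V ⟶ U) (x : E₂.sec U) : d₂ (E₂.res k x) = E₁.res k (d₂ x)
  d₁_d₂ {U : C} (x : E₂.sec U) : d₁ (d₂ x) = 0
  IsCocycle {U : C} : E₀.sec U → Prop
  isCocycle_res {U V : C} (k : V ⟶ U) {x : E₀.sec U} : IsCocycle x → IsCocycle (E₀.res k x)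
  isCocycle_of_cover {U : C} {R : Sieve U} (hR : R ∈ J U) {x : E₀.sec U}
    (h : ∀ {V : C} (k : V ⟶ U), R k → IsCocycle (E₀.res k x)) : IsCocycle x
  isCocycle_sub {U : C} {x : E₀.sec U} (y : E₁.sec U) : IsCocycle x → IsCocycle (x - d₁ y)
  ob {U : C} (x : P.Obj U) : E₀.sec U
  isCocycle_ob {U : C} (x : P.Obj U) : IsCocycle (ob x)
  mkOb {U : C} (x : E₀.sec U) (h : IsCocycle x) : P.Obj U
  ob_mkOb {U : C} (x : E₀.sec U) (h : IsCocycle x) : ob (mkOb x h) = x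
  ar {X Y : Tot P.Obj} (f : X ⟶ Y) : E₁.sec X.base
  d₁_ar {X Y : Tot P.Obj} (f : X ⟶ Y) : d₁ (ar f) = E₀.res (P.proj f) (ob Y.pt) - ob X.pt
  mkAr {X Y : Tot P.Obj} (k : X.base ⟶ Y.base) (m : E₁.sec X.base)
    (h : d₁ m = E₀.res k (ob Y.pt) - ob X.pt) : X ⟶ Y
  proj_mkAr {X Y : Tot P.Obj} (k : X.base ⟶ Y.base) (m : E₁.sec X.base)
    (h : d₁ m = E₀.res k (ob Y.pt) - ob X.pt) : P.proj (mkAr k m h) = k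
  ar_mkAr {X Y : Tot P.Obj} (k : X.base ⟶ Y.base) (m : E₁.sec X.base)
    (h : d₁ m = E₀.res k (ob Y.pt) - ob X.pt) : ar (mkAr k m h) = m
  ar_id (X : Tot P.Obj) : ar (𝟙 X) = 0
  ar_comp {X Y Z : Tot P.Obj} (f : X ⟶ Y) (g : Y ⟶ Z) :
    ar (f ≫ g) = ar f + E₁.res (P.proj f) (ar g)
  ce {X Y : Tot P.Obj} {f g : X ⟶ Y} (η : f ⟶ g) : E₂.sec X.base
  d₂_ce {X Y : Tot P.Obj} {f g : X ⟶ Y} (η : f ⟶ g) : d₂ (ce η) = ar g - ar f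
  ce_ext {X Y : Tot P.Obj} {f g : X ⟶ Y} {η θ : f ⟶ g} : ce η = ce θ → η = θ
  mkCe {X Y : Tot P.Obj} {f g : X ⟶ Y} (h : P.proj f = P.proj g) (x : E₂.sec X.base)
    (hx : d₂ x = ar g - ar f) : f ⟶ g
  ce_mkCe {X Y : Tot P.Obj} {f g : X ⟶ Y} (h : P.proj f = P.proj g) (x : E₂.sec X.base)
    (hx : d₂ x = ar g - ar f) : ce (mkCe h x hx) = x
  ce_id {X Y : Tot P.Obj} (f : X ⟶ Y) : ce (𝟙 f) = 0
  ce_comp {X Y : Tot P.Obj} {f g h : X ⟶ Y} (η : f ⟶ g) (θ : g ⟶ h) :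
    ce (η ≫ θ) = ce η + ce θ
  ce_whiskerLeft {X Y Z : Tot P.Obj} (f : X ⟶ Y) {g h : Y ⟶ Z} (η : g ⟶ h) :
    ce (f ◁ η) = E₂.res (P.proj f) (ce η)
  ce_whiskerRight {X Y Z : Tot P.Obj} {f g : X ⟶ Y} (η : f ⟶ g) (h : Y ⟶ Z) :
    ce (η ▷ h) = ce η
  ce_associator {X Y Z W : Tot P.Obj} (f : X ⟶ Y) (g : Y ⟶ Z) (h : Z ⟶ W) :
    ce (α_ f g h).hom = 0
  ce_leftUnitor {X Y : Tot P.Obj} (f : X ⟶ Y) : ce (λ_ f).hom = 0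
  ce_rightUnitor {X Y : Tot P.Obj} (f : X ⟶ Y) : ce (ρ_ f).hom = 0

namespace FibTwoCat.Coord

variable {C : Type u} [Category.{v} C] {J : GrothendieckTopology C}
  {P : FibTwoCat.{v, u, w, a, b} C} (E : P.Coord J)

attribute [simp] AvgSheaf.res_id ob_mkOb proj_mkAr ar_mkAr ar_id ar_comp ce_mkCe ce_id ce_comp ce_whiskerLeft
  ce_whiskerRight ce_associator ce_leftUnitor ce_rightUnitor

section
variable {X Y Z W : Tot P.Obj}

@[simp] lemma ce_inv {f g : X ⟶ Y} (η : f ≅ g) : E.ce η.inv = - E.ce η.hom := by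
  have h := congrArg E.ce η.hom_inv_id
  rw [E.ce_comp, E.ce_id] at h
  exact eq_neg_of_add_eq_zero_right h

/-- The invertible 2-arrow with given coordinate. -/
@[simps hom] def mkIso {f g : X ⟶ Y} (h : P.proj f = P.proj g) (x : E.E₂.sec X.base)
    (hx : E.d₂ x = E.ar g - E.ar f) : f ≅ g where
  hom := E.mkCe h x hx
  inv := E.mkCe h.symm (-x) (by rw [map_neg, hx, neg_sub])
  hom_inv_id := E.ce_ext (by simp)
  inv_hom_id := E.ce_ext (by simp)

/-- All witnesses are forced by the coordinates: an object is pulled back by restricting its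
cocycle, with `0` as the arrow; the lift of `g` through `f` has coordinate `g - k^* f`; and
whiskering on the right leaves the coordinate of a 2-arrow unchanged, so `γ` has the coordinate of
`β`. -/
lemma isFibredInGroupoids (E : P.Coord J) : P.IsFibredInGroupoids where
  isIso {X Y f g} η := ⟨E.mkCe (P.proj_eq η).symm (-E.ce η) (by rw [map_neg, E.d₂_ce, neg_sub]),
    E.ce_ext (by simp), E.ce_ext (by simp)⟩
  lift {U V} k y := ⟨E.mkOb (E.E₀.res k (E.ob y)) (E.isCocycle_res k (E.isCocycle_ob y)),
    E.mkAr k 0 (by simp), E.proj_mkAr _ _ _⟩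
  cartesian {X Y Z} f g k hk := by
    have h : E.d₁ (E.ar g - E.E₁.res k (E.ar f)) = E.E₀.res k (E.ob Y.pt) - E.ob X.pt := by
      rw [map_sub, E.d₁_res, E.d₁_ar, E.d₁_ar, map_sub, ← E.E₀.res_comp, hk]; abel
    exact ⟨E.mkAr k _ h, E.proj_mkAr _ _ _, ⟨E.mkIso (by simp [hk]) 0 (by simp)⟩⟩
  cartesian₂ {X Y Z} f h h' hh β := by
    have hβ : E.d₂ (E.ce β) = E.ar h' - E.ar h := by
      rw [E.d₂_ce, E.ar_comp, E.ar_comp, hh]; abel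
    refine ⟨E.mkCe hh (E.ce β) hβ, E.ce_ext (by simp), fun γ hγ => E.ce_ext ?_⟩
    rw [E.ce_mkCe, ← E.ce_whiskerRight γ f]; exact congrArg E.ce hγ

end

/-! ### Splitting of cocycles on a sieve. -/

section Cochains

variable {U : C} {R : Sieve U}

lemma sieveCat_obj_ext {V : C} {p q : (sieveCat R).Obj V} (h : p.1 = q.1) : p = q := Subtype.ext h

lemma sieveCat_hom_ext {X Y : Tot (sieveCat R).Obj} {f g : X ⟶ Y}
    (h : (sieveCat R).proj f = (sieveCat R).proj g) : f = g :=
  congrArg Discrete.mk (Subtype.ext h)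

lemma sieveCat_comm {X Y : Tot (sieveCat R).Obj} (f : X ⟶ Y) :
    (sieveCat R).proj f ≫ Y.pt.1 = X.pt.1 := f.as.2

/-- The restriction of `Y` along `k`, in a sieve. -/
abbrev sievePull (Y : Tot (sieveCat R).Obj) {V : C} (k : V ⟶ Y.base) : Tot (sieveCat R).Obj :=
  Tot.mk V ⟨k ≫ Y.pt.1, R.downward_closed Y.pt.2 k⟩

/-- The arrow over `k` with target `Y`, in a sieve. -/
def sieveLift (Y : Tot (sieveCat R).Obj) {V : C} (k : V ⟶ Y.base) : sievePull Y k ⟶ Y :=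
  ⟨⟨k, rfl⟩⟩

/-- A family of sections indexed by the 1-arrows of a sieve with target `Y` depends only on
the underlying arrows of `C`. -/
lemma sieve_congr {T : C → Type*} {Y : Tot (sieveCat R).Obj}
    (θ : ∀ {X : Tot (sieveCat R).Obj}, (X ⟶ Y) → T X.base) {V : C}
    {p q : (sieveCat R).Obj V} (f : Tot.mk V p ⟶ Y) (g : Tot.mk V q ⟶ Y)
    (h : (sieveCat R).proj f = (sieveCat R).proj g) : θ f = θ g := by
  -- An object of the sieve over `V` is an arrow to `U`, and it equals the projection of `f`
  -- followed by the arrow of `Y`.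
  obtain rfl : p = q := sieveCat_obj_ext (by rw [← sieveCat_comm f, ← sieveCat_comm g, h])
  rw [sieveCat_hom_ext h]

/-- The average over all arrows with target `Y`. -/
def sieveAvg (E : AvgSheaf.{v, u, w'} J) (Y : Tot (sieveCat R).Obj)
    (θ : ∀ {X : Tot (sieveCat R).Obj}, (X ⟶ Y) → E.sec X.base) : E.sec Y.base :=
  E.avg fun _ l => θ (sieveLift Y l)

/-- Naturality of the average. The two families are indexed by the same arrows of `C`, but their
sources are presented as `(l ≫ f) ≫ Y` and `l ≫ X`, which are equal without being the same term;
`sieve_congr` absorbs the difference. -/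
lemma res_sieveAvg (E : AvgSheaf.{v, u, w'} J) {X Y : Tot (sieveCat R).Obj}
    (θ : ∀ {X : Tot (sieveCat R).Obj}, (X ⟶ Y) → E.sec X.base) (f : X ⟶ Y) :
    E.res ((sieveCat R).proj f) (sieveAvg E Y θ) = sieveAvg E X (fun g => θ (g ≫ f)) := by
  refine (E.res_avg _ _).trans (congrArg E.avg ?_)
  funext V l
  exact sieve_congr θ _ _ rfl

lemma sieveAvg_res (E : AvgSheaf.{v, u, w'} J) (X : Tot (sieveCat R).Obj) (x : E.sec X.base) :
    sieveAvg E X (fun f => E.res ((sieveCat R).proj f) x) = x := E.avg_res x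

lemma sieveAvg_add (E : AvgSheaf.{v, u, w'} J) {Y : Tot (sieveCat R).Obj}
    (θ θ' : ∀ {X : Tot (sieveCat R).Obj}, (X ⟶ Y) → E.sec X.base) :
    sieveAvg E Y (fun f => θ f + θ' f) = sieveAvg E Y θ + sieveAvg E Y θ' :=
  map_add E.avg (fun _ l => θ (sieveLift Y l)) (fun _ l => θ' (sieveLift Y l))

/-- A 1-cocycle on a sieve with values in a sheaf with averaging operator is a coboundary. -/
lemma sieve_cocycle (E : AvgSheaf.{v, u, w'} J)
    (σ : ∀ {X Y : Tot (sieveCat R).Obj}, (X ⟶ Y) → E.sec X.base)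
    (h : ∀ {X Y Z : Tot (sieveCat R).Obj} (f : X ⟶ Y) (g : Y ⟶ Z),
      σ (f ≫ g) = σ f + E.res ((sieveCat R).proj f) (σ g)) {X Y : Tot (sieveCat R).Obj}
    (f : X ⟶ Y) : E.res ((sieveCat R).proj f) (sieveAvg E Y σ) = sieveAvg E X σ + σ f := by
  -- With `σ f` written as the average of its own restrictions, the claim is the cocycle identity
  -- for `g ≫ f`, averaged over `g`.
  rw [res_sieveAvg, ← sieveAvg_res E X (σ f), ← sieveAvg_add]
  congr 1
  funext Z g
  exact h g f

/-- A 2-cocycle on a sieve with values in a sheaf with averaging operator is a coboundary. -/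
lemma sieve_cocycle₂ (E : AvgSheaf.{v, u, w'} J)
    (θ : ∀ {X Y Z : Tot (sieveCat R).Obj}, (X ⟶ Y) → (Y ⟶ Z) → E.sec X.base)
    (h : ∀ {X Y Z W : Tot (sieveCat R).Obj} (f : X ⟶ Y) (g : Y ⟶ Z) (k : Z ⟶ W),
      θ (f ≫ g) k + θ f g = E.res ((sieveCat R).proj f) (θ g k) + θ f (g ≫ k))
    {X Y Z : Tot (sieveCat R).Obj} (f : X ⟶ Y) (g : Y ⟶ Z) :
    E.res ((sieveCat R).proj f) (sieveAvg E Y fun k => θ k g) + sieveAvg E X (fun k => θ k f) =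
      θ f g + sieveAvg E X (fun k => θ k (f ≫ g)) := by
  -- Again `θ f g` becomes an average, and the claim is the cocycle identity for `k`, `f`, `g`,
  -- averaged over `k`.
  rw [res_sieveAvg, ← sieveAvg_add, ← sieveAvg_res E X (θ f g), ← sieveAvg_add]
  congr 1
  funext W k
  exact h k f g

/-- A compatible family on a covering sieve can be glued. -/
lemma sieve_glue (E : AvgSheaf.{v, u, w'} J) (hR : R ∈ J U)
    (x : ∀ X : Tot (sieveCat R).Obj, E.sec X.base)
    (h : ∀ {X Y : Tot (sieveCat R).Obj} (f : X ⟶ Y), E.res ((sieveCat R).proj f) (x Y) = x X) :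
    ∃ y : E.sec U, ∀ X : Tot (sieveCat R).Obj, E.res X.pt.1 y = x X := by
  obtain ⟨y, hy⟩ := E.glue hR (fun {V} k hk => x (Tot.mk V ⟨k, hk⟩))
    (fun {V W} k hk l hl => h (X := Tot.mk W ⟨l ≫ k, hl⟩) (Y := Tot.mk V ⟨k, hk⟩) ⟨⟨l, rfl⟩⟩)
  exact ⟨y, fun X => hy X.pt.1 X.pt.2⟩

end Cochains

/-! ### Descent data, their transformations and modifications as cochains. -/

section Descent

variable {U : C} {R : Sieve U}

section
variable (s : FibFunctor (sieveCat R) P)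

/-- The coordinate of the value of a descent datum at an object. -/
abbrev cob (X : Tot (sieveCat R).Obj) : E.E₀.sec X.base := E.ob (s.obj X.pt)

/-- The coordinate of the value of a descent datum at a 1-arrow. -/
abbrev car {X Y : Tot (sieveCat R).Obj} (f : X ⟶ Y) : E.E₁.sec X.base := E.ar (s.map f)

/-- The coordinate of the composition constraint of a descent datum. -/
abbrev cce {X Y Z : Tot (sieveCat R).Obj} (f : X ⟶ Y) (g : Y ⟶ Z) : E.E₂.sec X.base :=
  E.ce (s.mapComp f g).hom

/-- The categories of 1-arrows of a sieve are discrete, so every 2-arrow is an identity. A descent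
datum is thus carried by its objects, its 1-arrows and its constraints. -/
lemma ce_map₂ {X Y : Tot (sieveCat R).Obj} {f g : X ⟶ Y} (η : f ⟶ g) : E.ce (s.map₂ η) = 0 := by
  obtain rfl : f = g := sieveCat_hom_ext ((sieveCat R).proj_eq η)
  obtain rfl : η = 𝟙 f := ULift.ext _ _ (Subsingleton.elim _ _)
  rw [s.map₂_id, E.ce_id]

lemma d₁_car {X Y : Tot (sieveCat R).Obj} (f : X ⟶ Y) :
    E.d₁ (E.car s f) = E.E₀.res ((sieveCat R).proj f) (E.cob s Y) - E.cob s X :=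
  (E.d₁_ar (s.map f)).trans (by rw [s.proj_map])

lemma d₂_cce {X Y Z : Tot (sieveCat R).Obj} (f : X ⟶ Y) (g : Y ⟶ Z) :
    E.d₂ (E.cce s f g) =
      E.car s f + E.E₁.res ((sieveCat R).proj f) (E.car s g) - E.car s (f ≫ g) :=
  (E.d₂_ce (s.mapComp f g).hom).trans (by rw [E.ar_comp, s.proj_map])

/-- This is the associativity law of `s` in coordinates: associators and images of 2-arrows
contribute `0`, and what remains is the 2-cocycle condition. -/
lemma cce_cocycle {X Y Z W : Tot (sieveCat R).Obj} (f : X ⟶ Y) (g : Y ⟶ Z) (k : Z ⟶ W) :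
    E.cce s (f ≫ g) k + E.cce s f g =
      E.E₂.res ((sieveCat R).proj f) (E.cce s g k) + E.cce s f (g ≫ k) := by
  have h := congrArg E.ce (s.map₂_associator f g k)
  simp only [ce_map₂, ce_comp, ce_whiskerRight, ce_whiskerLeft, ce_associator, ce_inv,
    s.proj_map, map_neg] at h
  rw [← sub_eq_zero, h]; abel

/-- This is the left unit law of `s` in coordinates. It expresses the unit constraint by the
composition constraint, so the unit constraint is no further datum. -/
lemma cce_id {X Y : Tot (sieveCat R).Obj} (f : X ⟶ Y) :
    E.cce s (𝟙 X) f + E.ce (s.mapId X).hom = 0 := by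
  have h := congrArg E.ce (s.map₂_left_unitor f)
  simpa only [ce_map₂, ce_comp, ce_whiskerRight, ce_leftUnitor, add_zero, eq_comm] using h

end

section
variable {s t : FibFunctor (sieveCat R) P} (φ : PreTrans s t)

lemma d₁_app (X : Tot (sieveCat R).Obj) : E.d₁ (E.ar (φ.app X.pt)) = E.cob t X - E.cob s X := by
  rw [E.d₁_ar, φ.proj_app, E.E₀.res_id]

lemma d₂_nat {X Y : Tot (sieveCat R).Obj} (f : X ⟶ Y) : E.d₂ (E.ce (φ.nat f).hom) =
    E.ar (φ.app X.pt) + E.car t f -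
      (E.car s f + E.E₁.res ((sieveCat R).proj f) (E.ar (φ.app Y.pt))) := by
  rw [E.d₂_ce, E.ar_comp, E.ar_comp, φ.proj_app, s.proj_map, E.E₁.res_id]

/-- The law `nat_comp` in coordinates: the naturality 2-arrows form a 1-cochain whose coboundary is
the difference of the two families of composition constraints. -/
lemma ce_nat_comp (φ : FibTrans s t) {X Y Z : Tot (sieveCat R).Obj} (f : X ⟶ Y) (g : Y ⟶ Z) :
    E.ce (φ.nat (f ≫ g)).hom + E.cce t f g = E.cce s f g +
      (E.E₂.res ((sieveCat R).proj f) (E.ce (φ.nat g).hom) + E.ce (φ.nat f).hom) := by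
  have h := congrArg E.ce (φ.nat_comp f g)
  simpa only [ce_comp, ce_whiskerRight, ce_whiskerLeft, ce_associator, ce_inv, s.proj_map,
    φ.proj_app, AvgSheaf.res_id, neg_zero, add_zero, zero_add] using h

/-- A transformation of descent data from its coordinates. -/
def mkTrans (n : ∀ X : Tot (sieveCat R).Obj, E.E₁.sec X.base)
    (ν : ∀ {X Y : Tot (sieveCat R).Obj}, (X ⟶ Y) → E.E₂.sec X.base)
    (hn : ∀ X, E.d₁ (n X) = E.cob t X - E.cob s X)
    (hν : ∀ {X Y : Tot (sieveCat R).Obj} (f : X ⟶ Y), E.d₂ (ν f) =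
      n X + E.car t f - (E.car s f + E.E₁.res ((sieveCat R).proj f) (n Y)))
    (h_id : ∀ X, ν (𝟙 X) + E.ce (t.mapId X).hom = E.ce (s.mapId X).hom)
    (h_comp : ∀ {X Y Z : Tot (sieveCat R).Obj} (f : X ⟶ Y) (g : Y ⟶ Z),
      ν (f ≫ g) + E.cce t f g = E.cce s f g + (E.E₂.res ((sieveCat R).proj f) (ν g) + ν f)) :
    FibTrans s t where
  app {V} x := E.mkAr (𝟙 V) (n (Tot.mk V x))
    ((hn (Tot.mk V x)).trans (congrArg (· - _) (E.E₀.res_id _).symm))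
  proj_app x := E.proj_mkAr _ _ _
  nat {X Y} f := E.mkIso (by simp [s.proj_map, t.proj_map]) (ν f) (by
    rw [hν, E.ar_comp, E.ar_comp, E.proj_mkAr, s.proj_map, E.E₁.res_id, E.ar_mkAr, E.ar_mkAr])
  naturality {X Y f g} η := E.ce_ext (by
    obtain rfl : f = g := sieveCat_hom_ext ((sieveCat R).proj_eq η)
    simp [ce_map₂])
  nat_id X := E.ce_ext (by simpa using h_id X)
  nat_comp f g := E.ce_ext (by simpa [s.proj_map] using h_comp f g)

@[simp] lemma ar_mkTrans (n : ∀ X : Tot (sieveCat R).Obj, E.E₁.sec X.base)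
    (ν : ∀ {X Y : Tot (sieveCat R).Obj}, (X ⟶ Y) → E.E₂.sec X.base) (hn) (hν) (h_id) (h_comp)
    (X : Tot (sieveCat R).Obj) :
    E.ar ((E.mkTrans (s := s) (t := t) n ν hn hν h_id h_comp).app X.pt) = n X :=
  E.ar_mkAr (X := Tot.mk X.base (s.obj X.pt)) (Y := Tot.mk X.base (t.obj X.pt)) (𝟙 X.base) (n X) _

@[simp] lemma ce_mkTrans (n : ∀ X : Tot (sieveCat R).Obj, E.E₁.sec X.base)
    (ν : ∀ {X Y : Tot (sieveCat R).Obj}, (X ⟶ Y) → E.E₂.sec X.base) (hn) (hν) (h_id) (h_comp)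
    {X Y : Tot (sieveCat R).Obj} (f : X ⟶ Y) :
    E.ce ((E.mkTrans (s := s) (t := t) n ν hn hν h_id h_comp).nat f).hom = ν f :=
  E.ce_mkCe (X := Tot.mk X.base (s.obj X.pt)) (Y := Tot.mk Y.base (t.obj Y.pt)) _ (ν f) _

/-- A modification from its coordinates. -/
def mkMod {φ ψ : PreTrans s t} (γ : ∀ X : Tot (sieveCat R).Obj, E.E₂.sec X.base)
    (hγ : ∀ X, E.d₂ (γ X) = E.ar (ψ.app X.pt) - E.ar (φ.app X.pt))
    (h : ∀ {X Y : Tot (sieveCat R).Obj} (f : X ⟶ Y),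
      E.E₂.res ((sieveCat R).proj f) (γ Y) + E.ce (ψ.nat f).hom = E.ce (φ.nat f).hom + γ X) :
    FibMod φ ψ where
  app {V} x := E.mkIso (by rw [φ.proj_app, ψ.proj_app]) (γ (Tot.mk V x)) (hγ (Tot.mk V x))
  naturality {X Y} f := E.ce_ext (by simpa [s.proj_map] using h f)

@[simp] lemma ce_mkMod {φ ψ : PreTrans s t} (γ : ∀ X : Tot (sieveCat R).Obj, E.E₂.sec X.base)
    (hγ) (h) (X : Tot (sieveCat R).Obj) :
    E.ce ((E.mkMod (φ := φ) (ψ := ψ) γ hγ h).app X.pt).hom = γ X :=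
  E.ce_mkCe (X := Tot.mk X.base (s.obj X.pt)) (Y := Tot.mk X.base (t.obj X.pt)) _ (γ X) _

lemma ce_mod {φ ψ : PreTrans s t} (Γ : FibMod φ ψ) {X Y : Tot (sieveCat R).Obj} (f : X ⟶ Y) :
    E.E₂.res ((sieveCat R).proj f) (E.ce (Γ.app Y.pt).hom) + E.ce (ψ.nat f).hom =
      E.ce (φ.nat f).hom + E.ce (Γ.app X.pt).hom := by
  simpa [s.proj_map] using congrArg E.ce (Γ.naturality f)

lemma mod_ext {φ ψ : PreTrans s t} {Γ Γ' : FibMod φ ψ}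
    (h : ∀ X : Tot (sieveCat R).Obj, E.ce (Γ.app X.pt).hom = E.ce (Γ'.app X.pt).hom) : Γ = Γ' := by
  refine FibMod.ext ?_
  funext V x
  exact Iso.ext (E.ce_ext (h (Tot.mk V x)))

end

end Descent

end FibTwoCat.Coord

/-! ### Descent for objects, and transformations on the maximal sieve. -/

namespace FibTwoCat.Coord

variable {C : Type u} [Category.{v} C] {J : GrothendieckTopology C}
  {P : FibTwoCat.{v, u, w, a, b} C} (E : P.Coord J) {U : C} {R : Sieve U}

/-- The image in the maximal sieve of an object of a sieve. -/
abbrev inclObj (X : Tot (sieveCat R).Obj) : Tot (sieveCat (⊤ : Sieve U)).Obj :=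
  Tot.mk X.base ((sieveIncl R).obj X.pt)

section
variable (s : FibFunctor (sieveCat (⊤ : Sieve U)) P)

/-- The constraint of a composite has one more factor, the image under `s` of a 2-arrow of the
maximal sieve, and this has coordinate `0`. -/
lemma cce_incl {X Y Z : Tot (sieveCat R).Obj} (f : X ⟶ Y) (g : Y ⟶ Z) :
    E.cce ((sieveIncl R).comp s) f g =
      E.cce s ((sieveIncl R).map f) ((sieveIncl R).map g) := by
  have h : E.ce (s.map₂ ((sieveIncl R).mapComp f g).hom) = 0 := E.ce_map₂ _ _
  exact (E.ce_comp _ _).trans ((congrArg (fun a : E.E₂.sec X.base =>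
    a + E.cce s ((sieveIncl R).map f) ((sieveIncl R).map g)) h).trans (zero_add _))

lemma mapId_incl (X : Tot (sieveCat R).Obj) :
    E.ce (((sieveIncl R).comp s).mapId X).hom = E.ce (s.mapId (inclObj X)).hom := by
  have h : E.ce (s.map₂ ((sieveIncl R).mapId X).hom) = 0 := E.ce_map₂ _ _
  exact (E.ce_comp _ _).trans ((congrArg (fun a : E.E₂.sec X.base =>
    a + E.ce (s.mapId (inclObj X)).hom) h).trans (zero_add _))

end

/-- The descent datum of the restrictions of an object. -/
def constDatum (x : E.E₀.sec U) (hx : E.IsCocycle x) :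
    FibFunctor (sieveCat (⊤ : Sieve U)) P where
  obj f := E.mkOb (E.E₀.res f.1 x) (E.isCocycle_res f.1 hx)
  map {X Y} f := E.mkAr ((sieveCat ⊤).proj f) 0
    ((map_zero _).trans (sub_eq_zero.2 (by
      rw [E.ob_mkOb, E.ob_mkOb, ← E.E₀.res_comp]
      exact congrArg (fun k => E.E₀.res k x) (sieveCat_comm f))).symm)
  proj_map f := E.proj_mkAr _ _ _
  map₂ η := E.mkCe (by rw [E.proj_mkAr, E.proj_mkAr, (sieveCat ⊤).proj_eq η]) 0 (by simp)
  mapId X := E.mkIso (by rw [E.proj_mkAr, proj_id, proj_id]) 0 (by simp)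
  mapComp f g := E.mkIso (by simp) 0 (by simp)
  map₂_id f := E.ce_ext (by simp)
  map₂_comp η θ := E.ce_ext (by simp)
  map₂_whisker_left f _ _ η := E.ce_ext (by simp)
  map₂_whisker_right η h := E.ce_ext (by simp)
  map₂_associator f g h := E.ce_ext (by simp)
  map₂_left_unitor f := E.ce_ext (by simp)
  map₂_right_unitor f := E.ce_ext (by simp)

section
variable (x : E.E₀.sec U) (hx : E.IsCocycle x)

lemma cob_constDatum (X : Tot (sieveCat R).Obj) :
    E.cob ((sieveIncl R).comp (E.constDatum x hx)) X = E.E₀.res X.pt.1 x := E.ob_mkOb _ _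

lemma car_constDatum {X Y : Tot (sieveCat R).Obj} (f : X ⟶ Y) :
    E.car ((sieveIncl R).comp (E.constDatum x hx)) f = 0 := E.ar_mkAr _ _ _

lemma cce_constDatum {X Y Z : Tot (sieveCat R).Obj} (f : X ⟶ Y) (g : Y ⟶ Z) :
    E.cce ((sieveIncl R).comp (E.constDatum x hx)) f g = 0 :=
  (E.cce_incl _ f g).trans (E.ce_mkCe _ _ _)

lemma mapId_constDatum (X : Tot (sieveCat R).Obj) :
    E.ce (((sieveIncl R).comp (E.constDatum x hx)).mapId X).hom = 0 :=
  (E.mapId_incl _ X).trans (E.ce_mkCe _ _ _)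

end

/-- Two splittings and a gluing: `t` splits the composition constraints, `y` splits the 1-arrows
corrected by `t`, and the objects corrected by `y` glue to `x`. The same `y` and `t` are the
coordinates of the transformation from the constant datum of `x` to `s`. -/
lemma descent_obj (E : P.Coord J) (hR : R ∈ J U) (s : FibFunctor (sieveCat R) P) :
    ∃ t : FibFunctor (sieveCat (⊤ : Sieve U)) P, Nonempty (FibTrans ((sieveIncl R).comp t) s) := by
  let t {X Y : Tot (sieveCat R).Obj} (f : X ⟶ Y) : E.E₂.sec X.base :=
    sieveAvg E.E₂ X fun k => E.cce s k f
  have ht {X Y Z : Tot (sieveCat R).Obj} (f : X ⟶ Y) (g : Y ⟶ Z) :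
      E.E₂.res ((sieveCat R).proj f) (t g) + t f = E.cce s f g + t (f ≫ g) :=
    sieve_cocycle₂ E.E₂ (fun f g => E.cce s f g) (fun f g k => E.cce_cocycle s f g k) f g
  -- The 1-arrows of `s` are multiplicative up to `d₂` of the composition constraints; subtracting
  -- `d₂ (t f)` makes them strictly multiplicative.
  let m {X Y : Tot (sieveCat R).Obj} (f : X ⟶ Y) : E.E₁.sec X.base := E.car s f - E.d₂ (t f)
  have hm {X Y Z : Tot (sieveCat R).Obj} (f : X ⟶ Y) (g : Y ⟶ Z) :
      m (f ≫ g) = m f + E.E₁.res ((sieveCat R).proj f) (m g) := by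
    have h := congrArg E.d₂ (ht f g)
    rw [map_add, map_add, E.d₂_res, E.d₂_cce] at h
    simp only [m, map_sub]
    rw [← sub_eq_zero] at h ⊢
    rw [← h]; abel
  let y (X : Tot (sieveCat R).Obj) : E.E₁.sec X.base := sieveAvg E.E₁ X m
  have hy {X Y : Tot (sieveCat R).Obj} (f : X ⟶ Y) :
      E.E₁.res ((sieveCat R).proj f) (y Y) = y X + m f := sieve_cocycle E.E₁ m hm f
  -- Since `d₁ d₂ = 0`, the correction by `t` does not change `d₁`, so `d₁ (m f)` is still the
  -- difference of the objects; the correction by `y` cancels it.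
  obtain ⟨x, hx⟩ := sieve_glue E.E₀ hR (fun X => E.cob s X - E.d₁ (y X)) (fun {X Y} f => by
    have h := congrArg E.d₁ (hy f)
    rw [E.d₁_res, map_add, map_sub, E.d₁_d₂, sub_zero, E.d₁_car] at h
    rw [map_sub, h]; abel)
  -- Being a cocycle is local, and each `x` restricted to the sieve differs from an actual object by
  -- a coboundary.
  have hxc : E.IsCocycle x := E.isCocycle_of_cover hR fun k hk => by
    rw [hx (Tot.mk _ ⟨k, hk⟩)]
    exact E.isCocycle_sub _ (E.isCocycle_ob _)
  refine ⟨E.constDatum x hxc, ⟨E.mkTrans y t (fun X => ?_) (fun {X Y} f => ?_) (fun X => ?_)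
    (fun f g => ?_)⟩⟩
  · rw [cob_constDatum, hx]; abel
  · rw [car_constDatum, hy]
    simp only [m]; abel
  · have h := ht (𝟙 X) (𝟙 X)
    have h' := E.cce_id s (𝟙 X)
    rw [mapId_constDatum]
    have e : t (𝟙 X ≫ 𝟙 X) = t (𝟙 X) := congrArg t (sieveCat_hom_ext (by simp))
    rw [e, proj_id, E.E₂.res_id, add_left_inj] at h
    rw [h, h']
  · rw [cce_constDatum, zero_add, ht, add_comm]

/-- The terminal object of the maximal sieve. -/
abbrev topObj (U : C) : Tot (sieveCat (⊤ : Sieve U)).Obj := Tot.mk U ⟨𝟙 U, trivial⟩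

/-- The arrow to the terminal object of the maximal sieve. -/
def toTop (X : Tot (sieveCat (⊤ : Sieve U)).Obj) : X ⟶ topObj U :=
  ⟨⟨X.pt.1, Category.comp_id _⟩⟩

@[simp] lemma proj_toTop (X : Tot (sieveCat (⊤ : Sieve U)).Obj) :
    (sieveCat ⊤).proj (toTop X) = X.pt.1 := rfl

@[simp] lemma comp_toTop {X Y : Tot (sieveCat (⊤ : Sieve U)).Obj} (f : X ⟶ Y) :
    f ≫ toTop Y = toTop X :=
  sieveCat_hom_ext ((sieveCat (⊤ : Sieve U)).proj_comp f (toTop Y) |>.trans (sieveCat_comm f))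

section
variable (s t : FibFunctor (sieveCat (⊤ : Sieve U)) P)

/-- The transformation of descent data on the maximal sieve that is determined by its value at the
terminal object. -/
def topTrans (n : E.E₁.sec U) (hn : E.d₁ n = E.cob t (topObj U) - E.cob s (topObj U)) :
    FibTrans s t :=
  -- The restriction of `n` is conjugated by the images of `toTop X` under `s` and `t`. The
  -- composition constraints with `toTop Y` then measure the failure of naturality, and they satisfy
  -- the required law by their own cocycle conditions.
  E.mkTrans (fun X => E.car s (toTop X) + E.E₁.res X.pt.1 n - E.car t (toTop X))
    (fun {X Y} f => E.cce t f (toTop Y) - E.cce s f (toTop Y))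
    (fun X => by
      rw [map_sub, map_add, E.d₁_car, E.d₁_car, E.d₁_res, hn, map_sub, proj_toTop]; abel)
    (fun {X Y} f => by
      rw [map_sub, E.d₂_cce, E.d₂_cce, comp_toTop, map_sub, map_add, ← E.E₁.res_comp,
        sieveCat_comm]; abel)
    (fun X => by
      have h := E.cce_id s (toTop X)
      have h' := E.cce_id t (toTop X)
      linear_combination (norm := abel) h' - h)
    (fun {X Y Z} f g => by
      have h := E.cce_cocycle s f g (toTop Z)
      have h' := E.cce_cocycle t f g (toTop Z)
      rw [comp_toTop] at h h'
      rw [map_sub]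
      linear_combination (norm := abel) h' - h)

lemma ar_topTrans (n : E.E₁.sec U) (hn : E.d₁ n = E.cob t (topObj U) - E.cob s (topObj U))
    (X : Tot (sieveCat (⊤ : Sieve U)).Obj) : E.ar ((E.topTrans s t n hn).app X.pt) =
      E.car s (toTop X) + E.E₁.res X.pt.1 n - E.car t (toTop X) :=
  E.ar_mkTrans _ _ _ _ _ _ X

lemma ce_topTrans (n : E.E₁.sec U) (hn : E.d₁ n = E.cob t (topObj U) - E.cob s (topObj U))
    {X Y : Tot (sieveCat (⊤ : Sieve U)).Obj} (f : X ⟶ Y) :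
    E.ce ((E.topTrans s t n hn).nat f).hom = E.cce t f (toTop Y) - E.cce s f (toTop Y) :=
  E.ce_mkTrans _ _ _ _ _ _ f

end

end FibTwoCat.Coord

/-! ### Descent for 1-arrows and 2-arrows. -/

namespace FibTwoCat.Coord

variable {C : Type u} [Category.{v} C] {J : GrothendieckTopology C}
  {P : FibTwoCat.{v, u, w, a, b} C} (E : P.Coord J) {U : C} {R : Sieve U}

section
variable (s : FibFunctor (sieveCat (⊤ : Sieve U)) P)

/-- The coordinate of the value at the 1-arrow to the terminal object. -/
def topCar (X : Tot (sieveCat R).Obj) : E.E₁.sec X.base := E.car s (toTop (inclObj X))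

/-- The coordinate of the composition constraint at a 1-arrow followed by the 1-arrow to the
terminal object. -/
def topCce {X Y : Tot (sieveCat R).Obj} (f : X ⟶ Y) : E.E₂.sec X.base :=
  E.cce s ((sieveIncl R).map f) (toTop (inclObj Y))

lemma d₁_topCar (X : Tot (sieveCat R).Obj) : E.d₁ (E.topCar s X) =
    E.E₀.res X.pt.1 (E.cob s (topObj U)) - E.cob ((sieveIncl R).comp s) X :=
  E.d₁_car s (toTop (inclObj X))

lemma d₂_topCce {X Y : Tot (sieveCat R).Obj} (f : X ⟶ Y) : E.d₂ (E.topCce s f) =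
    E.car ((sieveIncl R).comp s) f + E.E₁.res ((sieveCat R).proj f) (E.topCar s Y) -
      E.topCar s X := by
  have h := E.d₂_cce s ((sieveIncl R).map f) (toTop (inclObj Y))
  rw [comp_toTop] at h
  exact h

/-- Every arrow followed by `toTop` is `toTop`, so the 2-cocycle condition with third arrow `toTop`
exhibits `topCce` as a cochain whose coboundary is the restricted composition constraint. -/
lemma topCce_comp {X Y Z : Tot (sieveCat R).Obj} (f : X ⟶ Y) (g : Y ⟶ Z) :
    E.topCce s (f ≫ g) + E.cce ((sieveIncl R).comp s) f g =
      E.E₂.res ((sieveCat R).proj f) (E.topCce s g) + E.topCce s f := by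
  have h := E.cce_cocycle s ((sieveIncl R).map f) ((sieveIncl R).map g) (toTop (inclObj Z))
  rw [comp_toTop] at h
  rw [cce_incl]
  exact h

end

/-- Over `R`, the transformation `φ` is compared with those of the form `topTrans`. The naturality
2-arrows of `φ` and of `topTrans` have the same coboundary, so their difference `σ` is a 1-cocycle
and is split by some `γ`. Corrected by `γ` and transported to the terminal object, the components of
`φ` glue to a section `n` over `U`, and `γ` is the modification from the transformation of `n` to
`φ`. -/
lemma descent_hom (E : P.Coord J) (hR : R ∈ J U) (s t : FibFunctor (sieveCat (⊤ : Sieve U)) P)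
    (φ : FibTrans ((sieveIncl R).comp s) ((sieveIncl R).comp t)) :
    ∃ ψ : FibTrans s t, Nonempty (FibMod (ψ.precomp (sieveIncl R)).toPreTrans φ.toPreTrans) := by
  let σ {X Y : Tot (sieveCat R).Obj} (f : X ⟶ Y) : E.E₂.sec X.base :=
    E.topCce t f - E.topCce s f - E.ce (φ.nat f).hom
  have hσ {X Y Z : Tot (sieveCat R).Obj} (f : X ⟶ Y) (g : Y ⟶ Z) :
      σ (f ≫ g) = σ f + E.E₂.res ((sieveCat R).proj f) (σ g) := by
    simp only [σ, map_sub]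
    linear_combination (norm := abel) E.topCce_comp t f g - E.topCce_comp s f g -
      E.ce_nat_comp φ f g
  let γ (X : Tot (sieveCat R).Obj) : E.E₂.sec X.base := sieveAvg E.E₂ X σ
  have hγ {X Y : Tot (sieveCat R).Obj} (f : X ⟶ Y) :
      E.E₂.res ((sieveCat R).proj f) (γ Y) = γ X + σ f := sieve_cocycle E.E₂ σ hσ f
  -- The glued family is what `n` must restrict to if `d₂ γ` is to be the difference between `φ` and
  -- the transformation given by `n`.
  obtain ⟨n, hn⟩ := sieve_glue E.E₁ hR
    (fun X => E.ar (φ.app X.pt) - E.topCar s X + E.topCar t X - E.d₂ (γ X)) (fun {X Y} f => by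
    have h := congrArg E.d₂ (hγ f)
    have h₁ := E.d₂_topCce s f
    have h₂ := E.d₂_topCce t f
    have h₃ := E.d₂_nat φ.toPreTrans f
    simp only [σ, map_add, map_sub, E.d₂_res] at h ⊢
    linear_combination (norm := abel) h₃ - h + h₁ - h₂)
  -- An equation between sections over `U`, checked on the cover.
  have hdn : E.d₁ n = E.cob t (topObj U) - E.cob s (topObj U) := E.E₀.sep hR fun {V} k hk => by
    let X : Tot (sieveCat R).Obj := Tot.mk V ⟨k, hk⟩
    have h := congrArg E.d₁ (hn X)
    have h₁ := E.d₁_topCar s X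
    have h₂ := E.d₁_topCar t X
    have h₃ := E.d₁_app φ.toPreTrans X
    rw [E.d₁_res, map_sub, map_add, map_sub, E.d₁_d₂] at h
    rw [map_sub]
    linear_combination (norm := abel) h - h₁ + h₂ + h₃
  refine ⟨E.topTrans s t n hdn, ⟨E.mkMod γ (fun X => ?_) (fun {X Y} f => ?_)⟩⟩
  · have h : E.ar (((E.topTrans s t n hdn).precomp (sieveIncl R)).app X.pt) =
        E.topCar s X + E.E₁.res X.pt.1 n - E.topCar t X :=
      E.ar_topTrans s t n hdn (inclObj X)
    rw [h, hn]; abel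
  · have h : E.ce (((E.topTrans s t n hdn).precomp (sieveIncl R)).nat f).hom =
        E.topCce t f - E.topCce s f :=
      E.ce_topTrans s t n hdn ((sieveIncl R).map f)
    rw [h, hγ]
    simp only [σ]; abel

/-- A modification on the maximal sieve is determined by its value at the terminal object:
naturality at `toTop X` makes its value at `X` the restriction of that value plus a fixed `δ X`. As
`δ` satisfies the naturality equation, `Γ - δ` is a compatible family and glues; no averaging is
needed. -/
lemma descent_hom₂ (E : P.Coord J) (hR : R ∈ J U) (s t : FibFunctor (sieveCat (⊤ : Sieve U)) P)
    (φ ψ : FibTrans s t)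
    (Γ : FibMod (φ.precomp (sieveIncl R)).toPreTrans (ψ.precomp (sieveIncl R)).toPreTrans) :
    ∃! Ω : FibMod φ.toPreTrans ψ.toPreTrans, FibMod.precomp (sieveIncl R) Ω = Γ := by
  let δ (X : Tot (sieveCat (⊤ : Sieve U)).Obj) : E.E₂.sec X.base :=
    E.ce (ψ.nat (toTop X)).hom - E.ce (φ.nat (toTop X)).hom
  have hδ {X Y : Tot (sieveCat (⊤ : Sieve U)).Obj} (f : X ⟶ Y) :
      E.E₂.res ((sieveCat ⊤).proj f) (δ Y) + E.ce (ψ.nat f).hom = E.ce (φ.nat f).hom + δ X := by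
    have h := E.ce_nat_comp φ f (toTop Y)
    have h' := E.ce_nat_comp ψ f (toTop Y)
    rw [comp_toTop] at h h'
    simp only [δ, map_sub]
    linear_combination (norm := abel) h - h'
  have hdδ (X : Tot (sieveCat (⊤ : Sieve U)).Obj) : E.d₂ (δ X) =
      E.ar (ψ.app X.pt) - E.ar (φ.app X.pt) -
        E.E₁.res X.pt.1 (E.ar (ψ.app (topObj U).pt) - E.ar (φ.app (topObj U).pt)) := by
    rw [map_sub, map_sub, E.d₂_nat, E.d₂_nat, proj_toTop]; abel
  obtain ⟨x, hx⟩ := sieve_glue E.E₂ hR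
    (fun X => E.ce (Γ.app X.pt).hom - δ (inclObj X)) (fun {X Y} f => by
    have h := hδ ((sieveIncl R).map f)
    have h' := E.ce_mod Γ f
    rw [map_sub]
    change _ + E.ce (ψ.nat ((sieveIncl R).map f)).hom = E.ce (φ.nat ((sieveIncl R).map f)).hom + _
      at h'
    change E.E₂.res ((sieveCat R).proj f) (δ (inclObj Y)) + _ = _ at h
    linear_combination (norm := abel) h' - h)
  -- On the cover, `d₂` of the glued family is the difference of the components of `ψ` and `φ` minus
  -- `d₂ δ`, which by `hdδ` leaves the restriction of the difference at the terminal object.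
  have hdx : E.d₂ x = E.ar (ψ.app (topObj U).pt) - E.ar (φ.app (topObj U).pt) :=
    E.E₁.sep hR fun {V} k hk => by
      let X : Tot (sieveCat R).Obj := Tot.mk V ⟨k, hk⟩
      have h := congrArg E.d₂ (hx X)
      have h₁ := hdδ (inclObj X)
      have h₂ : E.d₂ (E.ce (Γ.app X.pt).hom) =
        E.ar (ψ.app (inclObj X).pt) - E.ar (φ.app (inclObj X).pt) := E.d₂_ce _
      rw [E.d₂_res, map_sub, h₂, h₁, sub_sub_cancel] at h
      exact h
  obtain ⟨Ω₀, hΩ₀⟩ : ∃ Ω : FibMod φ.toPreTrans ψ.toPreTrans, ∀ X : Tot (sieveCat ⊤).Obj,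
      E.ce (Ω.app X.pt).hom = E.E₂.res X.pt.1 x + δ X :=
    ⟨E.mkMod (fun X => E.E₂.res X.pt.1 x + δ X)
      (fun X => by rw [map_add, hdδ, E.d₂_res, hdx]; abel)
      (fun {X Y} f => by
        have h := hδ f
        rw [map_add, ← E.E₂.res_comp, sieveCat_comm]
        linear_combination (norm := abel) h), E.ce_mkMod _ _ _⟩
  refine ⟨Ω₀, E.mod_ext fun X => ?_, fun Ω hΩ => E.mod_ext fun X => ?_⟩
  · refine (hΩ₀ (inclObj X)).trans ?_
    change E.E₂.res X.pt.1 x + δ (inclObj X) = _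
    rw [hx]; abel
  -- Uniqueness: `Ω` is reconstructed from its value at the terminal object, and that value is known
  -- on the cover.
  · have hτ (X : Tot (sieveCat (⊤ : Sieve U)).Obj) : E.ce (Ω.app X.pt).hom =
        E.E₂.res X.pt.1 (E.ce (Ω.app (topObj U).pt).hom) + δ X := by
      have h := E.ce_mod Ω (toTop X)
      rw [proj_toTop] at h
      simp only [δ]
      linear_combination (norm := abel) -h
    have e : E.ce (Ω.app (topObj U).pt).hom = x := E.E₂.sep hR fun {V} k hk => by
      let Y : Tot (sieveCat R).Obj := Tot.mk V ⟨k, hk⟩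
      have h : E.ce (Ω.app (inclObj Y).pt).hom = E.ce (Γ.app Y.pt).hom := by rw [← hΩ]; rfl
      have h' := hx Y
      rw [← h, hτ, add_sub_cancel_right] at h'
      exact h'.symm
    rw [hτ, e, hΩ₀]

/-- A fibred 2-category with coordinates is a 2-stack. -/
lemma isTwoStack (E : P.Coord J) : P.IsTwoStack J where
  toIsFibredInGroupoids := E.isFibredInGroupoids
  descent_obj := E.descent_obj
  descent_hom := E.descent_hom
  descent_hom₂ := E.descent_hom₂

end FibTwoCat.Coord

/-! ### Coordinates for sections of complexes and for their fibered product; invertibility of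
objects. -/

section SectionCoordinates

variable {C : Type u} [Category.{v} C] {J : GrothendieckTopology C}

lemma dif_dif (K : CochainComplex (Sheaf J AddCommGrpCat.{max u v}) ℤ) (i j k : ℤ) {U : C}
    (x : sec K i U) : dif K j k (dif K i j x) = 0 :=
  ConcreteCategory.congr_hom (congrArg (fun t => t.hom.app (op U)) (K.d_comp_d i j k)) x

lemma sec_sep (K : CochainComplex (Sheaf J AddCommGrpCat.{max u v}) ℤ) {i : ℤ} {U : C}
    {R : Sieve U} (hR : R ∈ J U) {x y : sec K i U}
    (h : ∀ {V : C} (k : V ⟶ U), R k → res K k x = res K k y) : x = y :=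
  sheaf_sep (K.X i) hR h

/-- The coordinates on the 2-category of sections of a complex of injective sheaves. -/
noncomputable def secCoord (K : CochainComplex (Sheaf J AddCommGrpCat.{max u v}) ℤ)
    [∀ i, Injective (K.X i)] : (secCat K).Coord J where
  E₀ := avgSheaf (K.X 0)
  E₁ := avgSheaf (K.X (-1))
  E₂ := avgSheaf (K.X (-2))
  d₁ := dif K (-1) 0
  d₂ := dif K (-2) (-1)
  d₁_res k x := dif_res K k x
  d₂_res k x := dif_res K k x
  d₁_d₂ x := dif_dif K _ _ _ x
  IsCocycle {U} x := dif K 0 1 (U := U) x = 0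
  isCocycle_res {_ _} k {x} h := (dif_res K k x).trans ((congrArg _ h).trans (map_zero _))
  isCocycle_of_cover {_ _} hR {x} h := sec_sep K hR fun k hk =>
    (dif_res K k x).symm.trans ((h k hk).trans (map_zero _).symm)
  isCocycle_sub {U _} y h := (map_sub (dif K 0 1 (U := U)) _ _).trans
    ((congrArg₂ (· - ·) h (dif_dif K (-1) 0 1 y)).trans (sub_zero _))
  ob x := x.1
  isCocycle_ob x := x.2
  mkOb x h := ⟨x, h⟩
  ob_mkOb _ _ := rfl
  ar f := av f
  d₁_ar f := dif_av f
  mkAr k m h := mkArrow k m h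
  proj_mkAr _ _ _ := rfl
  ar_mkAr _ _ _ := rfl
  ar_id _ := rfl
  ar_comp f g := av_comp f g
  ce η := cv η
  d₂_ce η := dif_cv η
  ce_ext h := cv_ext h
  mkCe h x hx := mkCell x h hx
  ce_mkCe _ _ _ := rfl
  ce_id _ := rfl
  ce_comp _ _ := rfl
  ce_whiskerLeft _ _ _ _ := rfl
  ce_whiskerRight _ _ := rfl
  ce_associator _ _ _ := rfl
  ce_leftUnitor _ := rfl
  ce_rightUnitor _ := rfl

variable {K L M : CochainComplex (Sheaf J AddCommGrpCat.{max u v}) ℤ}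

section
variable (φ : K ⟶ M) (γ : L ⟶ M)

/-- The differential of the fibre product of complexes on pairs of sections with a section of the
target. -/
def prodDif (i j k : ℤ) {U : C} :
    sec K j U × sec L j U × sec M i U →+ sec K k U × sec L k U × sec M j U :=
  AddMonoidHom.mk' (fun x => (dif K j k x.1, dif L j k x.2.1,
      mor γ x.2.1 - mor φ x.1 - dif M i j x.2.2)) (fun x y => by
    simp only [Prod.fst_add, Prod.snd_add, map_add, Prod.mk_add_mk, Prod.mk.injEq, true_and]
    abel)

lemma prodDif_res (i j k : ℤ) {U V : C} (l : V ⟶ U) (x : sec K j U × sec L j U × sec M i U) :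
    prodDif φ γ i j k (res K l x.1, res L l x.2.1, res M l x.2.2) =
      (res K l (prodDif φ γ i j k x).1, res L l (prodDif φ γ i j k x).2.1,
        res M l (prodDif φ γ i j k x).2.2) := by
  simp [prodDif, dif_res, mor_res]

/-- The differential of the fibre product of complexes on pairs of sections. -/
def pairDif (i j : ℤ) {U : C} :
    sec K i U × sec L i U →+ sec K j U × sec L j U × sec M i U :=
  AddMonoidHom.mk' (fun x => (dif K i j x.1, dif L i j x.2, mor γ x.2 - mor φ x.1))
    (fun x y => by
      simp only [Prod.fst_add, Prod.snd_add, map_add, Prod.mk_add_mk, Prod.mk.injEq, true_and]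
      abel)

lemma prodDif_pairDif (i j k : ℤ) {U : C} (x : sec K i U × sec L i U) :
    prodDif φ γ i j k (pairDif φ γ i j x) = 0 := by
  simp [prodDif, pairDif, dif_dif, mor_dif]

end

variable [∀ i, Injective (K.X i)] [∀ i, Injective (L.X i)] [∀ i, Injective (M.X i)]

/-- The coordinates on the fibered product of the 2-categories of sections of complexes of
injective sheaves. -/
noncomputable def prodCoord (φ : K ⟶ M) (γ : L ⟶ M) : (secProd φ γ).Coord J where
  E₀ := (avgSheaf (K.X 0)).prod ((avgSheaf (L.X 0)).prod (avgSheaf (M.X (-1))))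
  E₁ := (avgSheaf (K.X (-1))).prod ((avgSheaf (L.X (-1))).prod (avgSheaf (M.X (-2))))
  E₂ := (avgSheaf (K.X (-2))).prod (avgSheaf (L.X (-2)))
  d₁ := prodDif φ γ (-2) (-1) 0
  d₂ := pairDif φ γ (-2) (-1)
  d₁_res k x := prodDif_res φ γ _ _ _ k x
  d₂_res k x := Prod.ext (dif_res K k x.1) (Prod.ext (dif_res L k x.2)
    ((congrArg₂ (· - ·) (mor_res γ k x.2) (mor_res φ k x.1)).trans (map_sub (res M k) _ _).symm))
  d₁_d₂ x := prodDif_pairDif φ γ _ _ _ x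
  IsCocycle {U} x := dif K 0 1 (U := U) x.1 = 0 ∧ dif L 0 1 (U := U) x.2.1 = 0 ∧
    dif M (-1) 0 (U := U) x.2.2 = mor γ (i := 0) (U := U) x.2.1 - mor φ (i := 0) (U := U) x.1
  isCocycle_res {_ _} k {x} h := ⟨(dif_res K k x.1).trans ((congrArg _ h.1).trans (map_zero _)),
    (dif_res L k x.2.1).trans ((congrArg _ h.2.1).trans (map_zero _)),
    (dif_res M k x.2.2).trans ((congrArg _ h.2.2).trans ((map_sub (res M k) _ _).trans
      (congrArg₂ (· - ·) (mor_res γ k x.2.1).symm (mor_res φ k x.1).symm)))⟩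
  isCocycle_of_cover {_ _} hR {x} h :=
    ⟨sec_sep K hR fun k hk => (dif_res K k x.1).symm.trans ((h k hk).1.trans (map_zero _).symm),
    sec_sep L hR fun k hk => (dif_res L k x.2.1).symm.trans ((h k hk).2.1.trans (map_zero _).symm),
    sec_sep M hR fun k hk => (dif_res M k x.2.2).symm.trans ((h k hk).2.2.trans
      ((congrArg₂ (· - ·) (mor_res γ k x.2.1) (mor_res φ k x.1)).trans
        (map_sub (res M k) _ _).symm))⟩
  isCocycle_sub {U x} y h :=
    ⟨(map_sub (dif K 0 1 (U := U)) _ _).trans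
      ((congrArg₂ (· - ·) h.1 (dif_dif K (-1) 0 1 y.1)).trans (sub_zero _)),
    (map_sub (dif L 0 1 (U := U)) _ _).trans
      ((congrArg₂ (· - ·) h.2.1 (dif_dif L (-1) 0 1 y.2.1)).trans (sub_zero _)), by
    have h' := h.2.2
    obtain ⟨x₁, x₂, x₃⟩ := x
    obtain ⟨y₁, y₂, y₃⟩ := y
    change sec K 0 U at x₁
    change sec L 0 U at x₂
    change sec M (-1) U at x₃
    change sec K (-1) U at y₁
    change sec L (-1) U at y₂
    change sec M (-2) U at y₃
    change dif M (-1) 0 x₃ = mor γ x₂ - mor φ x₁ at h'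
    change dif M (-1) 0 (x₃ - (mor γ y₂ - mor φ y₁ - dif M (-2) (-1) y₃)) =
      mor γ (x₂ - dif L (-1) 0 y₂) - mor φ (x₁ - dif K (-1) 0 y₁)
    simp only [map_sub, h', dif_dif, mor_dif]
    abel⟩
  ob x := (x.fst.1, x.snd.1, av x.link.1)
  isCocycle_ob x := ⟨x.fst.2, x.snd.2, dif_link x⟩
  mkOb {U} x h := ⟨⟨x.1, h.1⟩, ⟨x.2.1, h.2.1⟩, ⟨mkArrow (𝟙 U) x.2.2
    (h.2.2.trans (congrArg (· - _) (res_id M _).symm)), rfl⟩⟩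
  ob_mkOb _ _ := rfl
  ar f := (av (p₁ f), av (p₂ f), lv f)
  d₁_ar {X Y} f := Prod.ext (dif_av (p₁ f))
    (Prod.ext ((dif_av (p₂ f)).trans (by rw [proj_p₂]; rfl)) (by
      change mor γ (av (p₂ f)) - mor φ (av (p₁ f)) - dif M (-2) (-1) (lv f) =
        res M ((secCat K).proj (p₁ f)) (av Y.pt.link.1) - av X.pt.link.1
      rw [dif_lv]; abel))
  mkAr {X Y} k m h := mkProdArrow k m.1 m.2.1 m.2.2 (congrArg Prod.fst h)
    (congrArg (fun x => x.2.1) h) (by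
      have h' : mor γ (i := -1) (U := X.base) m.2.1 - mor φ (i := -1) (U := X.base) m.1 -
          dif M (-2) (-1) (U := X.base) m.2.2 =
        res M k (av Y.pt.link.1) - av X.pt.link.1 := congrArg (fun x => x.2.2) h
      linear_combination (norm := abel) -h')
  proj_mkAr _ _ _ := rfl
  ar_mkAr _ _ _ := rfl
  ar_id _ := Prod.ext rfl (Prod.ext rfl lv_id)
  ar_comp f g := Prod.ext rfl (Prod.ext (av_p₂_comp f g) ((lv_comp f g).trans (add_comm _ _)))
  ce η := (cv (q₁ η), cv (q₂ η))
  d₂_ce {X Y f g} η := Prod.ext (dif_cv (q₁ η)) (Prod.ext (dif_cv (q₂ η)) (by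
    have h := lv_eq η
    change mor γ (cv (q₂ η)) - mor φ (cv (q₁ η)) = lv g - lv f
    linear_combination (norm := abel) -h))
  ce_ext h := q_ext (congrArg Prod.fst h) (congrArg Prod.snd h)
  mkCe {X Y f g} h x hx := mkProdCell x.1 x.2 h (congrArg Prod.fst hx)
    (congrArg (fun y => y.2.1) hx) (by
      have h' : mor γ (i := -2) (U := X.base) x.2 - mor φ (i := -2) (U := X.base) x.1 =
        lv g - lv f := congrArg (fun y => y.2.2) hx
      linear_combination (norm := abel) -h')
  ce_mkCe _ _ _ := rfl
  ce_id _ := rfl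
  ce_comp _ _ := rfl
  ce_whiskerLeft f _ _ η := Prod.ext rfl (cv_q₂_left f η)
  ce_whiskerRight _ _ := rfl
  ce_associator _ _ _ := rfl
  ce_leftUnitor _ := rfl
  ce_rightUnitor _ := rfl

/-- Tensoring with `x` is translation by `x` on objects, undone by subtraction, and it adds the zero
coordinate of an identity to 1-arrows and 2-arrows. -/
lemma isPicardTwoStack_secPicard : (secPicard K).IsPicardTwoStack J where
  isTwoStack := (secCoord K).isTwoStack
  nonempty U := ⟨⟨0, map_zero _⟩⟩
  essSurj x z := ⟨⟨z.1 - x.1, by rw [map_sub, z.2, x.2, sub_zero]⟩,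
    ⟨⟨mkArrow (𝟙 _) 0 (by
      rw [map_zero, res_id]
      exact (sub_eq_zero.2 (add_sub_cancel x.1 z.1).symm).symm), rfl⟩⟩⟩
  full {U} x y y' g := by
    change VHom (secCat K) (addObj (x, y)) (addObj (x, y')) at g
    have h := dif_av g.1
    rw [g.2, res_id] at h
    let m : sec K (-1) U := av g.1
    have hm : dif K (-1) 0 m = res K (𝟙 U) y'.1 - y.1 := by
      rw [res_id]
      exact h.trans (add_sub_add_left_eq_sub y'.1 y.1 x.1)
    exact ⟨⟨mkArrow (𝟙 U) m hm, rfl⟩, ⟨mkIso g.2.symm (zero_add m)⟩⟩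
  bijective {U} x y y' f f' := by
    change VHom (secCat K) y y' at f f'
    refine ⟨fun η θ h => cv_ext ?_, fun η => ?_⟩
    · have h' : 0 + cv η = 0 + cv θ := congrArg cv h
      exact add_left_cancel h'
    · let t : sec K (-2) U := cv η
      have h : dif K (-2) (-1) t = av f'.1 - av f.1 :=
        (dif_cv η).trans (add_sub_add_left_eq_sub (av f'.1) (av f.1) 0)
      exact ⟨mkCell t (f.2.trans f'.2.symm) h, cv_ext (zero_add t)⟩

/-- Translations again, now in all three components: the link of the difference object is the
difference of the links, because `d` of a link is additive in the object. -/
lemma isPicardTwoStack_prodPicard (φ : K ⟶ M) (γ : L ⟶ M) :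
    (prodPicard φ γ).IsPicardTwoStack J where
  isTwoStack := (prodCoord φ γ).isTwoStack
  nonempty U := ⟨⟨⟨0, map_zero _⟩, ⟨0, map_zero _⟩, ⟨mkArrow (𝟙 U) 0 (by
    simp [secMap, morObj]), rfl⟩⟩⟩
  essSurj {U} x z := by
    change (secProd φ γ).Obj U at x z
    have h : dif M (-1) 0 (av z.link.1 - av x.link.1) =
        res M (𝟙 U) (mor γ (z.snd.1 - x.snd.1)) - mor φ (z.fst.1 - x.fst.1) := by
      rw [map_sub, dif_link z, dif_link x, res_id, map_sub, map_sub]; abel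
    let y : (secProd φ γ).Obj U :=
      ⟨⟨z.fst.1 - x.fst.1, by rw [map_sub, z.fst.2, x.fst.2, sub_zero]⟩,
        ⟨z.snd.1 - x.snd.1, by rw [map_sub, z.snd.2, x.snd.2, sub_zero]⟩,
        ⟨mkArrow (𝟙 U) (av z.link.1 - av x.link.1) h, rfl⟩⟩
    let l : sec M (-1) U := av x.link.1
    let l' : sec M (-1) U := av z.link.1
    exact ⟨y, ⟨zeroArrow (prodAddObj (x, y)) z (add_sub_cancel x.fst.1 z.fst.1)
      (add_sub_cancel x.snd.1 z.snd.1) (add_sub_cancel l l'), rfl⟩⟩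
  full {U} x y y' g := by
    change VHom (secProd φ γ) (prodAddObj (x, y)) (prodAddObj (x, y')) at g
    have hg : (secCat K).proj (p₁ g.1) = 𝟙 U := g.2
    have h₁ := dif_av (p₁ g.1)
    have h₂ := dif_av (p₂ g.1)
    have h₃ := dif_lv g.1
    rw [hg, res_id] at h₁ h₃
    rw [proj_p₂, hg, res_id] at h₂
    let m : sec K (-1) U := av (p₁ g.1)
    let n : sec L (-1) U := av (p₂ g.1)
    let t : sec M (-2) U := lv g.1
    have hm : dif K (-1) 0 m = res K (𝟙 U) y'.fst.1 - y.fst.1 := by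
      rw [res_id]; exact h₁.trans (add_sub_add_left_eq_sub y'.fst.1 y.fst.1 x.fst.1)
    have hn : dif L (-1) 0 n = res L (𝟙 U) y'.snd.1 - y.snd.1 := by
      rw [res_id]; exact h₂.trans (add_sub_add_left_eq_sub y'.snd.1 y.snd.1 x.snd.1)
    have ht : dif M (-2) (-1) t = (av y.link.1 + mor γ n) -
        (mor φ m + res M (𝟙 U) (av y'.link.1)) := by
      refine h₃.trans ?_
      change (av x.link.1 + av y.link.1 + mor γ n) -
        (mor φ m + (av x.link.1 + av y'.link.1)) = _
      rw [res_id]; abel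
    -- Tensoring adds the 2-arrow component of `𝟙 x`, which is built from unit constraints and
    -- vanishes by `lv_id`.
    have h₀ : lv (𝟙 (Tot.mk U x : Tot (secProd φ γ).Obj)) + t = t := by rw [lv_id, zero_add]
    exact ⟨⟨mkProdArrow (𝟙 U) m n t hm hn ht, rfl⟩,
      ⟨mkProdIso hg.symm (zero_add m) (zero_add n) h₀⟩⟩
  bijective {U} x y y' f f' := by
    change VHom (secProd φ γ) y y' at f f'
    refine ⟨fun η θ h => q_ext ?_ ?_, fun η => ?_⟩
    · have h' : 0 + cv (q₁ η) = 0 + cv (q₁ θ) := congrArg (fun t => cv (q₁ t)) h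
      exact add_left_cancel h'
    · have h' : 0 + cv (q₂ η) = 0 + cv (q₂ θ) := congrArg (fun t => cv (q₂ t)) h
      exact add_left_cancel h'
    · have h₁ : dif K (-2) (-1) (cv (q₁ η)) = av (p₁ f'.1) - av (p₁ f.1) :=
        (dif_cv (q₁ η)).trans (add_sub_add_left_eq_sub (av (p₁ f'.1)) (av (p₁ f.1)) 0)
      have h₂ : dif L (-2) (-1) (cv (q₂ η)) = av (p₂ f'.1) - av (p₂ f.1) :=
        (dif_cv (q₂ η)).trans (add_sub_add_left_eq_sub (av (p₂ f'.1)) (av (p₂ f.1)) 0)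
      have h₃ : mor φ (cv (q₁ η)) + lv f'.1 = lv f.1 + mor γ (cv (q₂ η)) := by
        have h : mor φ (cv (q₁ η)) + (lv (𝟙 (Tot.mk U x : Tot (secProd φ γ).Obj)) + lv f'.1) =
          lv (𝟙 (Tot.mk U x : Tot (secProd φ γ).Obj)) + lv f.1 + mor γ (cv (q₂ η)) := lv_eq η
        rwa [lv_id, zero_add, zero_add] at h
      let a : sec K (-2) U := cv (q₁ η)
      let b : sec L (-2) U := cv (q₂ η)
      exact ⟨mkProdCell a b (f.2.trans f'.2.symm) h₁ h₂ h₃, q_ext (zero_add a) (zero_add b)⟩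

end SectionCoordinates

/-! ### Exactness of complexes of sheaves, locally and globally on sections. -/

section Exactness

variable {C : Type u} [Category.{v} C] {J : GrothendieckTopology C}

/-- The functor of sections over `U`. -/
abbrev sectionsFunctor (J : GrothendieckTopology C) (U : C) :
    Sheaf J AddCommGrpCat.{max u v} ⥤ AddCommGrpCat.{max u v} :=
  sheafToPresheaf J AddCommGrpCat.{max u v} ⋙ (evaluation _ _).obj (op U)

/-- The map on sections that is induced by a morphism of sheaves. -/
def ev {F G : Sheaf J AddCommGrpCat.{max u v}} (φ : F ⟶ G) (U : C) :
    F.obj.obj (op U) →+ G.obj.obj (op U) := ((sectionsFunctor J U).map φ).hom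

section
variable {F G H : Sheaf J AddCommGrpCat.{max u v}} {U : C}

lemma ev_comp (φ : F ⟶ G) (γ : G ⟶ H) (x : F.obj.obj (op U)) :
    ev (φ ≫ γ) U x = ev γ U (ev φ U x) := rfl

lemma ev_id (x : F.obj.obj (op U)) : ev (𝟙 F) U x = x := rfl

lemma ev_add (φ γ : F ⟶ G) (x : F.obj.obj (op U)) : ev (φ + γ) U x = ev φ U x + ev γ U x := rfl

lemma ev_zero (x : F.obj.obj (op U)) : ev (0 : F ⟶ G) U x = 0 := rfl

lemma ev_res (φ : F ⟶ G) {V : C} (k : V ⟶ U) (x : F.obj.obj (op U)) :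
    ev φ V ((F.obj.map k.op).hom x) = (G.obj.map k.op).hom (ev φ U x) :=
  ConcreteCategory.congr_hom (φ.hom.naturality k.op) x

lemma eq_zero_of_isZero (hF : IsZero F) (x : F.obj.obj (op U)) : x = 0 := by
  rw [← ev_id x, hF.eq_of_src (𝟙 F) 0]; rfl

/-- A section that is killed by the second morphism of an exact sequence of sheaves comes locally
from the first term. -/
lemma ShortComplex.Exact.exists_local {S : ShortComplex (Sheaf J AddCommGrpCat.{max u v})}
    (hS : S.Exact) (x : S.X₂.obj.obj (op U)) (hx : ev S.g U x = 0) :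
    ∃ R ∈ J U, ∀ {V : C} (k : V ⟶ U), R k →
      ∃ y : S.X₁.obj.obj (op V), ev S.f V y = (S.X₂.obj.map k.op).hom x := by
  -- The problem is split at the cycles. Sections are left exact, so `x` comes from a section of the
  -- cycles over `U` itself; the first term maps onto the cycles by an epimorphism of sheaves, which
  -- is locally surjective.
  let T : ShortComplex (Sheaf J AddCommGrpCat.{max u v}) := ShortComplex.mk S.iCycles S.g (by simp)
  have hT : T.Exact := ShortComplex.exact_of_f_is_kernel _ S.cyclesIsKernel
  have hmap := hT.map_of_mono_of_preservesKernel (sectionsFunctor J U)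
    (inferInstanceAs (Mono S.iCycles)) inferInstance
  obtain ⟨z, hz⟩ := (ShortComplex.ab_exact_iff _).1 hmap x hx
  have : Epi S.toCycles := hS.epi_toCycles
  have : Sheaf.IsLocallySurjective S.toCycles := (Sheaf.isLocallySurjective_iff_epi' _ _).2 this
  refine ⟨_, Presheaf.imageSieve_mem J S.toCycles.hom (U := op U) z, fun {V} k hk => ?_⟩
  obtain ⟨y, hy⟩ := hk
  refine ⟨y, ?_⟩
  rw [← S.toCycles_i, ev_comp]
  change ev S.toCycles V y = _ at hy
  rw [hy]
  refine (ev_res S.iCycles k z).trans ?_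
  exact congrArg _ hz

end

variable {K L : CochainComplex (Sheaf J AddCommGrpCat.{max u v}) ℤ}

lemma exactAt_exists_local (i j k : ℤ) (hij : i + 1 = j) (hjk : j + 1 = k) (hK : K.ExactAt j)
    {U : C} (x : sec K j U) (hx : dif K j k x = 0) :
    ∃ R ∈ J U, ∀ {V : C} (l : V ⟶ U), R l → ∃ y : sec K i V, dif K i j y = res K l x :=
  ShortComplex.Exact.exists_local ((K.exactAt_iff' i j k (by simp; lia) (by simp; lia)).1 hK) x hx

/-- By `hs`, the endomorphism `1 - s d` of `K.X j` vanishes on the image of the incoming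
differential. By exactness and injectivity of `K.X j` it factors through the outgoing one, and the
factor is the next piece of a contraction. -/
lemma exists_contraction_of_comp {A : Type*} [Category* A] [Abelian A] (K : CochainComplex A ℤ)
    (i j k : ℤ) (hij : i + 1 = j) (hjk : j + 1 = k) [Injective (K.X j)] (hK : K.ExactAt j)
    (s : K.X j ⟶ K.X i) (hs : K.d i j ≫ s ≫ K.d i j = K.d i j) :
    ∃ t : K.X k ⟶ K.X j, s ≫ K.d i j + K.d j k ≫ t = 𝟙 (K.X j) := by
  have hex := (K.exactAt_iff' i j k (by simp; lia) (by simp; lia)).1 hK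
  have : Injective (K.sc' i j k).X₂ := inferInstanceAs (Injective (K.X j))
  have hz : K.d i j ≫ (𝟙 _ - s ≫ K.d i j) = 0 := by simp [Preadditive.comp_sub, hs]
  refine ⟨hex.descToInjective (J := K.X j) (𝟙 _ - s ≫ K.d i j) hz, ?_⟩
  have h : K.d j k ≫ hex.descToInjective (J := K.X j) (𝟙 _ - s ≫ K.d i j) hz =
    𝟙 _ - s ≫ K.d i j := hex.comp_descToInjective _ _
  rw [h]
  abel

/-- A bounded below complex of injective objects which is exact in degrees `≤ m` has a contraction
in degrees `≤ m`. -/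
lemma exists_contraction {A : Type*} [Category* A] [Abelian A] (K : CochainComplex A ℤ)
    [∀ i, Injective (K.X i)] (n : ℤ) [K.IsStrictlyGE n] (m : ℤ)
    (hK : ∀ i ≤ m, K.ExactAt i) (p : ℕ) (i j k : ℤ) (hij : i + 1 = j) (hjk : j + 1 = k)
    (hj : j = n + p) (hm : j ≤ m) :
    ∃ (s : K.X j ⟶ K.X i) (t : K.X k ⟶ K.X j), s ≫ K.d i j + K.d j k ≫ t = 𝟙 (K.X j) := by
  induction p generalizing i j k with
  | zero =>
    -- In the lowest degree the incoming differential has zero source, so the contraction can start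
    -- with `0`.
    have hi : IsZero (K.X i) := K.isZero_of_isStrictlyGE n i (by lia)
    exact ⟨0, exists_contraction_of_comp K i j k hij hjk (hK j hm) 0 (hi.eq_of_src _ _)⟩
  | succ p ih =>
    obtain ⟨s, t, h⟩ := ih (i - 1) i j (by lia) hij (by lia) (by lia)
    refine ⟨t, exists_contraction_of_comp K i j k hij hjk (hK j hm) t ?_⟩
    -- Followed by `d`, the relation one degree lower becomes `d t d = d`, the hypothesis for the
    -- next extension.
    have h' := congrArg (· ≫ K.d i j) h
    simpa using h'

/-- A bounded below complex of injective sheaves which is exact in degrees `≤ m` has exact sections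
in degrees `≤ m`. -/
lemma exists_dif_eq (K : CochainComplex (Sheaf J AddCommGrpCat.{max u v}) ℤ)
    [∀ i, Injective (K.X i)] (n : ℤ) [K.IsStrictlyGE n] (m : ℤ)
    (hK : ∀ i ≤ m, K.ExactAt i) (i j k : ℤ) (hij : i + 1 = j) (hjk : j + 1 = k) (hm : j ≤ m)
    {U : C} (x : sec K j U) (hx : dif K j k x = 0) : ∃ y : sec K i U, dif K i j y = x := by
  by_cases hj : j < n
  · exact ⟨0, (map_zero _).trans (eq_zero_of_isZero (K.isZero_of_isStrictlyGE n j hj) x).symm⟩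
  · obtain ⟨p, hp⟩ := Int.eq_ofNat_of_zero_le (a := j - n) (by lia)
    obtain ⟨s, t, h⟩ := exists_contraction K n m hK p i j k hij hjk (by lia) hm
    refine ⟨ev s U x, ?_⟩
    have h' := congrArg (fun φ => ev φ U x) h
    change ev (K.d i j) U (ev s U x) + ev t U (dif K j k x) = x at h'
    rw [hx, map_zero, add_zero] at h'
    exact h'

end Exactness

/-! ### Sections of mapping cones and local equivalences. -/

section Cone

variable {C : Type u} [Category.{v} C] {J : GrothendieckTopology C}

open CochainComplex

/-- A complex which is exact in two consecutive degrees `i`, `j` and vanishes in degree `i - 1`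
has exact sections in degree `j`. -/
lemma exists_dif_eq_of_isZero (K : CochainComplex (Sheaf J AddCommGrpCat.{max u v}) ℤ)
    (i j k : ℤ) (hij : i + 1 = j) (hjk : j + 1 = k) (h₀ : IsZero (K.X (i - 1)))
    (hi : K.ExactAt i) (hj : K.ExactAt j) {U : C} (x : sec K j U) (hx : dif K j k x = 0) :
    ∃ y : sec K i U, dif K i j y = x := by
  have h := (K.exactAt_iff' i j k (by simp; lia) (by simp; lia)).1 hj
  -- Exactness in degree `i` makes the differential out of `K.X i` a monomorphism, so left exactness
  -- of sections suffices and no term has to be injective.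
  have : Mono (K.sc' i j k).f :=
    ((K.exactAt_iff' (i - 1) i j (by simp) (by simp; lia)).1 hi).mono_g (h₀.eq_of_src _ _)
  have hmap := h.map_of_mono_of_preservesKernel (sectionsFunctor J U) this inferInstance
  exact (ShortComplex.ab_exact_iff _).1 hmap x hx

variable {K L : CochainComplex (Sheaf J AddCommGrpCat.{max u v}) ℤ} (ψ : K ⟶ L)

/-- The section of the mapping cone with components `a` and `-b`. -/
noncomputable def coneSec (j k : ℤ) (hjk : j + 1 = k) {U : C} (a : sec K k U) (b : sec L j U) :
    sec (mappingCone ψ) j U :=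
  ev ((mappingCone.inl ψ).v k j (by lia)) U a - ev ((mappingCone.inr ψ).f j) U b

lemma coneSec_res (j k : ℤ) (hjk : j + 1 = k) {U V : C} (l : V ⟶ U) (a : sec K k U)
    (b : sec L j U) : coneSec ψ j k hjk (res K l a) (res L l b) =
      res (mappingCone ψ) l (coneSec ψ j k hjk a b) :=
  (congrArg₂ (· - ·) (ev_res _ l a) (ev_res _ l b)).trans (map_sub (res (mappingCone ψ) l) _ _).symm

/-- The cone differential sends `a` to `ψ a` in the target and `-d a` in the source. With the second
component taken as `-b`, the cocycle condition becomes `d b = ψ a`, the shape in which 1-arrows and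
2-arrows between images under `ψ` occur. -/
lemma dif_coneSec (j k l : ℤ) (hjk : j + 1 = k) (hkl : k + 1 = l) {U : C} (a : sec K k U)
    (b : sec L j U) (ha : dif K k l a = 0) (hb : dif L j k b = mor ψ a) :
    dif (mappingCone ψ) j k (coneSec ψ j k hjk a b) = 0 := by
  have h₁ := congrArg (fun t => ev t U a)
    (mappingCone.inl_v_d ψ k j l (by lia) (by lia))
  have h₂ := congrArg (fun t => ev t U b) (mappingCone.inr_f_d ψ j k)
  change dif (mappingCone ψ) j k (ev ((mappingCone.inl ψ).v k j (by lia)) U a) =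
    ev ((mappingCone.inr ψ).f k) U (mor ψ a) -
      ev ((mappingCone.inl ψ).v l k (by lia)) U (dif K k l a) at h₁
  change dif (mappingCone ψ) j k (ev ((mappingCone.inr ψ).f j) U b) =
    ev ((mappingCone.inr ψ).f k) U (dif L j k b) at h₂
  rw [coneSec, map_sub, h₁, h₂, ha, hb, map_zero, sub_zero, sub_self]

/-- The two components of `c`, with signs reversed, are the required sections: the equation for `d
c` is read through the two projections of the cone. -/
lemma exists_of_dif_eq_coneSec (i j k : ℤ) (hij : i + 1 = j) (hjk : j + 1 = k) {U : C}
    (a : sec K k U) (b : sec L j U) (c : sec (mappingCone ψ) i U)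
    (hc : dif (mappingCone ψ) i j c = coneSec ψ j k hjk a b) :
    ∃ (a' : sec K j U) (b' : sec L i U), dif K j k a' = a ∧ mor ψ a' + dif L i j b' = b := by
  let F := (mappingCone.fst ψ).1.v i j hij
  let S := (mappingCone.snd ψ).v i i (add_zero i)
  have h₁ : ev ((mappingCone.fst ψ).1.v j k hjk) U (dif (mappingCone ψ) i j c) =
      - dif K j k (ev F U c) :=
    congrArg (fun t => ev t U c) (mappingCone.d_fst_v ψ i j k hij hjk)
  have h₂ : ev ((mappingCone.snd ψ).v j j (add_zero j)) U (dif (mappingCone ψ) i j c) =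
      mor ψ (ev F U c) + dif L i j (ev S U c) :=
    congrArg (fun t => ev t U c) (mappingCone.d_snd_v ψ i j hij)
  have e₁ : ev ((mappingCone.fst ψ).1.v j k hjk) U
      (ev ((mappingCone.inl ψ).v k j (by lia)) U a) = a :=
    congrArg (fun t => ev t U a) (mappingCone.inl_v_fst_v ψ k j hjk)
  have e₂ : ev ((mappingCone.snd ψ).v j j (add_zero j)) U
      (ev ((mappingCone.inl ψ).v k j (by lia)) U a) = 0 :=
    congrArg (fun t => ev t U a) (mappingCone.inl_v_snd_v ψ k j (by lia))
  have e₃ : ev ((mappingCone.fst ψ).1.v j k hjk) U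
      (ev ((mappingCone.inr ψ).f j) U b) = 0 :=
    congrArg (fun t => ev t U b) (mappingCone.inr_f_fst_v ψ j k hjk)
  have e₄ : ev ((mappingCone.snd ψ).v j j (add_zero j)) U
      (ev ((mappingCone.inr ψ).f j) U b) = b :=
    congrArg (fun t => ev t U b) (mappingCone.inr_f_snd_v ψ j)
  rw [hc, coneSec, map_sub] at h₁ h₂
  rw [e₁, e₃, sub_zero] at h₁
  rw [e₂, e₄, zero_sub] at h₂
  refine ⟨- ev F U c, - ev S U c, by rw [map_neg, h₁], ?_⟩
  rw [map_neg, map_neg, ← neg_add, ← h₂, neg_neg]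

lemma isZero_mappingCone_X [K.IsStrictlyGE (-2)] [L.IsStrictlyGE (-2)] (i : ℤ) (hi : i < -3) :
    IsZero ((mappingCone ψ).X i) :=
  (mappingCone.isZero_X_iff ψ i).2 ⟨K.isZero_of_isStrictlyGE (-2) _ (by lia),
    L.isZero_of_isStrictlyGE (-2) _ (by lia)⟩

/-- The 2-isomorphism that is given by a section of degree `-2`. -/
noncomputable def cellIso {X Y : Tot (secCat K).Obj} {f g : X ⟶ Y} (θ : sec K (-2) X.base)
    (h : (secCat K).proj f = (secCat K).proj g) (h' : dif K (-2) (-1) θ = av g - av f) : f ≅ g where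
  hom := mkCell θ h h'
  inv := mkCell (-θ) h.symm (by rw [map_neg, h', neg_sub])
  hom_inv_id := cv_ext (add_neg_cancel θ)
  inv_hom_id := cv_ext (neg_add_cancel θ)

/-- A morphism of complexes in degrees `≥ -2` which is an isomorphism in cohomology in
degrees `≤ 0` and injective in degree `1` induces a local equivalence. -/
lemma isLocalEquivalence_secMap [K.IsStrictlyGE (-2)] [L.IsStrictlyGE (-2)]
    (hψ : ∀ i ≤ 0, (mappingCone ψ).ExactAt i) : (secMap ψ).IsLocalEquivalence J where
  locally_essSurj {U} y := by
    -- An object `y` is the degree-0 cocycle of the cone with source component `0`; a local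
    -- primitive is an object of the source with a 1-arrow from its image to `y`.
    obtain ⟨R, hR, h⟩ := exactAt_exists_local (-1) 0 1 rfl rfl (hψ 0 le_rfl)
      (coneSec ψ 0 1 rfl 0 y.1) (dif_coneSec ψ 0 1 2 rfl rfl 0 y.1 (map_zero _)
        (y.2.trans (map_zero _).symm))
    refine ⟨R, hR, fun {V} k hk => ?_⟩
    obtain ⟨c, hc⟩ := h k hk
    rw [← coneSec_res, map_zero] at hc
    obtain ⟨a, b, ha, hb⟩ := exists_of_dif_eq_coneSec ψ (-1) 0 1 rfl rfl _ _ c hc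
    exact ⟨⟨a, ha⟩, mkArrow k b (eq_sub_of_add_eq' hb), rfl⟩
  locally_full {U x x'} g := by
    have hg := dif_av g.1
    rw [g.2, res_id] at hg
    -- A 1-arrow between images, together with the difference of the two objects, is a cocycle of
    -- degree -1; a local primitive is a 1-arrow of the source and a 2-arrow from its image.
    obtain ⟨R, hR, h⟩ := exactAt_exists_local (-2) (-1) 0 rfl rfl (hψ (-1) (by lia))
      (coneSec ψ (-1) 0 rfl (x'.1 - x.1) (av g.1)) (dif_coneSec ψ (-1) 0 1 rfl rfl _ _
        (by rw [map_sub, x'.2, x.2, sub_zero]) (hg.trans (map_sub _ _ _).symm))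
    refine ⟨R, hR, fun {V} k hk => ?_⟩
    obtain ⟨c, hc⟩ := h k hk
    rw [← coneSec_res] at hc
    obtain ⟨a, b, ha, hb⟩ := exists_of_dif_eq_coneSec ψ (-2) (-1) 0 rfl rfl _ _ c hc
    let z : (secCat K).Obj V := ⟨res K k x.1, by rw [dif_res, x.2, map_zero]⟩
    let z' : (secCat K).Obj V := ⟨res K k x'.1, by rw [dif_res, x'.2, map_zero]⟩
    refine ⟨z, z', mkArrow k 0 (by simp [z]), mkArrow k 0 (by simp [z']),
      ⟨mkArrow (𝟙 V) a (by rw [res_id, ha, map_sub]), rfl⟩, rfl, rfl, ⟨cellIso b ?_ ?_⟩⟩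
    · have h : (secCat L).proj g.1 = 𝟙 _ := g.2
      change 𝟙 V ≫ k = k ≫ (secCat L).proj g.1
      rw [h, id_comp, comp_id]
    · change dif L (-2) (-1) b = (mor ψ (0 : sec K (-1) V) + res L k (av g.1)) -
        (mor ψ a + res L (𝟙 V) (mor ψ (0 : sec K (-1) V)))
      rw [map_zero, map_zero, add_zero, zero_add, ← hb]
      abel
  bijective {U x x'} f f' := by
    refine ⟨fun η θ h => cv_ext ?_, fun η => ?_⟩
    · have h' : mor ψ (cv η) = mor ψ (cv θ) := congrArg cv h
      -- On 2-arrows the statement is global, and the cone vanishes below degree -3. The primitive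
      -- of the difference lies in degree -3 of `K`, which is zero.
      obtain ⟨c, hc⟩ := exists_dif_eq_of_isZero (mappingCone ψ) (-4) (-3) (-2) rfl rfl
        (isZero_mappingCone_X ψ _ (by lia)) (hψ _ (by lia)) (hψ _ (by lia))
        (coneSec ψ (-3) (-2) rfl (cv η - cv θ) 0) (dif_coneSec ψ (-3) (-2) (-1) rfl rfl _ _
          (by rw [map_sub, dif_cv, dif_cv, sub_self]) (by rw [map_zero, map_sub, h', sub_self]))
      obtain ⟨a, b, ha, hb⟩ := exists_of_dif_eq_coneSec ψ (-4) (-3) (-2) rfl rfl _ _ c hc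
      rw [eq_zero_of_isZero (K.isZero_of_isStrictlyGE (-2) (-3)) a, map_zero] at ha
      exact (sub_eq_zero.1 ha.symm)
    · let t : sec L (-2) U := cv η
      have ht : dif L (-2) (-1) t = mor ψ (av f'.1 - av f.1) :=
        (dif_cv η).trans (map_sub (mor ψ) _ _).symm
      have hf := dif_av f.1
      have hf' := dif_av f'.1
      rw [f.2, res_id] at hf
      rw [f'.2, res_id] at hf'
      -- The primitive has a component in degree -2 of `K`, the preimage of the 2-arrow; the
      -- component in degree -3 of `L` vanishes, so its image is the given 2-arrow exactly.
      obtain ⟨c, hc⟩ := exists_dif_eq_of_isZero (mappingCone ψ) (-3) (-2) (-1) rfl rfl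
        (isZero_mappingCone_X ψ _ (by lia)) (hψ _ (by lia)) (hψ _ (by lia))
        (coneSec ψ (-2) (-1) rfl (av f'.1 - av f.1) t) (dif_coneSec ψ (-2) (-1) 0 rfl rfl _ _
          (by rw [map_sub, hf, hf', sub_self]) ht)
      obtain ⟨a, b, ha, hb⟩ := exists_of_dif_eq_coneSec ψ (-3) (-2) (-1) rfl rfl _ _ c hc
      rw [eq_zero_of_isZero (L.isZero_of_isStrictlyGE (-2) (-3)) b, map_zero, add_zero] at hb
      exact ⟨mkCell a (f.2.trans f'.2.symm) ha, cv_ext hb⟩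

end Cone

/-! ### Cones, quasi-isomorphisms and K-injective complexes. -/

section HomologicalAlgebra

open CochainComplex HomologicalComplex Pretriangulated

variable {A : Type u} [Category.{v} A] [Abelian A]

/-- In the long exact sequence, the homology of the cone in degree `i` lies between the homology of
`L` in degree `i` and that of `K` in degree `j`; the epimorphism makes the incoming map zero and the
monomorphism the outgoing one. -/
lemma exactAt_mappingCone {K L : CochainComplex A ℤ} (ψ : K ⟶ L) (i j : ℤ) (hij : i + 1 = j)
    [Epi (homologyMap ψ i)] [Mono (homologyMap ψ j)] : (mappingCone ψ).ExactAt i := by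
  let F := HomotopyCategory.homologyFunctor A (ComplexShape.up ℤ)
  have hT := HomotopyCategory.mappingCone_triangleh_distinguished ψ
  have e := fun n => NatIso.naturality_1 (HomotopyCategory.homologyFunctorFactors A (.up ℤ) n) ψ
  -- The long exact sequence lives on the homotopy category; the hypotheses are carried there by the
  -- comparison with homology of complexes.
  have h₁ : Epi ((F 0 |>.shift i).map (mappingCone.triangleh ψ).mor₁) :=
    (MorphismProperty.epimorphisms A).arrow_mk_iso_iff
      (Arrow.isoMk ((HomotopyCategory.homologyFunctorFactors A (.up ℤ) i).app K)
        ((HomotopyCategory.homologyFunctorFactors A (.up ℤ) i).app L)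
        ((HomotopyCategory.homologyFunctorFactors A (.up ℤ) i).hom.naturality ψ).symm) |>.2
      (inferInstanceAs (Epi (homologyMap ψ i)))
  have h₂ : Mono ((F 0 |>.shift j).map (mappingCone.triangleh ψ).mor₁) :=
    (MorphismProperty.monomorphisms A).arrow_mk_iso_iff
      (Arrow.isoMk ((HomotopyCategory.homologyFunctorFactors A (.up ℤ) j).app K)
        ((HomotopyCategory.homologyFunctorFactors A (.up ℤ) j).app L)
        ((HomotopyCategory.homologyFunctorFactors A (.up ℤ) j).hom.naturality ψ).symm) |>.2
      (inferInstanceAs (Mono (homologyMap ψ j)))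
  have h := ((F 0).homologySequence_exact₃ _ hT i j hij).isZero_X₂_iff.2
    ⟨((F 0).homologySequence_epi_shift_map_mor₁_iff _ hT i).1 h₁,
      ((F 0).homologySequence_mono_shift_map_mor₁_iff _ hT i j hij).1 h₂⟩
  rw [exactAt_iff_isZero_homology]
  exact ((HomotopyCategory.homologyFunctorFactors A (.up ℤ) i).app _).isZero_iff.1 h

lemma exactAt_mappingCone_of_quasiIso {K L : CochainComplex A ℤ} (ψ : K ⟶ L) [QuasiIso ψ] (i : ℤ) :
    (mappingCone ψ).ExactAt i :=
  exactAt_mappingCone ψ i (i + 1) rfl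

/-- An additive functor carries the biproduct decomposition along, so the inverse is assembled from
the inverses on the summands. Only the images under `F` need be invertible, which is the situation
of homology and quasi-isomorphisms. -/
lemma isIso_map_biprod_map {D : Type*} [Category* D] [Preadditive D] (F : A ⥤ D) [F.Additive]
    {X X' Y Y' : A} (f : X ⟶ Y) (g : X' ⟶ Y') [IsIso (F.map f)] [IsIso (F.map g)] :
    IsIso (F.map (biprod.map f g)) := by
  refine ⟨F.map biprod.fst ≫ inv (F.map f) ≫ F.map biprod.inl +
    F.map biprod.snd ≫ inv (F.map g) ≫ F.map biprod.inr, ?_, ?_⟩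
  · simp only [Preadditive.comp_add, ← Functor.map_comp_assoc, biprod.map_fst, biprod.map_snd]
    simp only [Functor.map_comp, Category.assoc, IsIso.hom_inv_id_assoc]
    rw [← Functor.map_comp, ← Functor.map_comp, ← Functor.map_add, biprod.total, CategoryTheory.Functor.map_id]
  · simp only [Preadditive.add_comp, Category.assoc, ← Functor.map_comp, biprod.inl_map,
      biprod.inr_map]
    simp only [Functor.map_comp, IsIso.inv_hom_id_assoc]
    rw [← Functor.map_comp, ← Functor.map_comp, ← Functor.map_add, biprod.total, CategoryTheory.Functor.map_id]

instance quasiIso_biprod_map {K K' L L' : CochainComplex A ℤ} (f : K ⟶ L) (g : K' ⟶ L')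
    [QuasiIso f] [QuasiIso g] : QuasiIso (biprod.map f g) where
  quasiIsoAt i := by
    rw [quasiIsoAt_iff_isIso_homologyMap]
    have : IsIso ((homologyFunctor A (.up ℤ) i).map f) := inferInstanceAs (IsIso (homologyMap f i))
    have : IsIso ((homologyFunctor A (.up ℤ) i).map g) := inferInstanceAs (IsIso (homologyMap g i))
    exact isIso_map_biprod_map (homologyFunctor A (.up ℤ) i) f g

-- In the derived category the two cones complete `φ₁` and `φ₂` to distinguished triangles, and a
-- morphism of triangles that is invertible at two vertices is invertible at the third.
attribute [local instance] HasDerivedCategory.standard in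
lemma quasiIso_mapOfHomotopy {K₁ L₁ K₂ L₂ : CochainComplex A ℤ} {φ₁ : K₁ ⟶ L₁} {φ₂ : K₂ ⟶ L₂}
    {a : K₁ ⟶ K₂} {b : L₁ ⟶ L₂} (H : Homotopy (φ₁ ≫ b) (a ≫ φ₂)) [QuasiIso a] [QuasiIso b] :
    QuasiIso (mappingCone.mapOfHomotopy H) := by
  have hQ {K L : CochainComplex A ℤ} (φ : K ⟶ L) :
      IsIso (DerivedCategory.Qh.map ((HomotopyCategory.quotient A (.up ℤ)).map φ)) ↔
        QuasiIso φ :=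
    (NatIso.isIso_map_iff (DerivedCategory.quotientCompQhIso A) φ).trans
      (DerivedCategory.isIso_Q_map_iff_quasiIso A φ)
  rw [← hQ]
  exact isIso₃_of_isIso₁₂ (DerivedCategory.Qh.mapTriangle.map (mappingCone.trianglehMapOfHomotopy H))
    (DerivedCategory.Qh.map_distinguished _
      (HomotopyCategory.mappingCone_triangleh_distinguished φ₁))
    (DerivedCategory.Qh.map_distinguished _
      (HomotopyCategory.mappingCone_triangleh_distinguished φ₂))
    ((hQ a).2 inferInstance) ((hQ b).2 inferInstance)

/-- Homotopy classes of maps to a K-injective complex are local with respect to quasi-isomorphisms,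
so precomposition with `s` is bijective on them; its surjectivity provides `ψ`. -/
lemma exists_lift_of_isKInjective {K I F : CochainComplex A ℤ} [F.IsKInjective] (s : K ⟶ I)
    [QuasiIso s] (t : K ⟶ F) : ∃ ψ : I ⟶ F, Nonempty (Homotopy (s ≫ ψ) t) := by
  have h : (HomotopyCategory.subcategoryAcyclic A).trW.isLocal
      ((HomotopyCategory.quotient A (.up ℤ)).obj F) := by
    rw [ObjectProperty.isLocal_trW]
    exact CochainComplex.IsKInjective.rightOrthogonal F
  have hs : (HomotopyCategory.subcategoryAcyclic A).trW
      ((HomotopyCategory.quotient A (.up ℤ)).map s) := by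
    rw [← HomotopyCategory.quasiIso_eq_trW_subcategoryAcyclic,
      HomotopyCategory.quotient_map_mem_quasiIso_iff]
    exact inferInstanceAs (QuasiIso s)
  obtain ⟨ψ, hψ⟩ := (h _ hs).surjective ((HomotopyCategory.quotient A (.up ℤ)).map t)
  obtain ⟨ψ, rfl⟩ := (HomotopyCategory.quotient A (.up ℤ)).map_surjective ψ
  exact ⟨ψ, ⟨HomotopyCategory.homotopyOfEq _ _ (by simpa using hψ)⟩⟩

/-- The square of differences of two squares that commute up to homotopy. -/
noncomputable def homotopyBiprodDesc {K K' L L' P Q : CochainComplex A ℤ} {f : K ⟶ P} {g : L ⟶ P}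
    {f' : K' ⟶ Q} {g' : L' ⟶ Q} {a : K ⟶ K'} {b : L ⟶ L'} {c : P ⟶ Q}
    (hf : Homotopy (a ≫ f') (f ≫ c)) (hg : Homotopy (b ≫ g') (g ≫ c)) :
    Homotopy (biprod.desc f (-g) ≫ c) (biprod.map a b ≫ biprod.desc f' (-g')) :=
  (Homotopy.ofEq (by apply biprod.hom_ext' <;> simp)).trans
    (((hf.symm.compLeft biprod.fst).add (hg.compLeft (-biprod.snd)).symm).trans
      (Homotopy.ofEq (by apply biprod.hom_ext' <;> simp)))

/-- A resolution of the truncation of a shifted complex maps to a shifted injective resolution of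
the complex by an isomorphism in cohomology in degrees `≤ 0`. -/
lemma exists_hom_exactAt_mappingCone {G F I : CochainComplex A ℤ} (e : G ⟶ F) [QuasiIso e] (n : ℤ)
    [(F⟦n⟧).IsKInjective] (s : (G⟦n⟧).truncLE 0 ⟶ I) [QuasiIso s] :
    ∃ ψ : I ⟶ F⟦n⟧, ∀ i ≤ 0, (mappingCone ψ).ExactAt i := by
  -- The inclusion of the truncation, followed by the shift of `e`, is extended along the resolution
  -- `s`.
  obtain ⟨ψ, ⟨h⟩⟩ := exists_lift_of_isKInjective s ((G⟦n⟧).ιTruncLE 0 ≫ e⟦n⟧')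
  refine ⟨ψ, fun i hi => ?_⟩
  -- In degrees `≤ 0` the inclusion of the truncation is an isomorphism on homology, as are `s` and
  -- the shift of `e`, hence so is `ψ`.
  have hψ (j : ℤ) (hj : j ≤ 0) : IsIso (homologyMap ψ j) := by
    have := (G⟦n⟧).quasiIsoAt_ιTruncLE 0 j hj
    have h' := h.homologyMap_eq j
    rw [homologyMap_comp, homologyMap_comp] at h'
    have : IsIso (homologyMap s j ≫ homologyMap ψ j) := by
      rw [h']; infer_instance
    exact IsIso.of_isIso_comp_left (homologyMap s j) _
  have := hψ i hi
  have : Mono (homologyMap ψ (i + 1)) := by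
    obtain hi | rfl := hi.lt_or_eq
    · have := hψ (i + 1) (by lia)
      infer_instance
    -- Exactness at 0 asks for injectivity in degree 1. There `F⟦n⟧` may have homology, but the
    -- truncated complex, and so `I`, has none.
    · have h₀ : IsZero (((G⟦n⟧).truncLE 0).homology 1) :=
        ((G⟦n⟧).truncLE 0).isZero_of_isLE 0 1
      exact ((asIso (homologyMap s 1)).isZero_iff.1 h₀).mono _
  exact exactAt_mappingCone ψ i (i + 1) rfl

end HomologicalAlgebra

/-! ### The additive 2-functor defined by a square that commutes up to homotopy. -/

noncomputable section FibredProductMap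

variable {C : Type u} [Category.{v} C] {J : GrothendieckTopology C}
  {E K L M : CochainComplex (Sheaf J AddCommGrpCat.{max u v}) ℤ} {φ : K ⟶ M} {γ : L ⟶ M}

lemma Homotopy.mor_sub_mor {σ τ : E ⟶ M} (H : Homotopy σ τ) (i j k : ℤ) (hij : i + 1 = j)
    (hjk : j + 1 = k) {U : C} (x : sec E j U) :
    mor σ x - mor τ x = ev (H.hom k j) U (dif E j k x) + dif M i j (ev (H.hom j i) U x) := by
  have h := congrArg (fun t => ev t U x) (H.comm j)
  rw [dNext_eq H.hom (show (ComplexShape.up ℤ).Rel j k from hjk),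
    prevD_eq H.hom (show (ComplexShape.up ℤ).Rel i j from hij)] at h
  exact sub_eq_of_eq_add h

variable {α : E ⟶ K} {β : E ⟶ L} (H : Homotopy (β ≫ γ) (α ≫ φ))

/-- `x ↦ (α x, h x, β x)` on objects, where `h` is the homotopy. -/
def prodMapObj {U : C} (x : IntObj E U) : (secProd φ γ).Obj U where
  fst := morObj α x
  snd := morObj β x
  link := ⟨mkArrow (𝟙 U) (ev (H.hom 0 (-1)) U x.1) (by
    have h := H.mor_sub_mor (-1) 0 1 rfl rfl x.1
    rw [x.2, map_zero, zero_add] at h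
    rw [res_id]
    exact h.symm), rfl⟩

variable {X Y Z : Tot (secCat E).Obj}

/-- `m ↦ (α m, h m, β m)` on 1-arrows. -/
def prodMapArrow (f : X ⟶ Y) : (Tot.mk X.base (prodMapObj H X.pt) : Tot (secProd φ γ).Obj) ⟶
    Tot.mk Y.base (prodMapObj H Y.pt) :=
  mkProdArrow ((secCat E).proj f) (mor α (av f)) (mor β (av f)) (ev (H.hom (-1) (-2)) _ (av f))
    (dif_av (morArrow α f)) (dif_av (morArrow β f)) (by
      have h := H.mor_sub_mor (-2) (-1) 0 rfl rfl (av f)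
      have e := ev_res (H.hom 0 (-1)) ((secCat E).proj f) Y.pt.1
      change ev _ _ (res E _ _) = res M _ _ at e
      rw [dif_av, map_sub, e] at h
      change dif M (-2) (-1) _ = (ev (H.hom 0 (-1)) _ X.pt.1 + mor γ (mor β (av f))) -
        (mor φ (mor α (av f)) + res M _ (ev (H.hom 0 (-1)) _ Y.pt.1))
      change mor γ (mor β (av f)) - mor φ (mor α (av f)) = _ at h
      linear_combination (norm := abel) -h)

lemma lv_prodMapArrow (f : X ⟶ Y) : lv (prodMapArrow H f) = ev (H.hom (-1) (-2)) _ (av f) := rfl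

def prodMapComp (f : X ⟶ Y) (g : Y ⟶ Z) :
    prodMapArrow H (f ≫ g) ≅ prodMapArrow H f ≫ prodMapArrow H g :=
  mkProdIso rfl ((map_add _ _ _).trans (congrArg (_ + ·) (mor_res _ _ _)))
    (((map_add (mor β) _ _).trans (congrArg (_ + ·)
      (mor_res β ((secCat E).proj f) (av g)))).trans
      (av_p₂_comp (prodMapArrow H f) (prodMapArrow H g)).symm)
    (((map_add (ev (H.hom (-1) (-2)) X.base) _ _).trans ((congrArg (_ + ·)
      (ev_res (H.hom (-1) (-2)) ((secCat E).proj f) (av g))).trans (add_comm _ _))).trans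
      (lv_comp (prodMapArrow H f) (prodMapArrow H g)).symm)

lemma Cz.mapComp (f : X ⟶ Y) (g : Y ⟶ Z) : Cz (prodMapComp H f g).hom := ⟨rfl, rfl⟩

def prodMapId (X : Tot (secCat E).Obj) :
    prodMapArrow H (𝟙 X) ≅ 𝟙 (Tot.mk X.base (prodMapObj H X.pt) : Tot (secProd φ γ).Obj) :=
  mkProdIso rfl (map_zero _) (map_zero _)
    ((map_zero (ev (H.hom (-1) (-2)) X.base)).trans
      (lv_id (X := Tot.mk X.base (prodMapObj H X.pt))).symm)

variable [M.IsStrictlyGE (-2)]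

/-- In degree -2 the summand `d h` of the homotopy formula passes through `M.X (-3)`, which is zero.
What is left is the compatibility that makes the pair `(α θ, β θ)` a 2-arrow. -/
lemma Homotopy.ev_dif (U : C) (x : sec E (-2) U) :
    ev (H.hom (-1) (-2)) U (dif E (-2) (-1) x) = mor γ (mor β x) - mor φ (mor α x) := by
  have h := H.mor_sub_mor (-3) (-2) (-1) rfl rfl x
  rw [eq_zero_of_isZero (M.isZero_of_isStrictlyGE (-2) (-3)) (ev (H.hom (-2) (-3)) U x), map_zero,
    add_zero] at h
  exact h.symm

/-- `θ ↦ (α θ, β θ)` on 2-arrows. -/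
def prodMapCell {f g : X ⟶ Y} (η : f ⟶ g) : prodMapArrow H f ⟶ prodMapArrow H g :=
  mkProdCell (mor α (cv η)) (mor β (cv η))
    (show (secCat E).proj f = (secCat E).proj g from (secCat E).proj_eq η)
    (dif_cv (morCell α η)) (dif_cv (morCell β η)) (by
      have h := Homotopy.ev_dif H X.base (cv η)
      rw [dif_cv, map_sub] at h
      rw [lv_prodMapArrow, lv_prodMapArrow]
      linear_combination (norm := abel) h)

/-- The 2-functor to a fibered product that is induced by a square of morphisms of complexes which
commutes up to homotopy. -/
def prodMap : FibFunctor (secCat E) (secProd φ γ) where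
  obj := prodMapObj H
  map := prodMapArrow H
  proj_map f := rfl
  map₂ := prodMapCell H
  mapId := prodMapId H
  mapComp := prodMapComp H
  map₂_id f := q_ext (map_zero _) (map_zero _)
  map₂_comp η θ := q_ext (map_add _ _ _) (map_add _ _ _)
  map₂_whisker_left f _ _ η := q_ext
    (by
      rw [cv_q₁_comp, cv_q₁_comp, (Cz.mapComp H _ _).1, (Cz.inv (Cz.mapComp H _ _)).1,
        add_zero, zero_add]
      exact mor_res _ _ _)
    (by
      rw [cv_q₂_comp, cv_q₂_comp, (Cz.mapComp H _ _).2, (Cz.inv (Cz.mapComp H _ _)).2,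
        add_zero, zero_add, cv_q₂_left]
      exact mor_res _ _ _)
  map₂_whisker_right η h := q_ext
    (by
      rw [cv_q₁_comp, cv_q₁_comp, (Cz.mapComp H _ _).1, (Cz.inv (Cz.mapComp H _ _)).1,
        add_zero, zero_add]
      rfl)
    (by
      rw [cv_q₂_comp, cv_q₂_comp, (Cz.mapComp H _ _).2, (Cz.inv (Cz.mapComp H _ _)).2,
        add_zero, zero_add]
      rfl)
  map₂_associator f g h := Cz.ext ⟨map_zero (mor α (i := -2)), map_zero (mor β (i := -2))⟩
    (Cz.comp (Cz.mapComp H _ _) (Cz.comp (Cz.right _ (Cz.mapComp H _ _))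
      (Cz.comp (Cz.ahom _ _ _) (Cz.comp (Cz.left _ (Cz.inv (Cz.mapComp H _ _)))
        (Cz.inv (Cz.mapComp H _ _))))))
  map₂_left_unitor f := Cz.ext ⟨map_zero (mor α (i := -2)), map_zero (mor β (i := -2))⟩
    (Cz.comp (Cz.mapComp H _ _) (Cz.comp (Cz.right _ ⟨rfl, rfl⟩) (Cz.lhom _)))
  map₂_right_unitor f := Cz.ext ⟨map_zero (mor α (i := -2)), map_zero (mor β (i := -2))⟩
    (Cz.comp (Cz.mapComp H _ _) (Cz.comp (Cz.left _ ⟨rfl, rfl⟩) (Cz.rhom _)))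

lemma Az.map {f : X ⟶ Y} (h : av f = 0) : Az ((prodMap H).map f) where
  fst := (congrArg (mor α) h).trans (map_zero _)
  snd := (congrArg (mor β) h).trans (map_zero _)
  link := (congrArg (ev (H.hom (-1) (-2)) _) h).trans (map_zero _)

lemma Cz.map {f g : X ⟶ Y} {η : f ⟶ g} (h : cv η = 0) : Cz ((prodMap H).map₂ η) :=
  ⟨(congrArg (mor α) h).trans (map_zero _), (congrArg (mor β) h).trans (map_zero _)⟩

section
variable {D : FibTwoCat.{v, u, w, a, b} C}

lemma Cz.map_id (F : FibFunctor D (secCat E)) {X : Tot D.Obj} (h : cv (F.mapId X).hom = 0) :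
    Cz ((F.comp (prodMap H)).mapId X).hom :=
  Cz.comp (Cz.map H h) ⟨rfl, rfl⟩

lemma Cz.map_comp (F : FibFunctor D (secCat E)) {X Y Z : Tot D.Obj} (f : X ⟶ Y) (g : Y ⟶ Z)
    (h : cv (F.mapComp f g).hom = 0) : Cz ((F.comp (prodMap H)).mapComp f g).hom :=
  Cz.comp (Cz.map H h) (Cz.mapComp H _ _)

lemma Az.postcomp {F G : FibFunctor D (secCat E)} {s : PreTrans F G} {U : C} (x : D.Obj U)
    (h : av (s.app x) = 0) : Az ((s.postcomp (prodMap H)).app x) := Az.map H h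

lemma Cz.postcomp {F G : FibFunctor D (secCat E)} {s : PreTrans F G} {X Y : Tot D.Obj} (f : X ⟶ Y)
    (h : cv (s.nat f).hom = 0) : Cz ((s.postcomp (prodMap H)).nat f).hom :=
  Cz.comp (Cz.inv (Cz.mapComp H _ _)) (Cz.comp (Cz.map H h) (Cz.mapComp H _ _))

end

/-- The two maps and the homotopy are additive on sections, so the structure transformation can be
given by zero coordinates. -/
def prodMapData : AdditiveData (secData E) (prodData φ γ) (prodMap H) where
  lam := prodZeroTrans (fun _ => (map_add _ _ _).symm) (fun _ => (map_add _ _ _).symm)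
    (fun _ => (map_add _ _ _).symm) (fun _ => (map_add _ _ _).symm)
    (fun _ => (map_add _ _ _).symm) (fun _ => (map_add _ _ _).symm)
    (fun _ => (map_add _ _ _).symm) (fun _ => (map_add _ _ _).symm)
    (fun _ => Cz.tens_id (Cz.map_id H _ rfl) (Cz.map_id H _ rfl))
    (fun _ => Cz.map_id H (secTensor E) rfl)
    (fun f g => Cz.tens_comp f g (Cz.map_comp H _ f g rfl) (Cz.map_comp H _ f g rfl))
    (fun f g => Cz.map_comp H (secTensor E) f g (cv_addComp f g))

def prodMapCon : AdditiveConstraints (prodMapData H) where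
  muAssoc := prodZeroMod
    (fun x => Az.vcomp x (az_asc x) (Az.vcomp x (Az.ten x (Az.pid x) ⟨rfl, rfl, rfl⟩)
      ⟨rfl, rfl, rfl⟩))
    (fun x => Az.vcomp x (Az.ten x ⟨rfl, rfl, rfl⟩ (Az.pid x))
      (Az.vcomp x ⟨rfl, rfl, rfl⟩ (Az.postcomp H x rfl)))
    (fun f => Cz.vcomp f (zz_asc f) (Cz.vcomp f (Cz.ten f (Cz.pid f) ⟨rfl, rfl⟩) ⟨rfl, rfl⟩))
    (fun f => Cz.vcomp f (Cz.ten f ⟨rfl, rfl⟩ (Cz.pid f))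
      (Cz.vcomp f ⟨rfl, rfl⟩ (Cz.postcomp H f rfl)))
  muAssocInv := prodZeroMod
    (fun x => Az.vcomp x (az_ascInv x) (Az.vcomp x (Az.ten x ⟨rfl, rfl, rfl⟩ (Az.pid x))
      ⟨rfl, rfl, rfl⟩))
    (fun x => Az.vcomp x (Az.ten x (Az.pid x) ⟨rfl, rfl, rfl⟩)
      (Az.vcomp x ⟨rfl, rfl, rfl⟩ (Az.postcomp H x rfl)))
    (fun f => Cz.vcomp f (zz_ascInv f) (Cz.vcomp f (Cz.ten f ⟨rfl, rfl⟩ (Cz.pid f)) ⟨rfl, rfl⟩))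
    (fun f => Cz.vcomp f (Cz.ten f (Cz.pid f) ⟨rfl, rfl⟩)
      (Cz.vcomp f ⟨rfl, rfl⟩ (Cz.postcomp H f rfl)))
  muBraid := prodZeroMod
    (fun x => Az.vcomp x (az_braid x) ⟨rfl, rfl, rfl⟩)
    (fun x => Az.vcomp x ⟨rfl, rfl, rfl⟩ (Az.postcomp H x rfl))
    (fun f => Cz.vcomp f (zz_braid f) ⟨rfl, rfl⟩)
    (fun f => Cz.vcomp f ⟨rfl, rfl⟩ (Cz.postcomp H f rfl))

/-- All the building blocks of the comparison have zero coordinates, and composition, whiskering and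
tensor preserve this. Both sides of the coherence law are then parallel 2-arrows with zero
coordinates, hence equal. -/
lemma Cz.mu {ι : Type} {U : C} (x : ι → (secCat E).Obj U) {p q : Word ι} (f : FormalArrow p q) :
    Cz ((prodMapCon H).mu x f).hom := by
  induction f with
  | one p => exact Cz.comp ⟨rfl, rfl⟩ (Cz.comp ⟨rfl, rfl⟩ (Cz.left _ (Cz.inv ⟨rfl, rfl⟩)))
  | comp f g ih ih' =>
    exact Cz.comp ⟨rfl, rfl⟩ (Cz.comp (Cz.left _ ih') (Cz.comp ⟨rfl, rfl⟩ (Cz.comp (Cz.right _ ih)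
      (Cz.comp ⟨rfl, rfl⟩ (Cz.left _ (Cz.inv (Cz.mapComp H _ _)))))))
  | tensor f g ih ih' =>
    exact Cz.comp ⟨rfl, rfl⟩ (Cz.comp (Cz.right _ (Cz.comp (Cz.inv (Cz.add _ _))
      (Cz.comp (Cz.addCell ih ih') (Cz.add _ _)))) (Cz.comp ⟨rfl, rfl⟩
        (Cz.comp (Cz.left _ ⟨rfl, rfl⟩) ⟨rfl, rfl⟩)))
  | assoc p q r =>
    exact Cz.comp (Cz.left _ (Cz.comp (Cz.right _ (Cz.comp (Cz.addCell (Cz.inv ⟨rfl, rfl⟩)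
      ⟨rfl, rfl⟩) (Cz.add _ _))) ⟨rfl, rfl⟩)) (Cz.comp ⟨rfl, rfl⟩ (Cz.comp (Cz.right _
        (Cz.inv ⟨rfl, rfl⟩)) (Cz.comp ⟨rfl, rfl⟩ (Cz.comp (Cz.left _ ⟨rfl, rfl⟩)
          (Cz.comp ⟨rfl, rfl⟩ (Cz.comp (Cz.right _ (Cz.inv (Cz.comp (Cz.addCell ⟨rfl, rfl⟩
            (Cz.inv ⟨rfl, rfl⟩)) (Cz.add _ _)))) ⟨rfl, rfl⟩))))))
  | assocInv p q r =>
    exact Cz.comp (Cz.left _ (Cz.comp (Cz.right _ (Cz.comp (Cz.addCell ⟨rfl, rfl⟩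
      (Cz.inv ⟨rfl, rfl⟩)) (Cz.add _ _))) ⟨rfl, rfl⟩)) (Cz.comp ⟨rfl, rfl⟩ (Cz.comp (Cz.right _
        (Cz.inv ⟨rfl, rfl⟩)) (Cz.comp ⟨rfl, rfl⟩ (Cz.comp (Cz.left _ ⟨rfl, rfl⟩)
          (Cz.comp ⟨rfl, rfl⟩ (Cz.comp (Cz.right _ (Cz.inv (Cz.comp (Cz.addCell
            (Cz.inv ⟨rfl, rfl⟩) ⟨rfl, rfl⟩) (Cz.add _ _)))) ⟨rfl, rfl⟩))))))
  | braid p q =>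
    exact Cz.comp ⟨rfl, rfl⟩ (Cz.comp (Cz.right _ (Cz.inv ⟨rfl, rfl⟩)) (Cz.comp ⟨rfl, rfl⟩
      (Cz.comp (Cz.left _ ⟨rfl, rfl⟩) ⟨rfl, rfl⟩)))

/-- The additive 2-functor to a fibered product that is induced by a square of morphisms of
complexes which commutes up to homotopy. -/
def prodMapAdditive : AdditiveFunctor (secPicard E) (prodPicard φ γ) where
  functor := prodMap H
  data := prodMapData H
  con := prodMapCon H
  coherence x _ _ f g s := Cz.ext
    (Cz.comp (Cz.right _ (prodCon_eval _ s)) (Cz.mu H x g))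
    (Cz.comp (Cz.mu H x f) (Cz.left _ (Cz.map H (secCon_eval E x s))))

end FibredProductMap

/-! ### The homotopy fibre product and its sections as triples. -/

section Cocone

open CochainComplex CochainComplex.HomComplex

/-- The second projection is, up to sign, a null homotopy of `fst ≫ χ`; it will supply the homotopy
of the universal square. -/
lemma CochainComplex.mappingCocone.δ_snd {A : Type*} [Category* A] [Preadditive A]
    [HasBinaryBiproducts A] {K L : CochainComplex A ℤ} (χ : K ⟶ L) :
    δ (-1) 0 (mappingCocone.snd χ) = - Cochain.ofHom (mappingCocone.fst χ ≫ χ) := by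
  -- A cochain on the cocone is determined by its restrictions to the two summands, here zero and
  -- the identity; the differential of cochains given in this way is known.
  have h : mappingCocone.snd χ =
      mappingCocone.descCochain χ 0 (Cochain.ofHom (𝟙 L)) (neg_add_cancel 1) := by
    ext p q hpq
    rw [← cancel_epi (𝟙 _), ← mappingCocone.id_X χ p q hpq]
    simp [Preadditive.add_comp, mappingCocone.inr_v_descCochain_v χ 0 (Cochain.ofHom (𝟙 L))
      (neg_add_cancel 1) q p (by lia) q hpq]
  rw [h, mappingCocone.δ_descCochain _ _ _ _ 1 (zero_add 1)]
  simp [Cochain.ofHom_comp]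

section
variable {A : Type*} [Category* A] [Abelian A] {K L : CochainComplex A ℤ}

lemma injective_mappingCone_X (ψ : K ⟶ L) [∀ i, Injective (K.X i)] [∀ i, Injective (L.X i)]
    (i : ℤ) : Injective ((mappingCone ψ).X i) :=
  Injective.of_iso (HomologicalComplex.homotopyCofiber.XIsoBiprod ψ i (i + 1) rfl).symm
    inferInstance

instance isStrictlyGE_biprod (n : ℤ) [K.IsStrictlyGE n] [L.IsStrictlyGE n] :
    (K ⊞ L).IsStrictlyGE n := by
  rw [isStrictlyGE_iff]
  exact fun i hi => IsZero.of_iso ((biprod_isZero_iff _ _).2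
    ⟨K.isZero_of_isStrictlyGE n i, L.isZero_of_isStrictlyGE n i⟩)
    (HomologicalComplex.biprodXIso K L i)

end

variable {C : Type u} [Category.{v} C] {J : GrothendieckTopology C}
  {E K L M : CochainComplex (Sheaf J AddCommGrpCat.{max u v}) ℤ}

section
variable (φ : K ⟶ M) (γ : L ⟶ M)

/-- The homotopy fibre product of complexes. -/
noncomputable abbrev homotopyFibre : CochainComplex (Sheaf J AddCommGrpCat.{max u v}) ℤ :=
  mappingCocone (biprod.desc φ (-γ))

namespace homotopyFibre

/-- The first projection of a homotopy fibre product. -/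
noncomputable def fst : homotopyFibre φ γ ⟶ K := mappingCocone.fst _ ≫ biprod.fst

/-- The second projection of a homotopy fibre product. -/
noncomputable def snd : homotopyFibre φ γ ⟶ L := mappingCocone.fst _ ≫ biprod.snd

/-- The component of a homotopy fibre product in the target. -/
noncomputable def link (j i : ℤ) (hij : i + 1 = j) : (homotopyFibre φ γ).X j ⟶ M.X i :=
  (mappingCocone.snd (biprod.desc φ (-γ))).v j i (by lia)

/-- The square of a homotopy fibre product commutes up to homotopy. -/
noncomputable def homotopy : Homotopy (snd φ γ ≫ γ) (fst φ γ ≫ φ) :=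
  (Cochain.equivHomotopy _ _).symm ⟨mappingCocone.snd (biprod.desc φ (-γ)), by
    -- The map `desc φ (-γ)` is the difference of `φ` on the first component and `γ` on the second;
    -- the sign of `δ_snd` reverses it into the difference of the two sides of the square.
    rw [mappingCocone.δ_snd, ← Cochain.ofHom_neg, ← Cochain.ofHom_add]
    congr 1
    simp [fst, snd, biprod.desc_eq]⟩

lemma homotopy_hom (j i : ℤ) (hij : i + 1 = j) : (homotopy φ γ).hom j i = link φ γ j i hij :=
  dif_pos (by lia)

variable {φ γ}

section
variable (j i : ℤ) (hij : i + 1 = j)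

/-- The identity is the sum of the three projections followed by the inclusions: in degree `j` the
homotopy fibre product is `K.X j ⊕ L.X j ⊕ M.X i`. -/
lemma total : (fst φ γ).f j ≫ (biprod.inl : K ⟶ K ⊞ L).f j ≫
      (mappingCocone.inl (biprod.desc φ (-γ))).v j j (add_zero j) +
    (snd φ γ).f j ≫ (biprod.inr : L ⟶ K ⊞ L).f j ≫
      (mappingCocone.inl (biprod.desc φ (-γ))).v j j (add_zero j) +
    link φ γ j i hij ≫ (mappingCocone.inr (biprod.desc φ (-γ))).1.v i j hij = 𝟙 _ := by
  have h := congrArg (fun t : K ⊞ L ⟶ K ⊞ L => t.f j) (biprod.total (X := K) (Y := L))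
  simp only [HomologicalComplex.add_f_apply, HomologicalComplex.comp_f,
    HomologicalComplex.id_f] at h
  rw [← mappingCocone.id_X (biprod.desc φ (-γ)) j i (by lia), link, fst, snd]
  congr 1
  simp only [HomologicalComplex.comp_f, Category.assoc]
  rw [← Preadditive.comp_add, ← Category.assoc, ← Category.assoc, ← Preadditive.add_comp, h,
    Category.id_comp]

variable {U : C}

/-- Together with `section_ext` this identifies sections in degree `j` with arbitrary triples. For
`j = 0` and `j = -1` these triples are the coordinates of objects and of 1-arrows of the fibered
product. -/
lemma exists_section (x : sec K j U) (y : sec L j U) (l : sec M i U) :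
    ∃ b : sec (homotopyFibre φ γ) j U,
      mor (fst φ γ) b = x ∧ mor (snd φ γ) b = y ∧ ev (link φ γ j i hij) U b = l := by
  let χ := biprod.desc φ (-γ)
  let a₁ := (biprod.inl : K ⟶ K ⊞ L).f j ≫ (mappingCocone.inl χ).v j j (add_zero j)
  let a₂ := (biprod.inr : L ⟶ K ⊞ L).f j ≫ (mappingCocone.inl χ).v j j (add_zero j)
  let a₃ := (mappingCocone.inr χ).1.v i j hij
  have h₁₁ : a₁ ≫ (fst φ γ).f j = 𝟙 _ := by simp [a₁, fst, χ]
  have h₁₂ : a₁ ≫ (snd φ γ).f j = 0 := by simp [a₁, snd, χ]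
  have h₁₃ : a₁ ≫ link φ γ j i hij = 0 := by simp [a₁, link, χ]
  have h₂₁ : a₂ ≫ (fst φ γ).f j = 0 := by simp [a₂, fst, χ]
  have h₂₂ : a₂ ≫ (snd φ γ).f j = 𝟙 _ := by simp [a₂, snd, χ]
  have h₂₃ : a₂ ≫ link φ γ j i hij = 0 := by simp [a₂, link, χ]
  have h₃₁ : a₃ ≫ (fst φ γ).f j = 0 := by simp [a₃, fst, χ]
  have h₃₂ : a₃ ≫ (snd φ γ).f j = 0 := by simp [a₃, snd, χ]
  have h₃₃ : a₃ ≫ link φ γ j i hij = 𝟙 _ := by simp [a₃, link, χ]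
  refine ⟨ev a₁ U x + ev a₂ U y + ev a₃ U l, ?_, ?_, ?_⟩
  · change ev ((fst φ γ).f j) U _ = x
    rw [map_add, map_add, ← ev_comp, ← ev_comp, ← ev_comp, h₁₁, h₂₁, h₃₁, ev_id, ev_zero, ev_zero,
      add_zero, add_zero]
  · change ev ((snd φ γ).f j) U _ = y
    rw [map_add, map_add, ← ev_comp, ← ev_comp, ← ev_comp, h₁₂, h₂₂, h₃₂, ev_id, ev_zero, ev_zero,
      add_zero, zero_add]
  · rw [map_add, map_add, ← ev_comp, ← ev_comp, ← ev_comp, h₁₃, h₂₃, h₃₃, ev_id, ev_zero, ev_zero,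
      add_zero, zero_add]

lemma section_ext {b c : sec (homotopyFibre φ γ) j U}
    (h₁ : mor (fst φ γ) b = mor (fst φ γ) c) (h₂ : mor (snd φ γ) b = mor (snd φ γ) c)
    (h₃ : ev (link φ γ j i hij) U b = ev (link φ γ j i hij) U c) : b = c := by
  rw [← ev_id b, ← ev_id c, ← total j i hij]
  simp only [ev_add, ev_comp]
  change ev ((fst φ γ).f j) U b = ev ((fst φ γ).f j) U c at h₁
  change ev ((snd φ γ).f j) U b = ev ((snd φ γ).f j) U c at h₂
  rw [h₁, h₂, h₃]

end

/-- The homotopy formula for the universal square, which is the third component of the differential.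
It agrees with `prodDif`, so cochains of the homotopy fibre product and coordinates of the fibered
product have the same differential. -/
lemma link_dif {U : C} (i j k : ℤ) (hij : i + 1 = j) (hjk : j + 1 = k)
    (b : sec (homotopyFibre φ γ) j U) :
    ev (link φ γ k j hjk) U (dif _ j k b) =
      mor γ (mor (snd φ γ) b) - mor φ (mor (fst φ γ) b) - dif M i j (ev (link φ γ j i hij) U b) := by
  have h := (homotopy φ γ).mor_sub_mor i j k hij hjk b
  rw [homotopy_hom _ _ _ _ hij, homotopy_hom _ _ _ _ hjk] at h
  exact eq_sub_of_add_eq h.symm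

instance injective_X [∀ i, Injective (K.X i)] [∀ i, Injective (L.X i)] [∀ i, Injective (M.X i)]
    (j : ℤ) : Injective ((homotopyFibre φ γ).X j) := by
  have (i : ℤ) : Injective ((K ⊞ L).X i) :=
    Injective.of_iso (HomologicalComplex.biprodXIso K L i).symm inferInstance
  exact injective_mappingCone_X (biprod.desc φ (-γ)) (j + -1)

end homotopyFibre

end

/-- Forming the cone moves the source down by one degree, to -3, and the shift moves it back. -/
instance isStrictlyGE_homotopyFibre (φ : K ⟶ M) (γ : L ⟶ M) [K.IsStrictlyGE (-2)]
    [L.IsStrictlyGE (-2)] [M.IsStrictlyGE (-2)] :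
    (((mappingCone (biprod.desc φ (-γ)))⟦(-1 : ℤ)⟧).IsStrictlyGE (-2)) := by
  have : (mappingCone (biprod.desc φ (-γ))).IsStrictlyGE (-3) :=
    isStrictlyGE_mappingCone _ (-2) (-2) _
  exact isStrictlyGE_shift _ (-3) _ _ (by simp)

instance isStrictlyGE_fiberedProduct (φ : K ⟶ M) (γ : L ⟶ M) [K.IsStrictlyGE (-2)]
    [L.IsStrictlyGE (-2)] [M.IsStrictlyGE (-2)] : (fiberedProduct φ γ).IsStrictlyGE (-2) := by
  unfold fiberedProduct
  infer_instance

end Cocone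

/-! ### Equivalence with the fibered product. -/

section Equivalence

open CochainComplex

variable {C : Type u} [Category.{v} C] {J : GrothendieckTopology C}

/-- A map to a bounded below complex of injective sheaves which is an isomorphism in cohomology in
degrees `≤ 0` has a cone with exact sections in degrees `≤ 0`. -/
lemma exists_of_dif_eq_mor {E F : CochainComplex (Sheaf J AddCommGrpCat.{max u v}) ℤ} (ψ : E ⟶ F)
    [∀ i, Injective (E.X i)] [∀ i, Injective (F.X i)] [E.IsStrictlyGE (-2)] [F.IsStrictlyGE (-2)]
    (hψ : ∀ i ≤ 0, (mappingCone ψ).ExactAt i) (i j k l : ℤ) (hij : i + 1 = j) (hjk : j + 1 = k)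
    (hkl : k + 1 = l) (hj : j ≤ 0) {U : C} (a : sec E k U) (b : sec F j U)
    (ha : dif E k l a = 0) (hb : dif F j k b = mor ψ a) :
    ∃ (a' : sec E j U) (b' : sec F i U), dif E j k a' = a ∧ mor ψ a' + dif F i j b' = b := by
  have := isStrictlyGE_mappingCone ψ (-2) (-2) (-3)
  have := injective_mappingCone_X ψ
  obtain ⟨c, hc⟩ := exists_dif_eq (mappingCone ψ) (-3) 0 hψ i j k hij hjk hj
    (coneSec ψ j k hjk a b) (dif_coneSec ψ j k l hjk hkl a b ha hb)
  exact exists_of_dif_eq_coneSec ψ i j k hij hjk a b c hc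

variable {E K L M : CochainComplex (Sheaf J AddCommGrpCat.{max u v}) ℤ} {φ : K ⟶ M} {γ : L ⟶ M}

namespace homotopyFibre

section
variable (ψ : E ⟶ homotopyFibre φ γ)

/-- The square that is induced by a morphism to a homotopy fibre product. -/
noncomputable def square : Homotopy ((ψ ≫ snd φ γ) ≫ γ) ((ψ ≫ fst φ γ) ≫ φ) :=
  ((Homotopy.ofEq (assoc _ _ _)).trans ((homotopy φ γ).compLeft ψ)).trans
    (Homotopy.ofEq (assoc _ _ _).symm)

lemma square_hom (j i : ℤ) (hij : i + 1 = j) :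
    (square ψ).hom j i = ψ.f j ≫ link φ γ j i hij := by
  simp [square, homotopy_hom _ _ _ _ hij]

lemma ev_square (j i : ℤ) (hij : i + 1 = j) {U : C} (x : sec E j U) :
    ev ((square ψ).hom j i) U x = ev (link φ γ j i hij) U (mor ψ x) := by
  rw [square_hom _ _ _ hij]; rfl

/-- Exactness of the cone of a morphism to a homotopy fibre product, in coordinates. -/
lemma exists_of_cocycle [∀ i, Injective (E.X i)] [∀ i, Injective (K.X i)]
    [∀ i, Injective (L.X i)] [∀ i, Injective (M.X i)] [E.IsStrictlyGE (-2)]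
    [K.IsStrictlyGE (-2)] [L.IsStrictlyGE (-2)] [M.IsStrictlyGE (-2)]
    (hψ : ∀ i ≤ 0, (mappingCone ψ).ExactAt i) (h i j k l : ℤ) (hhi : h + 1 = i) (hij : i + 1 = j)
    (hjk : j + 1 = k) (hkl : k + 1 = l) (hj : j ≤ 0) {U : C} (a : sec E k U) (x : sec K j U)
    (y : sec L j U) (t : sec M i U) (ha : dif E k l a = 0)
    (hx : dif K j k x = mor (ψ ≫ fst φ γ) a) (hy : dif L j k y = mor (ψ ≫ snd φ γ) a)
    (ht : mor γ y - mor φ x - dif M i j t = ev ((square ψ).hom k j) U a) :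
    ∃ (a' : sec E j U) (x' : sec K i U) (y' : sec L i U) (t' : sec M h U), dif E j k a' = a ∧
      mor (ψ ≫ fst φ γ) a' + dif K i j x' = x ∧ mor (ψ ≫ snd φ γ) a' + dif L i j y' = y ∧
      ev ((square ψ).hom j i) U a' + (mor γ y' - mor φ x' - dif M h i t') = t := by
  have : (homotopyFibre φ γ).IsStrictlyGE (-2) := isStrictlyGE_homotopyFibre φ γ
  -- The triple is a single section `b` of the homotopy fibre product, and the three hypotheses on
  -- its components say that `d b = ψ a`.
  obtain ⟨b, rfl, rfl, rfl⟩ := exists_section (φ := φ) (γ := γ) j i hij x y t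
  obtain ⟨a', b', ha', hb'⟩ := exists_of_dif_eq_mor ψ hψ i j k l hij hjk hkl hj a b ha
    (section_ext k j hjk ((mor_dif _ b).trans hx) ((mor_dif _ b).trans hy)
      ((link_dif i j k hij hjk b).trans (ht.trans (ev_square ψ k j hjk a))))
  refine ⟨a', mor (fst φ γ) b', mor (snd φ γ) b', ev (link φ γ i h hhi) U b', ha', ?_, ?_, ?_⟩
  · rw [← hb', map_add, mor_dif]; rfl
  · rw [← hb', map_add, mor_dif]; rfl
  · rw [← hb', map_add, link_dif h i j hhi hij, ev_square ψ j i hij]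

end

end homotopyFibre

/-- The 2-isomorphism of a fibered product that is given by sections of degree `-2`. -/
noncomputable def prodCellIso {X Y : Tot (secProd φ γ).Obj} {f g : X ⟶ Y} (s : sec K (-2) X.base)
    (t : sec L (-2) X.base) (h : (secCat K).proj (p₁ f) = (secCat K).proj (p₁ g))
    (hs : dif K (-2) (-1) s = av (p₁ g) - av (p₁ f))
    (ht : dif L (-2) (-1) t = av (p₂ g) - av (p₂ f))
    (hc : mor φ s + lv g = lv f + mor γ t) : f ≅ g where
  hom := mkProdCell s t h hs ht hc
  inv := mkProdCell (-s) (-t) h.symm (by rw [map_neg, hs, neg_sub]) (by rw [map_neg, ht, neg_sub])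
    (by rw [map_neg, map_neg]; linear_combination (norm := abel) -hc)
  hom_inv_id := q_ext (add_neg_cancel s) (add_neg_cancel t)
  inv_hom_id := q_ext (neg_add_cancel s) (neg_add_cancel t)

/-- A morphism to a homotopy fibre product which is an isomorphism in cohomology in degrees `≤ 0`
induces an equivalence of 2-stacks. -/
lemma isEquivalence_prodMap [∀ i, Injective (E.X i)] [∀ i, Injective (K.X i)]
    [∀ i, Injective (L.X i)] [∀ i, Injective (M.X i)] [E.IsStrictlyGE (-2)]
    [K.IsStrictlyGE (-2)] [L.IsStrictlyGE (-2)] [M.IsStrictlyGE (-2)]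
    (ψ : E ⟶ homotopyFibre φ γ) (hψ : ∀ i ≤ 0, (mappingCone ψ).ExactAt i) :
    (prodMap (homotopyFibre.square ψ)).IsEquivalence where
  essSurj {U} y := by
    -- Degree 0: an object `(X, l, Y)` is a cocycle of the homotopy fibre product, so with `0` in
    -- degree 1 of `E` it is a cocycle of the cone. A primitive is an object of `E` and a 1-arrow
    -- from its image.
    obtain ⟨a, m, n, t, ha, hm, hn, ht⟩ := homotopyFibre.exists_of_cocycle ψ hψ (-2) (-1) 0 1 2
      rfl rfl rfl rfl le_rfl 0 y.fst.1 y.snd.1 (av y.link.1) (map_zero _)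
      (y.fst.2.trans (map_zero _).symm) (y.snd.2.trans (map_zero _).symm)
      (by rw [dif_link y, sub_self, map_zero])
    refine ⟨⟨a, ha⟩, ⟨mkProdArrow (𝟙 U) m n t ?_ ?_ ?_, rfl⟩⟩
    · rw [res_id]; exact eq_sub_of_add_eq' hm
    · rw [res_id]; exact eq_sub_of_add_eq' hn
    · rw [res_id]
      change dif M (-2) (-1) t = (ev ((homotopyFibre.square ψ).hom 0 (-1)) U a + mor γ n) -
        (mor φ m + av y.link.1)
      linear_combination (norm := abel) -ht
  full {U x x'} g := by
    have hg : (secCat K).proj (p₁ g.1) = 𝟙 U := g.2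
    have h₁ := dif_av (p₁ g.1)
    have h₂ := dif_av (p₂ g.1)
    have h₃ := dif_lv g.1
    rw [hg, res_id] at h₁ h₃
    rw [proj_p₂, hg, res_id] at h₂
    let m : sec K (-1) U := av (p₁ g.1)
    let n : sec L (-1) U := av (p₂ g.1)
    let t : sec M (-2) U := lv g.1
    change dif M (-2) (-1) t = (ev ((homotopyFibre.square ψ).hom 0 (-1)) U x.1 + mor γ n) -
      (mor φ m + ev ((homotopyFibre.square ψ).hom 0 (-1)) U x'.1) at h₃
    -- Degree -1: the 1-arrow with the difference of the objects. The primitive is a 1-arrow `a` and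
    -- a 2-arrow `(r, s)` from its image; its component `t'` lies in degree -3 of `M` and vanishes.
    obtain ⟨a, r, s, t', ha, hr, hs, ht⟩ := homotopyFibre.exists_of_cocycle ψ hψ (-3) (-2) (-1) 0 1
      rfl rfl rfl rfl (by lia) (x'.1 - x.1) m n t (by rw [map_sub, x'.2, x.2, sub_zero])
      (h₁.trans (map_sub _ _ _).symm) (h₂.trans (map_sub _ _ _).symm)
      (by rw [map_sub, h₃]; abel)
    rw [eq_zero_of_isZero (M.isZero_of_isStrictlyGE (-2) (-3)) t', map_zero, sub_zero] at ht
    refine ⟨⟨mkArrow (𝟙 U) a (by rw [res_id]; exact ha), rfl⟩,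
      ⟨prodCellIso r s hg.symm (eq_sub_of_add_eq' hr) (eq_sub_of_add_eq' hs) ?_⟩⟩
    change mor φ r + t = ev ((homotopyFibre.square ψ).hom (-1) (-2)) U a + mor γ s
    rw [← ht]; abel
  bijective {U x x'} f f' := by
    have hf := dif_av f.1
    have hf' := dif_av f'.1
    rw [f.2, res_id] at hf
    rw [f'.2, res_id] at hf'
    let m : sec E (-1) U := av f.1
    let m' : sec E (-1) U := av f'.1
    refine ⟨fun η θ h => cv_ext ?_, fun η => ?_⟩
    · let a : sec E (-2) U := cv η
      let a' : sec E (-2) U := cv θ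
      have h₁ : mor (ψ ≫ homotopyFibre.fst φ γ) a = mor (ψ ≫ homotopyFibre.fst φ γ) a' :=
        congrArg (fun t => cv (q₁ t)) h
      have h₂ : mor (ψ ≫ homotopyFibre.snd φ γ) a = mor (ψ ≫ homotopyFibre.snd φ γ) a' :=
        congrArg (fun t => cv (q₂ t)) h
      -- Degree -3: two 2-arrows with the same image have a difference that is the differential of a
      -- section of `E.X (-3)`, which is zero.
      obtain ⟨c, _, _, _, hc, -⟩ := homotopyFibre.exists_of_cocycle ψ hψ (-5) (-4) (-3) (-2) (-1)
        rfl rfl rfl rfl (by lia) (a - a') 0 0 0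
        (by rw [map_sub, sub_eq_zero]; exact (dif_cv η).trans (dif_cv θ).symm)
        (by rw [map_zero, map_sub, h₁, sub_self]) (by rw [map_zero, map_sub, h₂, sub_self])
        (eq_zero_of_isZero (M.isZero_of_isStrictlyGE (-2) (-3)) _ |>.trans
          (eq_zero_of_isZero (M.isZero_of_isStrictlyGE (-2) (-3)) _).symm)
      rw [eq_zero_of_isZero (E.isZero_of_isStrictlyGE (-2) (-3)) c, map_zero] at hc
      exact sub_eq_zero.1 hc.symm
    · let r : sec K (-2) U := cv (q₁ η)
      let s : sec L (-2) U := cv (q₂ η)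
      have hr : dif K (-2) (-1) r = mor (ψ ≫ homotopyFibre.fst φ γ) m' -
        mor (ψ ≫ homotopyFibre.fst φ γ) m := dif_cv (q₁ η)
      have hs : dif L (-2) (-1) s = mor (ψ ≫ homotopyFibre.snd φ γ) m' -
        mor (ψ ≫ homotopyFibre.snd φ γ) m := dif_cv (q₂ η)
      have ht : mor φ r + ev ((homotopyFibre.square ψ).hom (-1) (-2)) U m' =
        ev ((homotopyFibre.square ψ).hom (-1) (-2)) U m + mor γ s := lv_eq η
      -- Degree -2: a 2-arrow is a pair because the third component lies in `M.X (-3)`, whence the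
      -- `0`. The compatibility of the pair with the two links is the third cocycle equation.
      obtain ⟨a, r', s', _, ha, hr', hs', -⟩ := homotopyFibre.exists_of_cocycle ψ hψ (-4) (-3) (-2)
        (-1) 0 rfl rfl rfl rfl (by lia) (m' - m) r s 0
        (by rw [map_sub, sub_eq_zero]; exact hf'.trans hf.symm)
        (hr.trans (map_sub _ _ _).symm) (hs.trans (map_sub _ _ _).symm)
        (by rw [map_zero, map_sub]; linear_combination (norm := abel) -ht)
      rw [eq_zero_of_isZero (K.isZero_of_isStrictlyGE (-2) (-3)) r', map_zero, add_zero] at hr'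
      rw [eq_zero_of_isZero (L.isZero_of_isStrictlyGE (-2) (-3)) s', map_zero, add_zero] at hs'
      exact ⟨mkCell a (f.2.trans f'.2.symm) ha, q_ext hr' hs'⟩

/-- The 2-stack property comes from the injective terms of the resolution, the local equivalence
from the acyclicity of the cone of the quasi-isomorphism `ι`. -/
lemma InjRes.isAssociated {K : CochainComplex (Sheaf J AddCommGrpCat.{max u v}) ℤ}
    [K.IsStrictlyGE (-2)] (R : InjRes K) : R.IsAssociated where
  isPicardTwoStack := by
    have := R.injective
    exact isPicardTwoStack_secPicard
  isLocalEquivalence := by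
    have := R.strictlyGE
    have := R.quasiIso
    exact isLocalEquivalence_secMap R.ι fun i _ => exactAt_mappingCone_of_quasiIso R.ι i

end Equivalence

/-! ### The main theorem. -/

theorem mainTheorem4 {C : Type u} [Category.{v} C] (J : GrothendieckTopology C)
    (A B P : CochainComplex (Sheaf J AddCommGrpCat.{max u v}) ℤ)
    [A.IsStrictlyGE (-2)] [A.IsStrictlyLE 0] [B.IsStrictlyGE (-2)] [B.IsStrictlyLE 0]
    [P.IsStrictlyGE (-2)] [P.IsStrictlyLE 0] (f : A ⟶ P) (g : B ⟶ P)
    (RA : InjRes A) (RB : InjRes B) (RP : InjRes P) (RE : InjRes (fiberedProduct f g))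
    (f' : RA.cx ⟶ RP.cx) (hf : Nonempty (Homotopy (RA.ι ≫ f') (f ≫ RP.ι)))
    (g' : RB.cx ⟶ RP.cx) (hg : Nonempty (Homotopy (RB.ι ≫ g') (g ≫ RP.ι))) :
    RA.IsAssociated ∧ RB.IsAssociated ∧ RP.IsAssociated ∧ RE.IsAssociated ∧
      (prodPicard f' g').IsPicardTwoStack J ∧
      ∃ E : AdditiveFunctor RE.twoStack (prodPicard f' g'), E.functor.IsEquivalence := by 
  have := RA.injective
  have := RB.injective
  have := RP.injective
  have := RE.injective
  have := RA.strictlyGE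
  have := RB.strictlyGE
  have := RP.strictlyGE
  have := RE.strictlyGE
  have := RA.quasiIso
  have := RB.quasiIso
  have := RP.quasiIso
  obtain ⟨hf⟩ := hf
  obtain ⟨hg⟩ := hg
  have : (homotopyFibre f' g').IsStrictlyGE (-2) := isStrictlyGE_homotopyFibre f' g'
  -- A bounded below complex of injectives is K-injective. This is what allows the map from the
  -- truncation to be extended along the resolution `RE.ι`.
  have : (homotopyFibre f' g').IsKInjective := CochainComplex.isKInjective_of_injective _ (-2)
  have : ((CochainComplex.mappingCone (biprod.desc f' (-g')))⟦(-1 : ℤ)⟧).IsKInjective := this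
  -- The resolutions induce a map from the cone of `f - g` to the cone of `f' - g'`. It depends on
  -- the chosen homotopies, but it is a quasi-isomorphism for any choice.
  let e := CochainComplex.mappingCone.mapOfHomotopy (homotopyBiprodDesc hf hg)
  have : QuasiIso e := quasiIso_mapOfHomotopy (homotopyBiprodDesc hf hg)
  let s : ((CochainComplex.mappingCone (biprod.desc f (-g)))⟦(-1 : ℤ)⟧).truncLE 0 ⟶ RE.cx := RE.ι
  have : QuasiIso s := RE.quasiIso
  obtain ⟨ψ, hψ⟩ := exists_hom_exactAt_mappingCone e (-1) s
  exact ⟨RA.isAssociated, RB.isAssociated, RP.isAssociated, RE.isAssociated,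
    isPicardTwoStack_prodPicard f' g', prodMapAdditive (homotopyFibre.square ψ),
    isEquivalence_prodMap ψ hψ⟩
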